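/- Let $p\ge 2$, let $G=(V,E)$ be an undirected graph on $V=\{1,\dots,p\}$, and let $\mathscr S_p^+(G)$ be the set of positive definite $p\times p$ matrices $A$ with $A_{i,j}=0$ whenever $i\ne j$ and $\{i,j\}\notin E$. For a positive definite $A$ let $h_G(A)$ be the unique positive definite matrix with $h_G(A)_{i,j}=A_{i,j}$ if $i=j$ or $\{i,j\}\in E$, and $(h_G(A)^{-1})_{i,j}=0$ if $i\neq j$ and $\{i,j\}\notin E$. Let $X_1,X_2,\dots$ be independent with the elliptical distribution $F=E_p(\mu,S,g)$, i.e. with Lebesgue density $\det(S)^{-1/2}g\{(x-\mu)^TS^{-1}(x-\mu)\}$, where $g:[0,\infty)\to[0,\infty)$ and $S^{-1}\in\mathscr S_p^+(G)$. Let $u_1,u_2$ be real functions on $(0,\infty)$ such that $u_1,u_2$ are non-increasing and $\phi_1(s)=su_1(s)$, $\phi_2(s)=su_2(s)$ are non-decreasing. An M-estimator $(\hat\mu_n,\hat S_n)$ is a sequence of random elements ($\hat S_n$ positive definite) which, with probability tending to one, solves $$0=\sum_{i=1}^n u_1(\hat R_i)(X_i-\hat\mu_n),\qquad \hat S_n=\frac1n\sum_{i=1}^n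 u_2(\hat R_i)(X_i-\hat\mu_n)(X_i-\hat\mu_n)^T,\qquad \hat R_i=(X_i-\hat\mu_n)^T\hat S_n^{-1}(X_i-\hat\mu_n).$$ A graphical M-estimator $(\hat\mu_M,\hat S_M)$ is a sequence of random elements ($\hat S_M$ positive definite) which, with probability tending to one, solves, with $\hat R_{i,M}=(X_i-\hat\mu_M)^T\hat S_M^{-1}(X_i-\hat\mu_M)$, $$0=\sum_{i=1}^n u_1(\hat R_{i,M})(X_i-\hat\mu_M),\qquad (\hat S_M)_{j,k}=\Big\{\frac1n\sum_{i=1}^n u_2(\hat R_{i,M})(X_i-\hat\mu_M)(X_i-\hat\mu_M)^T\Big\}_{j,k}\ \text{ if } j=k \text{ or } \{j,k\}\in E,$$ and $(\hat S_M^{-1})_{j,k}=0$ if $j\ne k$ and $\{j,k\}\notin E$. Both systems have the form $n^{-1}\sum_{i=1}^n\psi_j(X_i;\hat\theta)=0$, $j=1,\dots,l$, $\hat\theta\in\Theta$. For the first, $\theta$ consists of the location and the entries of the scatter matrix on and below the diagonal; for the second, of the location and the diagonal and sub-diagonal edge entries of the inverse scatter matrix; $\Theta$ is given by positive definiteness.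 Assume that for each of the two systems: (I) $E_F\psi(X;\theta)=0$ has exactly one solution $\theta_F\in\Theta$; (II) every sequence $\hat\theta$ of random vectors solving the system with probability tending to one converges to $\theta_F$ in probability; (III) the partial derivatives $\partial\psi_j(x;\theta_F)/\partial\theta_k$ exist for $F$-almost all $x$, and for every sequence $\hat\theta$ as in (II) there are $r_{j,k,n}\to0$ in probability such that, with probability tending to one, for all $j$, $$0=\frac1n\sum_{i=1}^n\psi_j(X_i;\theta_F)+\sum_{k=1}^l(\hat\theta_k-\theta_{F,k})\Big[\frac1n\sum_{i=1}^n\frac{\partial\psi_j(X_i;\theta_F)}{\partial\theta_k}+r_{j,k,n}\Big];$$ (IV) the expectations $E_F\{\partial\psi_j(X;\theta_F)/\partial\theta_k\}$ and $E_F\{\psi_j(X;\theta_F)\psi_k(X;\theta_F)\}$ exist. Let $(\mu_F,V_F)$ be the location and scatter given by $\theta_F$ for the first system and $R=(X-\mu_F)^TV_F^{-1}(X-\mu_F)$ with $X\sim F$. Assume that $u_1$ is not identically zero on $(0,\infty)$, that $\phi_2'(R)>0$ with positive probability and, if $p=2$, that also $\phi_1'(R)>0$ with positive probability. Then the plug-in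 estimator $(\hat\mu_P,\hat S_P)=(\hat\mu_n,h_G(\hat S_n))$ and the graphical M-estimator are asymptotically equivalent: $$\sqrt n\,\{(\hat\mu_P,\operatorname{vec}\hat S_P)-(\hat\mu_M,\operatorname{vec}\hat S_M)\}\to0\quad\text{in probability.}$$ -/

import Mathlib

open MeasureTheory ProbabilityTheory Filter Topology

noncomputable section

namespace GraphicalM

/-! ### Matrices with a prescribed zero pattern -/

/-- The set `S_p^+(G)`: positive definite matrices that vanish at every off-diagonal position which
is not an edge of `G`. -/
def posDefGraph {p : ℕ} (G : SimpleGraph (Fin p)) : Set (Matrix (Fin p) (Fin p) ℝ) :=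
  {A | A.PosDef ∧ ∀ i j, i ≠ j → ¬ G.Adj i j → A i j = 0}

/-- `B` is positive definite, agrees with `A` on the diagonal and at the edges of `G`, and `B⁻¹`
vanishes at the non-edges. -/
def IsGraphCompletion {p : ℕ} (G : SimpleGraph (Fin p)) (A B : Matrix (Fin p) (Fin p) ℝ) : Prop :=
  B.PosDef ∧ (∀ i j, (i = j ∨ G.Adj i j) → B i j = A i j) ∧
    ∀ i j, i ≠ j → ¬ G.Adj i j → B⁻¹ i j = 0

open Classical in
/-- The map `h_G`. For positive definite `A` the completion exists and is unique; the value `0`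
is used only where no completion exists. -/
def hG {p : ℕ} (G : SimpleGraph (Fin p)) (A : Matrix (Fin p) (Fin p) ℝ) :
    Matrix (Fin p) (Fin p) ℝ :=
  if h : ∃ B, IsGraphCompletion G A B then h.choose else 0

open Classical in
/-- The set `K(G)` of the diagonal positions and the sub-diagonal edge positions. For the complete
graph `⊤` these are all positions on and below the diagonal. -/
def kPos {p : ℕ} (G : SimpleGraph (Fin p)) : Finset (Fin p × Fin p) :=
  Finset.univ.filter fun q => q.1 = q.2 ∨ (q.2 < q.1 ∧ G.Adj q.1 q.2)

/-- The symmetric matrix with the entries `k` at the positions `K(G)` and zeros at the positions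
of the non-edges. -/
def symMat {p : ℕ} (G : SimpleGraph (Fin p)) (k : kPos G → ℝ) : Matrix (Fin p) (Fin p) ℝ :=
  Matrix.of fun i j =>
    if h : (i, j) ∈ kPos G then k ⟨(i, j), h⟩
    else if h : (j, i) ∈ kPos G then k ⟨(j, i), h⟩
    else 0

/-! ### Elliptical distributions -/

/-- The quadratic form `(x - m)ᵀ K (x - m)`. -/
def sqDist {p : ℕ} (m : Fin p → ℝ) (K : Matrix (Fin p) (Fin p) ℝ) (x : Fin p → ℝ) : ℝ :=
  (x - m) ⬝ᵥ (K.mulVec (x - m))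

/-- The measure `E_p(μ, S, g)` with Lebesgue density
`det(S)^{-1/2} g((x - μ)ᵀ S⁻¹ (x - μ))`. -/
def elliptical {p : ℕ} (m : Fin p → ℝ) (S : Matrix (Fin p) (Fin p) ℝ) (g : ℝ → ℝ) :
    Measure (Fin p → ℝ) :=
  volume.withDensity fun x =>
    ENNReal.ofReal ((Real.sqrt S.det)⁻¹ * g (sqDist m S⁻¹ x))

/-! ### M-estimators of location and scatter -/

/-- `n⁻¹ ∑ u₂(R_i) (x_i - m)(x_i - m)ᵀ` with `R_i = (x_i - m)ᵀ S⁻¹ (x_i - m)`. -/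
def weightedScatter {p : ℕ} (u₂ : ℝ → ℝ) (n : ℕ) (x : ℕ → Fin p → ℝ) (m : Fin p → ℝ)
    (S : Matrix (Fin p) (Fin p) ℝ) : Matrix (Fin p) (Fin p) ℝ :=
  (n : ℝ)⁻¹ • ∑ i ∈ Finset.range n,
    u₂ (sqDist m S⁻¹ (x i)) • Matrix.vecMulVec (x i - m) (x i - m)

/-- `(m, S)` solves the simultaneous M-estimating equations of location and scatter for the sample
`x 0, …, x (n - 1)`. -/
def IsMEstimate {p : ℕ} (u₁ u₂ : ℝ → ℝ) (n : ℕ) (x : ℕ → Fin p → ℝ) (m : Fin p → ℝ)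
    (S : Matrix (Fin p) (Fin p) ℝ) : Prop :=
  S.PosDef ∧
  (0 = ∑ i ∈ Finset.range n, u₁ (sqDist m S⁻¹ (x i)) • (x i - m)) ∧
  S = weightedScatter u₂ n x m S

/-- `(m, S)` solves the graphical M-estimating equations under `G` for the sample
`x 0, …, x (n - 1)`. -/
def IsGraphicalMEstimate {p : ℕ} (G : SimpleGraph (Fin p)) (u₁ u₂ : ℝ → ℝ) (n : ℕ)
    (x : ℕ → Fin p → ℝ) (m : Fin p → ℝ) (S : Matrix (Fin p) (Fin p) ℝ) : Prop :=
  S.PosDef ∧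
  (0 = ∑ i ∈ Finset.range n, u₁ (sqDist m S⁻¹ (x i)) • (x i - m)) ∧
  (∀ j k, (j = k ∨ G.Adj j k) → S j k = weightedScatter u₂ n x m S j k) ∧
  ∀ j k, j ≠ k → ¬ G.Adj j k → S⁻¹ j k = 0

/-- The monotonicity conditions on the weight functions. -/
structure WeightConditions (u₁ u₂ : ℝ → ℝ) : Prop where
  u₁_anti : AntitoneOn u₁ (Set.Ioi 0)
  u₂_anti : AntitoneOn u₂ (Set.Ioi 0)
  φ₁_mono : MonotoneOn (fun s => s * u₁ s) (Set.Ioi 0)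
  φ₂_mono : MonotoneOn (fun s => s * u₂ s) (Set.Ioi 0)

/-! ### General M-estimating equations `ave ψ_j(X_i; θ) = 0` -/

section General

variable {Ω E ι : Type*}

/-- The average over `i = 0, …, n - 1`. -/
def ave (n : ℕ) (f : ℕ → ℝ) : ℝ := (n : ℝ)⁻¹ * ∑ i ∈ Finset.range n, f i

/-- `θ ∈ Θ` solves `E_F ψ(X; θ) = 0`, the expectations being well defined. -/
def IsMFunctional [MeasurableSpace E] (F : Measure E) (ψ : E → (ι → ℝ) → ι → ℝ)
    (Θ : Set (ι → ℝ)) (θ : ι → ℝ) : Prop :=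
  θ ∈ Θ ∧ ∀ j, Integrable (fun x => ψ x θ j) F ∧ ∫ x, ψ x θ j ∂F = 0

/-- A sequence of random vectors which solve the M-estimating equations with probability tending
to one. -/
def IsMEstimatorSeq [MeasurableSpace Ω] (P : Measure Ω) (X : ℕ → Ω → E)
    (ψ : E → (ι → ℝ) → ι → ℝ) (Θ : Set (ι → ℝ)) (θhat : ℕ → Ω → ι → ℝ) : Prop :=
  (∀ n, Measurable (θhat n)) ∧
  Tendsto (fun n => P {ω | ¬ (θhat n ω ∈ Θ ∧ ∀ j, ave n (fun i => ψ (X i ω) (θhat n ω) j) = 0)})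
    atTop (𝓝 0)

/-- The partial derivative `∂ψ_j(x; θ)/∂θ_k`. -/
def partialPsi [DecidableEq ι] (ψ : E → (ι → ℝ) → ι → ℝ) (θ : ι → ℝ) (j k : ι) (x : E) : ℝ :=
  deriv (fun t => ψ x (Function.update θ k t) j) (θ k)

/-- The M-estimation regularity conditions for the estimating function `ψ` on the parameter set
`Θ` at the distribution `F`, with `θF` the population value. -/
structure MRegular [MeasurableSpace Ω] [MeasurableSpace E] [Fintype ι] [DecidableEq ι]
    (P : Measure Ω) (X : ℕ → Ω → E) (F : Measure E) (ψ : E → (ι → ℝ) → ι → ℝ)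
    (Θ : Set (ι → ℝ)) (θF : ι → ℝ) : Prop where
  /-- `θF` solves the M-functional equation … -/
  solution : IsMFunctional F ψ Θ θF
  /-- … and is its only solution. -/
  unique : ∀ θ, IsMFunctional F ψ Θ θ → θ = θF
  /-- Any sequence of M-estimates is consistent. -/
  consistent : ∀ θhat, IsMEstimatorSeq P X ψ Θ θhat →
    TendstoInMeasure P θhat atTop (fun _ => θF)
  /-- The partial derivatives at `θF` exist almost surely. -/
  differentiable : ∀ j k, ∀ᵐ x ∂F,
    DifferentiableAt ℝ (fun t => ψ x (Function.update θF k t) j) (θF k)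
  /-- The linear expansion of the estimating equations about `θF`. -/
  expansion : ∀ θhat, IsMEstimatorSeq P X ψ Θ θhat →
    ∃ r : ι → ι → ℕ → Ω → ℝ,
      (∀ j k, TendstoInMeasure P (r j k) atTop (fun _ => 0)) ∧
      Tendsto (fun n => P {ω | ¬ ∀ j, 0 = ave n (fun i => ψ (X i ω) θF j) +
          ∑ k, (θhat n ω k - θF k) *
            (ave n (fun i => partialPsi ψ θF j k (X i ω)) + r j k n ω)})
        atTop (𝓝 0)
  /-- The expectations of the partial derivatives exist. -/
  integrable_partial : ∀ j k, Integrable (partialPsi ψ θF j k) F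
  /-- The second moments of the estimating function exist. -/
  integrable_mul : ∀ j k, Integrable (fun x => ψ x θF j * ψ x θF k) F

end General

/-! ### The two estimating functions -/

/-- Parameter vectors: a location in `ℝ^p` and the entries of a symmetric matrix at `K(G)`. -/
abbrev Idx {p : ℕ} (G : SimpleGraph (Fin p)) : Type := Fin p ⊕ kPos G

/-- The location part of a parameter vector. -/
def locPart {p : ℕ} {G : SimpleGraph (Fin p)} (θ : Idx G → ℝ) : Fin p → ℝ :=
  fun j => θ (Sum.inl j)

/-- The matrix part of a parameter vector. -/
def matPart {p : ℕ} {G : SimpleGraph (Fin p)} (θ : Idx G → ℝ) : Matrix (Fin p) (Fin p) ℝ :=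
  symMat G fun q => θ (Sum.inr q)

/-- The parameter vectors whose matrix part is positive definite. -/
def paramSet {p : ℕ} (G : SimpleGraph (Fin p)) : Set (Idx G → ℝ) :=
  {θ | (matPart θ).PosDef}

/-- The vector made of `u₁(R)(x - m)` and of the entries of `u₂(R)(x - m)(x - m)ᵀ - S` at the
positions `K(G)`, where `R = (x - m)ᵀ S⁻¹ (x - m)`. -/
def score {p : ℕ} (G : SimpleGraph (Fin p)) (u₁ u₂ : ℝ → ℝ) (x m : Fin p → ℝ)
    (S : Matrix (Fin p) (Fin p) ℝ) : Idx G → ℝ :=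
  Sum.elim
    (fun j => u₁ (sqDist m S⁻¹ x) * (x j - m j))
    (fun q => u₂ (sqDist m S⁻¹ x) * ((x q.1.1 - m q.1.1) * (x q.1.2 - m q.1.2)) - S q.1.1 q.1.2)

/-- The estimating function of the unrestricted M-estimator, with parameter `(μ, v(S))`: all
entries of `S` on and below the diagonal. -/
def psiFull {p : ℕ} (u₁ u₂ : ℝ → ℝ) (x : Fin p → ℝ) (θ : Idx (⊤ : SimpleGraph (Fin p)) → ℝ) :
    Idx (⊤ : SimpleGraph (Fin p)) → ℝ :=
  score ⊤ u₁ u₂ x (locPart θ) (matPart θ)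

/-- The estimating function of the graphical M-estimator, with parameter `(μ, k)`, where `k` holds
the free entries of the concentration matrix `S⁻¹`. -/
def psiGraph {p : ℕ} (G : SimpleGraph (Fin p)) (u₁ u₂ : ℝ → ℝ) (x : Fin p → ℝ)
    (θ : Idx G → ℝ) : Idx G → ℝ :=
  score G u₁ u₂ x (locPart θ) (matPart θ)⁻¹

/-- The weight functions are not degenerate at `F`, where `R = (X - m)ᵀ V⁻¹ (X - m)` with `X ∼ F`:
`u₁` is not the zero function, `φ₂'(R) > 0` with positive probability, and in dimension two also
`φ₁'(R) > 0` with positive probability. -/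
structure NonDegenerate {p : ℕ} (F : Measure (Fin p → ℝ)) (u₁ u₂ : ℝ → ℝ) (m : Fin p → ℝ)
    (V : Matrix (Fin p) (Fin p) ℝ) : Prop where
  u₁_ne_zero : ∃ s > 0, u₁ s ≠ 0
  φ₁_deriv : p = 2 → F {x | 0 < deriv (fun s => s * u₁ s) (sqDist m V⁻¹ x)} ≠ 0
  φ₂_deriv : F {x | 0 < deriv (fun s => s * u₂ s) (sqDist m V⁻¹ x)} ≠ 0

end GraphicalM

end

/-! Let `F` be the elliptical law and `V` the population scatter. With `S = T Tᵀ` and `O`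
orthogonal, the maps `x ↦ μ + T O T⁻¹ (x - μ)` preserve `F`. The population equations are affine
equivariant, so uniqueness makes their solution invariant under all these maps, which forces
location `μ` and `V = η S` (`PopSolution.eq_elliptical`). Hence `V⁻¹` has the zero pattern of `G`,
the pair `(μ, V⁻¹)` also solves the graphical population equations, and at this point the graphical
score is a subvector of the full score. To first order both estimators are therefore driven by the
same averages `a`, which are of order `n^{-1/2}` by Chebyshev's inequality (`ave_tight`).

After standardization, rotational invariance determines the expected derivatives: location and
scatter decouple by oddness, and the fourth moments have a single free constant. A change `(w, L)`
of location and concentration matrix changes the expected score by `δ w` and `(1 + 2κ) V L V + κ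
tr(L V) V` (`exists_coefficients`). Both systems have the same `δ`, `κ`; the graphical one only
reads the second expression on the pattern, that is, on the diagonal and at the edges. The weight
conditions make `δ`, `1 + 2κ` and `1 + 2κ + pκ` non-zero, and then both derivatives are injective
(`response_eq_zero`).

Put `H = Sn - V`. The full system gives `(1 + 2κ) H + κ tr(V⁻¹ H) V = a_scat + o(a)`, where `a_scat`
is the scatter part of `a`. If `L` is the deviation of the concentration matrix of `hG G Sn` from
`V⁻¹`, then `-V L V = H + o(a)` on the pattern. Since `V⁻¹` vanishes off the pattern, the trace only
sees the pattern, so `tr(V⁻¹ H) = -tr(L V) + o(a)`. Thus the plug-in estimator satisfies the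
linearized graphical equations (`plugIn_expansion`). Subtracting those of the graphical M-estimator
and inverting the derivative shows that the two differ by `o(a)` (`isLittleO_plugIn_sub`), and `√n
a` is bounded in probability. All `o` and `O` relations between random quantities are taken along
`probFilter`. -/

noncomputable section

namespace GraphicalM

/-! ### Symmetric matrices with a zero pattern -/

section Pattern

variable {p : ℕ} {G : SimpleGraph (Fin p)}

/-- `M` vanishes at the non-edges of `G`. -/
def Supported (G : SimpleGraph (Fin p)) (M : Matrix (Fin p) (Fin p) ℝ) : Prop :=
  ∀ i j, i ≠ j → ¬ G.Adj i j → M i j = 0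

theorem mem_kPos {i j : Fin p} : (i, j) ∈ kPos G ↔ i = j ∨ (j < i ∧ G.Adj i j) := by
  simp [kPos]

theorem adj_of_mem_kPos {q : Fin p × Fin p} (h : q ∈ kPos G) : q.1 = q.2 ∨ G.Adj q.1 q.2 := by
  rcases mem_kPos.1 h with h | h
  · exact Or.inl h
  · exact Or.inr h.2

theorem mem_kPos_or {i j : Fin p} (h : i = j ∨ G.Adj i j) :
    (i, j) ∈ kPos G ∨ (j, i) ∈ kPos G := by
  rcases h with h | h
  · exact Or.inl (mem_kPos.2 (Or.inl h))
  · rcases lt_trichotomy i j with hij | hij | hij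
    · exact Or.inr (mem_kPos.2 (Or.inr ⟨hij, h.symm⟩))
    · exact Or.inl (mem_kPos.2 (Or.inl hij))
    · exact Or.inl (mem_kPos.2 (Or.inr ⟨hij, h⟩))

theorem symMat_apply_mem (k : kPos G → ℝ) (q : kPos G) : symMat G k q.1.1 q.1.2 = k q := by
  simp [symMat, q.2]

theorem symMat_comm (k : kPos G → ℝ) (i j : Fin p) : symMat G k i j = symMat G k j i := by
  by_cases hij : i = j
  · rw [hij]
  by_cases h1 : (i, j) ∈ kPos G
  · have h2 : (j, i) ∉ kPos G := by
      intro h2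
      rw [mem_kPos] at h1 h2
      rcases h1 with h1 | h1
      · exact hij h1
      rcases h2 with h2 | h2
      · exact hij h2.symm
      · exact lt_asymm h1.1 h2.1
    simp [symMat, h1, h2]
  · by_cases h2 : (j, i) ∈ kPos G <;> simp [symMat, h1, h2]

theorem symMat_isSymm (k : kPos G → ℝ) : (symMat G k).IsSymm := by
  ext i j
  exact symMat_comm k j i

theorem symMat_supported (k : kPos G → ℝ) : Supported G (symMat G k) := by
  intro i j hij h
  have h1 : (i, j) ∉ kPos G := fun h' => (adj_of_mem_kPos h').elim hij h
  have h2 : (j, i) ∉ kPos G := fun h' =>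
    (adj_of_mem_kPos h').elim (fun e => hij e.symm) (fun e => h e.symm)
  simp [symMat, h1, h2]

/-- A symmetric matrix supported on `G` is determined by its entries at the positions `K(G)`. -/
theorem symMat_entries {M : Matrix (Fin p) (Fin p) ℝ} (hM : M.IsSymm) (hs : Supported G M) :
    symMat G (fun q => M q.1.1 q.1.2) = M := by
  ext i j
  by_cases h : i = j ∨ G.Adj i j
  · rcases mem_kPos_or h with h1 | h1
    · exact symMat_apply_mem (fun q => M q.1.1 q.1.2) ⟨(i, j), h1⟩
    · rw [symMat_comm, symMat_apply_mem (fun q => M q.1.1 q.1.2) ⟨(j, i), h1⟩]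
      exact hM.apply i j
  · push Not at h
    rw [symMat_supported _ i j h.1 h.2, hs i j h.1 h.2]

theorem supported_top (M : Matrix (Fin p) (Fin p) ℝ) : Supported ⊤ M := by
  intro i j hij h
  exact absurd hij (by simpa using h)

/-- Two symmetric matrices which agree at `K(G)` agree on the diagonal and at all edges. -/
theorem eq_on_pattern {M N : Matrix (Fin p) (Fin p) ℝ} (hM : M.IsSymm) (hN : N.IsSymm)
    (h : ∀ q : kPos G, M q.1.1 q.1.2 = N q.1.1 q.1.2) (i j : Fin p) (hij : i = j ∨ G.Adj i j) :
    M i j = N i j := by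
  rcases mem_kPos_or hij with h1 | h1
  · exact h ⟨(i, j), h1⟩
  · rw [← hM.apply i j, ← hN.apply i j]
    exact h ⟨(j, i), h1⟩

/-- The linear map `k ↦ symMat G k`. -/
def symMatLin (G : SimpleGraph (Fin p)) : (kPos G → ℝ) →ₗ[ℝ] Matrix (Fin p) (Fin p) ℝ where
  toFun := symMat G
  map_add' k l := by
    ext i j
    simp only [symMat, Matrix.of_apply, Matrix.add_apply, Pi.add_apply]
    split_ifs <;> simp
  map_smul' c k := by
    ext i j
    simp only [symMat, Matrix.of_apply, Matrix.smul_apply, Pi.smul_apply, RingHom.id_apply]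
    split_ifs <;> simp

theorem symMat_eq_zero {k : kPos G → ℝ} (h : symMat G k = 0) : k = 0 := by
  ext q
  rw [← symMat_apply_mem k q, h]
  rfl

/-- In `tr(N M) = ∑ N i j * M j i` the non-edges drop out. Every argument that recovers a matrix
from its entries on the pattern rests on this pairing. -/
theorem trace_mul_congr {N M M' : Matrix (Fin p) (Fin p) ℝ} (hN : Supported G N)
    (h : ∀ i j, (i = j ∨ G.Adj i j) → M i j = M' i j) : (N * M).trace = (N * M').trace := by
  simp only [Matrix.trace, Matrix.diag, Matrix.mul_apply]
  refine Finset.sum_congr rfl fun i _ => Finset.sum_congr rfl fun j _ => ?_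
  by_cases hij : j = i ∨ G.Adj j i
  · rw [h j i hij]
  · push Not at hij
    rw [hN i j (fun e => hij.1 e.symm) (fun e => hij.2 e.symm)]
    simp

end Pattern

/-! ### Positive definite matrices -/

section PosDef

variable {p : ℕ} {G : SimpleGraph (Fin p)}

open scoped MatrixOrder in
theorem PosDef.exists_factor {V : Matrix (Fin p) (Fin p) ℝ} (hV : V.PosDef) :
    ∃ T : Matrix (Fin p) (Fin p) ℝ, IsUnit T.det ∧ V = T * T.transpose := by
  obtain ⟨B, rfl⟩ := CStarAlgebra.nonneg_iff_eq_star_mul_self.mp hV.posSemidef.nonneg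
  have h := hV.isUnit
  rw [Matrix.isUnit_iff_isUnit_det, Matrix.det_mul] at h
  refine ⟨B.transpose, ?_, ?_⟩
  · rw [Matrix.det_transpose]
    exact isUnit_of_mul_isUnit_right h
  · rw [Matrix.transpose_transpose, Matrix.star_eq_conjTranspose,
      Matrix.conjTranspose_eq_transpose_of_trivial]

/-- With `A = T Tᵀ` and `B = U Uᵀ` the trace is the squared Frobenius norm of `Tᵀ D U`. -/
theorem eq_zero_of_trace_eq_zero {A B D : Matrix (Fin p) (Fin p) ℝ} (hA : A.PosDef) (hB : B.PosDef)
    (hD : D.IsSymm) (h : (D * A * D * B).trace = 0) : D = 0 := by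
  obtain ⟨T, hT, rfl⟩ := PosDef.exists_factor hA
  obtain ⟨U, hU, rfl⟩ := PosDef.exists_factor hB
  have h1 : ((T.transpose * D * U).conjTranspose * (T.transpose * D * U)).trace = 0 := by
    rw [← h, Matrix.conjTranspose_eq_transpose_of_trivial, Matrix.transpose_mul,
      Matrix.transpose_mul, Matrix.transpose_transpose, hD.eq, Matrix.mul_assoc, Matrix.trace_mul_comm]
    simp only [Matrix.mul_assoc]
  rw [Matrix.trace_conjTranspose_mul_self_eq_zero_iff] at h1
  have hT' : IsUnit T.transpose.det := by rwa [Matrix.det_transpose]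
  calc D = T.transpose⁻¹ * (T.transpose * D * U) * U⁻¹ := by
        rw [Matrix.mul_assoc T.transpose, Matrix.nonsing_inv_mul_cancel_left _ _ hT',
          Matrix.mul_nonsing_inv_cancel_right _ _ hU]
    _ = 0 := by rw [h1]; simp

theorem PosDef.isSymm {V : Matrix (Fin p) (Fin p) ℝ} (hV : V.PosDef) : V.IsSymm := by
  have := hV.isHermitian
  rwa [Matrix.IsHermitian, Matrix.conjTranspose_eq_transpose_of_trivial] at this

theorem PosDef.isUnit_det {V : Matrix (Fin p) (Fin p) ℝ} (hV : V.PosDef) : IsUnit V.det :=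
  hV.det_pos.ne'.isUnit

/-- The matrix `B - C` vanishes on the pattern and `B⁻¹ - C⁻¹` off it, so they are orthogonal for
the trace pairing. As `B⁻¹ - C⁻¹ = -B⁻¹ (B - C) C⁻¹`, this pairing is, up to sign, a definite
quadratic form in `B - C`. -/
theorem IsGraphCompletion.unique {A B C : Matrix (Fin p) (Fin p) ℝ}
    (hB : IsGraphCompletion G A B) (hC : IsGraphCompletion G A C) : B = C := by
  have hBu := PosDef.isUnit_det hB.1
  have hCu := PosDef.isUnit_det hC.1
  have hsupp : Supported G (B⁻¹ - C⁻¹) := fun i j hij h => by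
    rw [Matrix.sub_apply, hB.2.2 i j hij h, hC.2.2 i j hij h, sub_zero]
  have h1 : ((B⁻¹ - C⁻¹) * B).trace = ((B⁻¹ - C⁻¹) * C).trace :=
    trace_mul_congr hsupp fun i j h => (hB.2.1 i j h).trans (hC.2.1 i j h).symm
  have h2 : ((B - C) * B⁻¹ * (B - C) * C⁻¹).trace = 0 := by
    have e1 : B⁻¹ - C⁻¹ = -(B⁻¹ * (B - C) * C⁻¹) := by
      rw [Matrix.mul_sub, Matrix.nonsing_inv_mul _ hBu, Matrix.sub_mul, Matrix.one_mul,
        Matrix.mul_nonsing_inv_cancel_right _ _ hCu]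
      abel
    have e2 : ((B⁻¹ - C⁻¹) * (B - C)).trace = 0 := by
      rw [Matrix.mul_sub, Matrix.trace_sub, h1, sub_self]
    rw [e1, Matrix.neg_mul, Matrix.trace_neg, neg_eq_zero, Matrix.trace_mul_comm] at e2
    simpa only [Matrix.mul_assoc] using e2
  have h3 := eq_zero_of_trace_eq_zero hB.1.inv hC.1.inv
    ((PosDef.isSymm hB.1).sub (PosDef.isSymm hC.1)) h2
  exact sub_eq_zero.1 h3

theorem hG_eq {A B : Matrix (Fin p) (Fin p) ℝ} (hB : IsGraphCompletion G A B) : hG G A = B := by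
  have h : ∃ B, IsGraphCompletion G A B := ⟨B, hB⟩
  rw [hG, dif_pos h]
  exact h.choose_spec.unique hB

/-- Injectivity of `L ↦ [α V L V + β tr(L V) V]_G` on symmetric matrices supported on `G`. -/
theorem eq_zero_of_pattern_eq_zero {V L : Matrix (Fin p) (Fin p) ℝ} (hV : V.PosDef)
    (hVG : Supported G V⁻¹) (hL : L.IsSymm) (hLG : Supported G L) {α β : ℝ} (hα : α ≠ 0)
    (hαβ : α + p * β ≠ 0)
    (h : ∀ i j, (i = j ∨ G.Adj i j) →
      α * (V * L * V) i j + β * (L * V).trace * V i j = 0) : L = 0 := by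
  have hu := PosDef.isUnit_det hV
  -- Pairing with `V⁻¹`, which is supported on `G`, yields `(α + p β) tr(L V) = 0`.
  have h1 : (V⁻¹ * (α • (V * L * V) + (β * (L * V).trace) • V)).trace = (V⁻¹ * 0).trace :=
    trace_mul_congr hVG fun i j hij => by simpa using h i j hij
  rw [Matrix.mul_zero, Matrix.trace_zero, Matrix.mul_add, Matrix.mul_smul, Matrix.mul_smul,
    Matrix.nonsing_inv_mul _ hu, Matrix.mul_assoc, Matrix.nonsing_inv_mul_cancel_left _ _ hu,
    Matrix.trace_add, Matrix.trace_smul, Matrix.trace_smul, Matrix.trace_one, smul_eq_mul,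
    smul_eq_mul, Fintype.card_fin] at h1
  have ht : (L * V).trace = 0 := by
    have : (α + p * β) * (L * V).trace = 0 := by linarith
    exact (mul_eq_zero.1 this).resolve_left hαβ
  -- Once the trace term is gone, pairing with `L` itself leaves `tr(L V L V) = 0`.
  have h2 : (L * (V * L * V)).trace = (L * 0).trace :=
    trace_mul_congr hLG fun i j hij => by
      have := h i j hij
      rw [ht, mul_zero, zero_mul, add_zero] at this
      simpa using (mul_eq_zero.1 this).resolve_left hα
  refine eq_zero_of_trace_eq_zero hV hV hL ?_
  simpa [Matrix.mul_assoc] using h2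

/-- On the compact unit sphere, positivity of the quadratic form persists for all nearby matrices;
homogeneity extends it to all non-zero vectors. -/
theorem eventually_posDef {V : Matrix (Fin p) (Fin p) ℝ} (hV : V.PosDef) :
    ∀ᶠ M in 𝓝 V, M.IsSymm → M.PosDef := by
  have hpos : ∀ᶠ M in 𝓝 V, ∀ z ∈ Metric.sphere (0 : Fin p → ℝ) 1, 0 < z ⬝ᵥ (M.mulVec z) := by
    refine (isCompact_sphere _ _).eventually_forall_of_forall_eventually fun z hz => ?_
    have hz0 : z ≠ 0 := by
      rintro rfl
      simp at hz
    have hc : Continuous fun q : Matrix (Fin p) (Fin p) ℝ × (Fin p → ℝ) =>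
        q.2 ⬝ᵥ (q.1.mulVec q.2) :=
      Continuous.dotProduct continuous_snd (continuous_fst.matrix_mulVec continuous_snd)
    refine hc.continuousAt.eventually (lt_mem_nhds ?_)
    simpa using hV.dotProduct_mulVec_pos hz0
  filter_upwards [hpos] with M hM hs
  refine Matrix.PosDef.of_dotProduct_mulVec_pos
    (by rwa [Matrix.IsHermitian, Matrix.conjTranspose_eq_transpose_of_trivial]) fun x hx => ?_
  have hn : 0 < ‖x‖ := norm_pos_iff.2 hx
  have h := hM (‖x‖⁻¹ • x) (by simp [norm_smul, hn.ne'])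
  rw [Matrix.mulVec_smul, smul_dotProduct, dotProduct_smul, smul_eq_mul, smul_eq_mul] at h
  have h' := pos_of_mul_pos_right (pos_of_mul_pos_right h (inv_pos.2 hn).le) (inv_pos.2 hn).le
  simpa using h'

end PosDef

/-! ### Differentiability of the inverse and the map `h_G` near a fixed point -/

section Inverse

variable {p : ℕ} {G : SimpleGraph (Fin p)}

/-- The linear map `h ↦ -V (symMat G h) V`, with values in families of entries. -/
def invDeriv (G : SimpleGraph (Fin p)) (V : Matrix (Fin p) (Fin p) ℝ) :
    (kPos G → ℝ) →L[ℝ] (Fin p → Fin p → ℝ) :=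
  LinearMap.toContinuousLinearMap
    { toFun := fun h i j => -(V * symMatLin G h * V) i j
      map_add' := fun h h' => by
        ext i j
        simp [Matrix.mul_add, Matrix.add_mul, add_comm]
      map_smul' := fun c h => by
        ext i j
        simp }

theorem invDeriv_apply (V : Matrix (Fin p) (Fin p) ℝ) (h : kPos G → ℝ) (i j : Fin p) :
    invDeriv G V h i j = -(V * symMat G h * V) i j := rfl

section LinftyOpNorm

attribute [local instance] Matrix.linftyOpNormedAddCommGroup Matrix.linftyOpNormedRing
  Matrix.linftyOpNormedAlgebra

/-- The derivative of inversion comes from a normed algebra structure on matrices. The values are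
families of entries, so the auxiliary matrix norm does not enter the statement. -/
theorem hasStrictFDerivAt_inv_symMat {k : kPos G → ℝ} (hk : IsUnit (symMat G k).det) :
    HasStrictFDerivAt (fun (l : kPos G → ℝ) (i j : Fin p) => (symMat G l)⁻¹ i j)
      (invDeriv G (symMat G k)⁻¹) k := by
  obtain ⟨U, hU⟩ := (Matrix.isUnit_iff_isUnit_det _).2 hk
  have h1 : HasStrictFDerivAt (fun l => symMat G l) (symMatLin G).toContinuousLinearMap k :=
    (symMatLin G).toContinuousLinearMap.hasStrictFDerivAt
  have h2 := hasStrictFDerivAt_ringInverse (𝕜 := ℝ) U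
  rw [hU] at h2
  have h3 := h2.comp k h1
  let E : Matrix (Fin p) (Fin p) ℝ →ₗ[ℝ] (Fin p → Fin p → ℝ) :=
    { toFun := fun M i j => M i j, map_add' := fun _ _ => rfl, map_smul' := fun _ _ => rfl }
  have h4 := (E.toContinuousLinearMap.hasStrictFDerivAt).comp k h3
  have hUi : ((U⁻¹ : (Matrix (Fin p) (Fin p) ℝ)ˣ) : Matrix (Fin p) (Fin p) ℝ)
      = (symMat G k)⁻¹ := by
    rw [← hU, Matrix.coe_units_inv]
  rw [hUi] at h4
  have hfun : (fun (l : kPos G → ℝ) (i j : Fin p) => (symMat G l)⁻¹ i j) =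
      fun l => E.toContinuousLinearMap (Ring.inverse (symMat G l)) := by
    ext l i j
    rw [← Matrix.nonsing_inv_eq_ringInverse]
    rfl
  rw [hfun]
  refine h4.congr_fderiv ?_
  ext1 h
  ext i j
  rw [invDeriv_apply]
  rfl

end LinftyOpNorm

/-- The entries at `K(G)` of `(symMat G k)⁻¹`. -/
def invEntries (G : SimpleGraph (Fin p)) (k : kPos G → ℝ) : kPos G → ℝ :=
  fun q => (symMat G k)⁻¹ q.1.1 q.1.2

/-- Restriction of a family of entries to `K(G)`. -/
def restrictEntries (G : SimpleGraph (Fin p)) : (Fin p → Fin p → ℝ) →L[ℝ] (kPos G → ℝ) :=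
  LinearMap.toContinuousLinearMap
    { toFun := fun M q => M q.1.1 q.1.2, map_add' := fun _ _ => rfl, map_smul' := fun _ _ => rfl }

theorem hasStrictFDerivAt_invEntries {k : kPos G → ℝ} (hk : IsUnit (symMat G k).det) :
    HasStrictFDerivAt (invEntries G) ((restrictEntries G).comp (invDeriv G (symMat G k)⁻¹)) k :=
  (restrictEntries G).hasStrictFDerivAt.comp k (hasStrictFDerivAt_inv_symMat hk)

/-- Near `V = (symMat G k)⁻¹`, the completion `h_G(A)` is `(symMat G l)⁻¹` for a parameter `l`
which depends smoothly on the entries of `A` at `K(G)`. -/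
theorem exists_hG_param {k : kPos G → ℝ} (hk : (symMat G k).PosDef) :
    ∃ f : (kPos G → ℝ) → (kPos G → ℝ),
      Tendsto f (𝓝 (invEntries G k)) (𝓝 k) ∧
      (fun y => f y - k) =O[𝓝 (invEntries G k)] (fun y => y - invEntries G k) ∧
      (∀ᶠ y in 𝓝 (invEntries G k), invEntries G (f y) = y) ∧
      ∀ᶠ y in 𝓝 (invEntries G k), ∀ A : Matrix (Fin p) (Fin p) ℝ, A.IsSymm →
        (fun q : kPos G => A q.1.1 q.1.2) = y → hG G A = (symMat G (f y))⁻¹ := by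
  have hu := PosDef.isUnit_det hk
  have hD := hasStrictFDerivAt_invEntries hu
  set D := (restrictEntries G).comp (invDeriv G (symMat G k)⁻¹) with hDdef
  -- The derivative sends `h` to the entries of `-V (symMat G h) V` at `K(G)`, where `V = (symMat G
  -- k)⁻¹`. This is the case `α = 1`, `β = 0` of `eq_zero_of_pattern_eq_zero`. An injective
  -- endomorphism in finite dimension is invertible, so the inverse function theorem applies and `f`
  -- is the local inverse.
  have hinj : Function.Injective (D : (kPos G → ℝ) →ₗ[ℝ] (kPos G → ℝ)) := by
    rw [← LinearMap.ker_eq_bot, LinearMap.ker_eq_bot']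
    intro h hh
    refine symMat_eq_zero (eq_zero_of_pattern_eq_zero (G := G) hk.inv ?_ (symMat_isSymm h)
      (symMat_supported h) (α := 1) (β := 0) one_ne_zero (by simp) ?_)
    · rw [Matrix.nonsing_inv_nonsing_inv _ hu]
      exact symMat_supported k
    · intro i j hij
      have hV := PosDef.isSymm hk.inv
      have hs : ((symMat G k)⁻¹ * symMat G h * (symMat G k)⁻¹).IsSymm := by
        rw [Matrix.IsSymm, Matrix.transpose_mul, Matrix.transpose_mul, hV.eq,
          (symMat_isSymm h).eq, Matrix.mul_assoc]
      have := eq_on_pattern (G := G) hs (Matrix.isSymm_zero) (fun q => ?_) i j hij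
      · simpa using this
      · have := congrFun hh q
        simpa [hDdef, restrictEntries, invDeriv_apply] using this
  let D' : (kPos G → ℝ) ≃L[ℝ] (kPos G → ℝ) :=
    (LinearEquiv.ofInjectiveEndo _ hinj).toContinuousLinearEquiv
  have hDD' : (D' : (kPos G → ℝ) →L[ℝ] (kPos G → ℝ)) = D := by
    ext1 h
    rfl
  rw [← hDD'] at hD
  have hf := hD.localInverse_tendsto
  have hr := hD.eventually_right_inverse
  have hk0 := hD.localInverse_apply_image
  refine ⟨hD.localInverse _ _ _, hf, ?_, hr, ?_⟩
  · have := hD.to_localInverse.hasFDerivAt.isBigO_sub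
    rwa [hk0] at this
  -- Near `k` the inverse of `symMat G (f y)` is positive definite and has the required entries,
  -- hence is a completion. Existence is only needed locally and comes from `f`; uniqueness
  -- identifies it with `hG`.
  · have hpd : ∀ᶠ l in 𝓝 k, (symMat G l).PosDef := by
      have hc : Continuous (symMat G) := (symMatLin G).continuous_of_finiteDimensional
      filter_upwards [hc.continuousAt.eventually (eventually_posDef hk)] with l hl
      exact hl (symMat_isSymm l)
    filter_upwards [hr, hf.eventually hpd] with y h1 h2 A hA hAy
    have hu2 := PosDef.isUnit_det h2
    refine hG_eq ⟨h2.inv, ?_, ?_⟩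
    · refine eq_on_pattern (PosDef.isSymm h2.inv) hA fun q => ?_
      exact (congrFun h1 q).trans (congrFun hAy q).symm
    · rw [Matrix.nonsing_inv_nonsing_inv _ hu2]
      exact symMat_supported _

end Inverse

/-! ### Events with probability tending to one, as a filter -/

section ProbFilter

variable {Ω : Type*} [MeasurableSpace Ω] {P : Measure Ω}

/-- The filter on `ℕ × Ω` of the families of events whose probability tends to one. Convergence
along this filter is convergence in probability. -/
def probFilter (P : Measure Ω) : Filter (ℕ × Ω) where
  sets := {A | Tendsto (fun n => P {ω | ¬ (n, ω) ∈ A}) atTop (𝓝 0)}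
  univ_sets := by simp
  sets_of_superset {A B} hA hAB :=
    tendsto_of_tendsto_of_tendsto_of_le_of_le tendsto_const_nhds hA (fun _ => zero_le)
      fun n => measure_mono fun ω h h' => h (hAB h')
  inter_sets {A B} hA hB := by
    have h : Tendsto (fun n => P {ω | ¬ (n, ω) ∈ A} + P {ω | ¬ (n, ω) ∈ B}) atTop (𝓝 0) := by
      simpa using Tendsto.add hA hB
    refine tendsto_of_tendsto_of_tendsto_of_le_of_le tendsto_const_nhds h (fun _ => zero_le)
      fun n => ?_
    refine (measure_mono fun ω hω => ?_).trans (measure_union_le _ _)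
    by_cases h' : (n, ω) ∈ A
    · exact Or.inr fun h'' => hω ⟨h', h''⟩
    · exact Or.inl h'

theorem eventually_probFilter {s : ℕ × Ω → Prop} :
    (∀ᶠ q in probFilter P, s q) ↔ Tendsto (fun n => P {ω | ¬ s (n, ω)}) atTop (𝓝 0) := Iff.rfl

theorem tendsto_probFilter {E : Type*} [PseudoEMetricSpace E] {f : ℕ → Ω → E} {c : E}
    (h : TendstoInMeasure P f atTop fun _ => c) :
    Tendsto (fun q : ℕ × Ω => f q.1 q.2) (probFilter P) (𝓝 c) := by
  refine EMetric.tendsto_nhds.2 fun ε hε => eventually_probFilter.2 ?_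
  simpa [not_lt] using h ε hε

/-- If `D = o(a)` in probability and `√n a` is bounded in probability, then `√n D → 0` in
probability. -/
theorem tendstoInMeasure_sqrt_smul {E ι : Type*} [Fintype ι] [NormedAddCommGroup E]
    [NormedSpace ℝ E] {D : ℕ × Ω → E} {a : ℕ × Ω → ι → ℝ} (hD : D =o[probFilter P] a)
    (ha : ∀ j, ∀ δ : ENNReal, 0 < δ →
      ∃ M : ℝ, 0 < M ∧ ∀ n : ℕ, P {ω | M ≤ |Real.sqrt n * a (n, ω) j|} ≤ δ) :
    TendstoInMeasure P (fun (n : ℕ) ω => Real.sqrt n • D (n, ω)) atTop fun _ => 0 := by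
  refine tendstoInMeasure_of_ne_top fun ε hε hεt => ENNReal.tendsto_nhds_zero.2 fun δ hδ => ?_
  set e := ε.toReal with he
  have hepos : 0 < e := ENNReal.toReal_pos hε.ne' hεt
  -- Half of `δ` is shared among the coordinates of `√n a`; the `+ 1` keeps the divisor non-zero
  -- when `ι` is empty.
  have hδ' : 0 < δ / 2 / (Fintype.card ι + 1 : ℕ) :=
    ENNReal.div_pos (ENNReal.half_pos hδ.ne').ne' (ENNReal.natCast_ne_top _)
  choose M hM0 hM using fun j => ha j _ hδ'
  obtain ⟨B, hB0, hB⟩ : ∃ B : ℝ, 0 < B ∧ ∀ j, M j ≤ B := by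
    refine ⟨1 + ∑ j, M j, ?_, fun j => ?_⟩
    · have := Finset.sum_nonneg fun j (_ : j ∈ Finset.univ) => (hM0 j).le
      linarith
    · have := Finset.single_le_sum (fun j (_ : j ∈ Finset.univ) => (hM0 j).le) (Finset.mem_univ j)
      linarith
  -- With this constant, `‖√n a‖ ≤ B` implies `‖√n D‖ ≤ e / 2 < e`.
  have h1 := eventually_probFilter.1 (hD.bound (c := e / (2 * B)) (by positivity))
  filter_upwards [ENNReal.tendsto_nhds_zero.1 h1 (δ / 2) (ENNReal.half_pos hδ.ne')] with n hn
  have hsub : {ω | ε ≤ edist (Real.sqrt n • D (n, ω)) 0} ⊆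
      {ω | ¬ ‖D (n, ω)‖ ≤ e / (2 * B) * ‖a (n, ω)‖} ∪
        ⋃ j, {ω | M j ≤ |Real.sqrt n * a (n, ω) j|} := by
    intro ω hω
    by_contra hc
    simp only [Set.mem_union, Set.mem_ofPred_eq, Set.mem_iUnion, not_or, not_exists,
      not_le] at hc
    obtain ⟨hc1, hc2⟩ := hc
    rw [not_lt] at hc1
    have hsn := Real.sqrt_nonneg n
    have h2 : ‖Real.sqrt n • a (n, ω)‖ ≤ B := by
      refine (pi_norm_le_iff_of_nonneg hB0.le).2 fun j => ?_
      simpa using (hc2 j).le.trans (hB j)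
    rw [norm_smul, Real.norm_of_nonneg hsn] at h2
    have h3 : ‖Real.sqrt n • D (n, ω)‖ ≤ e / 2 := by
      rw [norm_smul, Real.norm_of_nonneg hsn]
      calc Real.sqrt n * ‖D (n, ω)‖ ≤ Real.sqrt n * (e / (2 * B) * ‖a (n, ω)‖) := by gcongr
        _ = e / (2 * B) * (Real.sqrt n * ‖a (n, ω)‖) := by ring
        _ ≤ e / (2 * B) * B := by gcongr
        _ = e / 2 := by field_simp
    have h4 : e ≤ ‖Real.sqrt n • D (n, ω)‖ := by
      have : ε ≤ edist (Real.sqrt n • D (n, ω)) 0 := hω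
      rw [edist_zero_right] at this
      simpa [he] using ENNReal.toReal_mono (by simp) this
    linarith
  refine (measure_mono hsub).trans ((measure_union_le _ _).trans ?_)
  calc _ ≤ δ / 2 + ∑ j, P {ω | M j ≤ |Real.sqrt n * a (n, ω) j|} :=
        add_le_add hn (measure_iUnion_fintype_le _ _)
    _ ≤ δ / 2 + ∑ _j : ι, δ / 2 / (Fintype.card ι + 1 : ℕ) := by
        gcongr with j
        exact hM j n
    _ ≤ δ / 2 + δ / 2 := by
        gcongr
        rw [Finset.sum_const, Finset.card_univ, nsmul_eq_mul]
        calc _ ≤ ((Fintype.card ι + 1 : ℕ) : ENNReal) * (δ / 2 / (Fintype.card ι + 1 : ℕ)) := by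
              gcongr
              simp
          _ ≤ δ / 2 := ENNReal.mul_div_le
    _ = δ := ENNReal.add_halves δ

end ProbFilter

/-! ### Averages of an i.i.d. sample -/

section Average

variable {Ω E : Type*} [MeasurableSpace Ω] [MeasurableSpace E] {P : Measure Ω}
  {F : Measure E} {X : ℕ → Ω → E}

theorem aemeasurable_of_law (hlaw : ∀ i, HasLaw (X i) F P) {f : E → ℝ} (hf : AEMeasurable f F)
    (i : ℕ) : AEMeasurable f (P.map (X i)) := by
  rwa [(hlaw i).map_eq]

theorem indep_comp_of_law (hind : iIndepFun X P) (hlaw : ∀ i, HasLaw (X i) F P) {f : E → ℝ}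
    (hf : AEMeasurable f F) : iIndepFun (fun i => f ∘ X i) P :=
  hind.comp₀ (fun _ => f) (fun i => (hlaw i).aemeasurable) (aemeasurable_of_law hlaw hf)

theorem identDistrib_of_law (hlaw : ∀ i, HasLaw (X i) F P) {f : E → ℝ} (hf : AEMeasurable f F)
    (i j : ℕ) : IdentDistrib (f ∘ X i) (f ∘ X j) P P :=
  (IdentDistrib.mk (hlaw i).aemeasurable (hlaw j).aemeasurable
    ((hlaw i).map_eq.trans (hlaw j).map_eq.symm)).comp_of_aemeasurable
      (aemeasurable_of_law hlaw hf i)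

theorem integrable_comp_of_law (hlaw : ∀ i, HasLaw (X i) F P) {f : E → ℝ} (hf : Integrable f F)
    (i : ℕ) : Integrable (f ∘ X i) P := by
  rw [← (hlaw i).map_eq] at hf
  exact hf.comp_aemeasurable (hlaw i).aemeasurable

/-- The weak law of large numbers. -/
theorem tendsto_ave [IsProbabilityMeasure P] (hind : iIndepFun X P) (hlaw : ∀ i, HasLaw (X i) F P) {f : E → ℝ}
    (hf : Integrable f F) :
    Tendsto (fun q : ℕ × Ω => ave q.1 fun i => f (X i q.2)) (probFilter P) (𝓝 (∫ x, f x ∂F)) := by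
  have hfm := hf.aestronglyMeasurable.aemeasurable
  have hInt := integrable_comp_of_law hlaw hf
  have hsl := strong_law_ae_real (fun i => f ∘ X i) (hInt 0)
    (fun i j hij => (indep_comp_of_law hind hlaw hfm).indepFun hij)
    (fun i => identDistrib_of_law hlaw hfm i 0)
  rw [(hlaw 0).integral_comp hf.aestronglyMeasurable] at hsl
  refine tendsto_probFilter (f := fun n ω => ave n fun i => f (X i ω))
    (tendstoInMeasure_of_tendsto_ae (fun n => ?_) ?_)
  · exact (Finset.aestronglyMeasurable_fun_sum _
      fun i _ => (hInt i).aestronglyMeasurable).const_mul _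
  · filter_upwards [hsl] with ω hω
    simpa [ave, div_eq_inv_mul] using hω

/-- Averages of a centred square integrable function are of order `n^{-1/2}`. -/
theorem ave_tight [IsProbabilityMeasure P] (hind : iIndepFun X P) (hlaw : ∀ i, HasLaw (X i) F P) {f : E → ℝ}
    (hf : Integrable f F) (hf2 : Integrable (fun x => f x * f x) F) (hf0 : ∫ x, f x ∂F = 0)
    (δ : ENNReal) (hδ : 0 < δ) :
    ∃ M : ℝ, 0 < M ∧ ∀ n : ℕ,
      P {ω | M ≤ |Real.sqrt n * ave n fun i => f (X i ω)|} ≤ δ := by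
  have hfm := hf.aestronglyMeasurable.aemeasurable
  have hInt := integrable_comp_of_law hlaw hf
  have hL2 : ∀ i, MemLp (f ∘ X i) 2 P := fun i => by
    rw [memLp_two_iff_integrable_sq (hInt i).aestronglyMeasurable]
    simpa [pow_two, Function.comp_def] using integrable_comp_of_law hlaw hf2 i
  set σ := variance (f ∘ X 0) P with hσ
  have hσ0 : 0 ≤ σ := variance_nonneg _ _
  have hvar : ∀ n : ℕ, variance (∑ i ∈ Finset.range n, f ∘ X i) P = n * σ := fun n => by
    rw [IndepFun.variance_sum (fun i _ => hL2 i)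
      fun i _ j _ hij => (indep_comp_of_law hind hlaw hfm).indepFun hij,
      Finset.sum_congr rfl fun i _ => (identDistrib_of_law hlaw hfm i 0).variance_eq]
    simp [hσ]
  have hmean : ∀ n : ℕ, P[∑ i ∈ Finset.range n, f ∘ X i] = 0 := fun n => by
    simp only [Finset.sum_apply]
    rw [integral_finsetSum _ fun i _ => hInt i]
    refine Finset.sum_eq_zero fun i _ => ?_
    rw [(hlaw i).integral_comp hf.aestronglyMeasurable, hf0]
  obtain ⟨M, hM0, hM⟩ : ∃ M : ℝ, 0 < M ∧ ENNReal.ofReal (σ / M ^ 2) ≤ δ := by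
    have ht : Tendsto (fun M : ℝ => ENNReal.ofReal (σ / M ^ 2)) atTop (𝓝 0) := by
      rw [← ENNReal.ofReal_zero]
      exact ENNReal.tendsto_ofReal (tendsto_const_nhds.div_atTop (tendsto_pow_atTop two_ne_zero))
    exact ((eventually_gt_atTop 0).and (ENNReal.tendsto_nhds_zero.1 ht δ hδ)).exists
  refine ⟨M, hM0, fun n => ?_⟩
  rcases Nat.eq_zero_or_pos n with rfl | hn
  · simp [hM0.not_ge]
  have hn' : (0 : ℝ) < n := by exact_mod_cast hn
  have hs : 0 < Real.sqrt n := Real.sqrt_pos.2 hn'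
  -- Chebyshev's inequality for the sum at level `√n * M`: the ratio of `n * σ` to `n * M ^ 2` does
  -- not depend on `n`.
  have hcheb := meas_ge_le_variance_div_sq (memLp_finsetSum' _ fun i (_ : i ∈ Finset.range n) =>
    hL2 i) (mul_pos hs hM0)
  rw [hvar, hmean, mul_pow, Real.sq_sqrt hn'.le, mul_div_mul_left _ _ hn'.ne'] at hcheb
  refine (measure_mono fun ω hω => ?_).trans (hcheb.trans hM)
  have hω' : M ≤ |Real.sqrt n * ave n fun i => f (X i ω)| := hω
  simp only [Set.mem_ofPred_eq, sub_zero, Finset.sum_apply, Function.comp_apply]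
  rw [ave, ← mul_assoc, abs_mul, abs_of_nonneg (by positivity)] at hω'
  calc Real.sqrt n * M ≤ Real.sqrt n * (Real.sqrt n * (n : ℝ)⁻¹ *
        |∑ i ∈ Finset.range n, f (X i ω)|) := by gcongr
    _ = _ := by
      rw [← mul_assoc, ← mul_assoc, Real.mul_self_sqrt hn'.le, mul_inv_cancel₀ hn'.ne', one_mul]

end Average

/-! ### Measures invariant under orthogonal transformations -/

section Invariant

variable {p : ℕ} {ν : Measure (Fin p → ℝ)}

/-- `ν` is invariant under all orthogonal transformations. -/
def OrthInvariant (ν : Measure (Fin p → ℝ)) : Prop :=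
  ∀ O : Matrix (Fin p) (Fin p) ℝ, O.transpose * O = 1 → MeasurePreserving O.mulVec ν ν

theorem isUnit_det_of_orthogonal {O : Matrix (Fin p) (Fin p) ℝ} (hO : O.transpose * O = 1) :
    IsUnit O.det := by
  have := congrArg Matrix.det hO
  rw [Matrix.det_mul, Matrix.det_one] at this
  exact IsUnit.of_mul_eq_one_right _ this

theorem measurableEmbedding_mulVec {O : Matrix (Fin p) (Fin p) ℝ} (hO : IsUnit O.det) :
    MeasurableEmbedding O.mulVec :=
  (Continuous.matrix_mulVec continuous_const continuous_id).measurableEmbedding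
    (Matrix.mulVec_injective_iff_isUnit.2 ((Matrix.isUnit_iff_isUnit_det _).2 hO))

theorem OrthInvariant.integral_comp (hν : OrthInvariant ν) {O : Matrix (Fin p) (Fin p) ℝ}
    (hO : O.transpose * O = 1) (f : (Fin p → ℝ) → ℝ) :
    ∫ z, f (O.mulVec z) ∂ν = ∫ z, f z ∂ν :=
  (hν O hO).integral_comp (measurableEmbedding_mulVec (isUnit_det_of_orthogonal hO)) f

theorem dotProduct_mulVec_orthogonal {O : Matrix (Fin p) (Fin p) ℝ} (hO : O.transpose * O = 1)
    (z : Fin p → ℝ) : O.mulVec z ⬝ᵥ O.mulVec z = z ⬝ᵥ z := by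
  rw [Matrix.dotProduct_mulVec, Matrix.vecMul_mulVec, hO, Matrix.vecMul_one]

/-- The integral of an odd function vanishes. -/
theorem OrthInvariant.integral_odd (hν : OrthInvariant ν) {f : (Fin p → ℝ) → ℝ}
    (hf : ∀ z, f (-z) = -f z) : ∫ z, f z ∂ν = 0 := by
  have h := hν.integral_comp (O := -1) (by simp) f
  simp only [Matrix.neg_mulVec, Matrix.one_mulVec, hf, integral_neg] at h
  linarith

/-- The matrix of the reflection `z ↦ z - 2 (v·z)/(v·v) v`. -/
def householder (v : Fin p → ℝ) : Matrix (Fin p) (Fin p) ℝ :=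
  1 - (2 / (v ⬝ᵥ v)) • Matrix.vecMulVec v v

theorem householder_transpose (v : Fin p → ℝ) : (householder v).transpose = householder v := by
  simp [householder, Matrix.transpose_vecMulVec]

theorem householder_orthogonal {v : Fin p → ℝ} (hv : v ⬝ᵥ v ≠ 0) :
    (householder v).transpose * householder v = 1 := by
  rw [householder_transpose, householder, Matrix.mul_sub, Matrix.mul_one, Matrix.sub_mul,
    Matrix.one_mul, Matrix.smul_mul, Matrix.mul_smul, Matrix.vecMulVec_mul_vecMulVec,
    Matrix.vecMulVec_smul, smul_smul, smul_smul]
  have : 2 / (v ⬝ᵥ v) * (2 / (v ⬝ᵥ v)) * (v ⬝ᵥ v) = 2 / (v ⬝ᵥ v) + 2 / (v ⬝ᵥ v) := by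
    field_simp
    norm_num
  rw [this, add_smul]
  abel

theorem householder_mulVec (v z : Fin p → ℝ) (i : Fin p) :
    (householder v).mulVec z i = z i - 2 / (v ⬝ᵥ v) * (v ⬝ᵥ z) * v i := by
  rw [householder, Matrix.sub_mulVec, Matrix.one_mulVec, Matrix.smul_mulVec,
    Matrix.vecMulVec_mulVec]
  simp [mul_comm, mul_assoc]

/-- The change of sign of the coordinate `a`. -/
def flipMat (a : Fin p) : Matrix (Fin p) (Fin p) ℝ := householder (Pi.single a 1)

theorem flipMat_orthogonal (a : Fin p) : (flipMat a).transpose * flipMat a = 1 :=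
  householder_orthogonal (by simp)

theorem flipMat_mulVec_same (a : Fin p) (z : Fin p → ℝ) : (flipMat a).mulVec z a = -z a := by
  rw [flipMat, householder_mulVec]
  simp
  ring

theorem flipMat_mulVec_ne {a i : Fin p} (h : i ≠ a) (z : Fin p → ℝ) :
    (flipMat a).mulVec z i = z i := by
  rw [flipMat, householder_mulVec]
  simp [h]

/-- The exchange of the coordinates `a` and `b`. -/
def swapMat (a b : Fin p) : Matrix (Fin p) (Fin p) ℝ := householder (Pi.single a 1 - Pi.single b 1)

theorem dotProduct_swap {a b : Fin p} (h : a ≠ b) :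
    ((Pi.single a 1 - Pi.single b 1 : Fin p → ℝ) ⬝ᵥ (Pi.single a 1 - Pi.single b 1)) = 2 := by
  simp [h, h.symm]
  norm_num

theorem swapMat_orthogonal {a b : Fin p} (h : a ≠ b) :
    (swapMat a b).transpose * swapMat a b = 1 :=
  householder_orthogonal (by rw [dotProduct_swap h]; norm_num)

theorem swapMat_mulVec_left {a b : Fin p} (h : a ≠ b) (z : Fin p → ℝ) :
    (swapMat a b).mulVec z a = z b := by
  rw [swapMat, householder_mulVec, dotProduct_swap h]
  simp [sub_dotProduct, h]

theorem swapMat_mulVec_right {a b : Fin p} (h : a ≠ b) (z : Fin p → ℝ) :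
    (swapMat a b).mulVec z b = z a := by
  rw [swapMat, householder_mulVec, dotProduct_swap h]
  simp [sub_dotProduct, h.symm]

/-- The reflection along `e_a + 2 e_b`. -/
def mixMat (a b : Fin p) : Matrix (Fin p) (Fin p) ℝ :=
  householder (Pi.single a 1 + (2 : ℝ) • Pi.single b 1)

theorem dotProduct_mix {a b : Fin p} (h : a ≠ b) :
    ((Pi.single a 1 + (2 : ℝ) • Pi.single b 1 : Fin p → ℝ) ⬝ᵥ
      (Pi.single a 1 + (2 : ℝ) • Pi.single b 1)) = 5 := by
  simp [h, h.symm]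
  norm_num

theorem mixMat_orthogonal {a b : Fin p} (h : a ≠ b) :
    (mixMat a b).transpose * mixMat a b = 1 :=
  householder_orthogonal (by rw [dotProduct_mix h]; norm_num)

/-- Sign changes and permutations of coordinates cannot relate the moment of `z_a⁴` to that of `z_a²
z_b²`. This reflection can, and the triple 3, 4, 5 keeps its coefficients rational. -/
theorem mixMat_mulVec_left {a b : Fin p} (h : a ≠ b) (z : Fin p → ℝ) :
    (mixMat a b).mulVec z a = (3 * z a - 4 * z b) / 5 := by
  rw [mixMat, householder_mulVec, dotProduct_mix h]
  simp [add_dotProduct, h]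
  ring

/-! ### Moments of a rotationally invariant measure -/

/-- `∫ w(|z|²) z_a z_b z_c z_d`. -/
def moment (ν : Measure (Fin p → ℝ)) (w : ℝ → ℝ) (a b c d : Fin p) : ℝ :=
  ∫ z, w (z ⬝ᵥ z) * (z a * z b * z c * z d) ∂ν

theorem OrthInvariant.integral_flip (hν : OrthInvariant ν) (a : Fin p) {f : (Fin p → ℝ) → ℝ}
    (hf : ∀ z, f ((flipMat a).mulVec z) = -f z) : ∫ z, f z ∂ν = 0 := by
  have h := hν.integral_comp (flipMat_orthogonal a) f
  simp only [hf, integral_neg] at h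
  linarith

/-- The integrand changes sign with the coordinate `a`, which occurs exactly once. -/
theorem OrthInvariant.moment_eq_zero (hν : OrthInvariant ν) (w : ℝ → ℝ) {a b c d : Fin p}
    (hb : b ≠ a) (hc : c ≠ a) (hd : d ≠ a) : moment ν w a b c d = 0 := by
  refine hν.integral_flip a fun z => ?_
  rw [dotProduct_mulVec_orthogonal (flipMat_orthogonal a), flipMat_mulVec_same,
    flipMat_mulVec_ne hb, flipMat_mulVec_ne hc, flipMat_mulVec_ne hd]
  ring

theorem moment_perm (w : ℝ → ℝ) {a b c d a' b' c' d' : Fin p}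
    (h : ∀ z : Fin p → ℝ, z a * z b * z c * z d = z a' * z b' * z c' * z d') :
    moment ν w a b c d = moment ν w a' b' c' d' := by
  simp only [moment, h]

theorem OrthInvariant.moment_four (hν : OrthInvariant ν) (w : ℝ → ℝ) (a b : Fin p) :
    moment ν w a a a a = moment ν w b b b b := by
  by_cases h : a = b
  · rw [h]
  rw [moment, ← hν.integral_comp (swapMat_orthogonal h)]
  simp only [dotProduct_mulVec_orthogonal (swapMat_orthogonal h), swapMat_mulVec_left h]
  rfl

/-- Invariance under `mixMat` replaces `z_a⁴` by `((3 z_a - 4 z_b) / 5)⁴`. The mixed odd terms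
integrate to zero, leaving `625 M₄ = (81 + 256) M₄ + 864 M₂₂`, that is `M₄ = 3 M₂₂`. -/
theorem OrthInvariant.moment_two_two (hν : OrthInvariant ν) {w : ℝ → ℝ}
    (hw : ∀ a b c d, Integrable (fun z => w (z ⬝ᵥ z) * (z a * z b * z c * z d)) ν) {a b : Fin p}
    (h : a ≠ b) : moment ν w a a a a = 3 * moment ν w a a b b := by
  have e1 := (hw a a a a).const_mul (81 / 625)
  have e2 := (hw b a a a).const_mul (432 / 625)
  have e3 := (hw a a b b).const_mul (864 / 625)
  have e4 := (hw a b b b).const_mul (768 / 625)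
  have e5 := (hw b b b b).const_mul (256 / 625)
  have h1 := integral_add' (((e1.sub e2).add e3).sub e4) e5
  rw [integral_sub' ((e1.sub e2).add e3) e4, integral_add' (e1.sub e2) e3,
    integral_sub' e1 e2] at h1
  replace h1 := Eq.trans (a := moment ν w a a a a) (by
    rw [moment, ← hν.integral_comp (mixMat_orthogonal h)]
    simp only [dotProduct_mulVec_orthogonal (mixMat_orthogonal h), mixMat_mulVec_left h]
    congr 1 with z
    simp only [Pi.add_apply, Pi.sub_apply]
    ring) h1
  simp only [integral_const_mul] at h1
  change moment ν w a a a a = 81 / 625 * moment ν w a a a a - 432 / 625 * moment ν w b a a a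
    + 864 / 625 * moment ν w a a b b - 768 / 625 * moment ν w a b b b
    + 256 / 625 * moment ν w b b b b at h1
  rw [hν.moment_eq_zero w (a := b) h h h, hν.moment_eq_zero w (a := a) h.symm h.symm h.symm,
    hν.moment_four w b a] at h1
  linarith

/-- Fourth moments form an isotropic symmetric tensor, so only the sum over the three pairings of
the indices survives. When all indices agree the three pairings coincide, whence the division by `3`
in `κ`. -/
theorem OrthInvariant.moment_eq (hν : OrthInvariant ν) {w : ℝ → ℝ}
    (hw : ∀ a b c d, Integrable (fun z => w (z ⬝ᵥ z) * (z a * z b * z c * z d)) ν) :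
    ∃ κ : ℝ, ∀ a b c d, moment ν w a b c d = κ * ((if a = b then if c = d then 1 else 0 else 0) +
      (if a = c then if b = d then 1 else 0 else 0) +
      (if a = d then if b = c then 1 else 0 else 0)) := by
  rcases isEmpty_or_nonempty (Fin p) with he | ⟨⟨o⟩⟩
  · exact ⟨0, fun a => (he.false a).elim⟩
  refine ⟨moment ν w o o o o / 3, fun a b c d => ?_⟩
  have h4 : ∀ a, moment ν w a a a a = moment ν w o o o o := fun a => hν.moment_four w a o
  have h22 : ∀ a b, a ≠ b → moment ν w a a b b = moment ν w o o o o / 3 := fun a b h => by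
    rw [← h4 a, hν.moment_two_two hw h]
    ring
  have hz := fun {a b c d : Fin p} => hν.moment_eq_zero w (a := a) (b := b) (c := c) (d := d)
  by_cases hab : a = b
  · subst hab
    by_cases hcd : c = d
    · subst hcd
      by_cases hac : a = c
      · subst hac
        rw [h4]
        simp
        ring
      · rw [h22 a c hac]
        simp [hac]
    · by_cases hca : c = a
      · subst hca
        rw [moment_perm w (a' := d) (b' := c) (c' := c) (d' := c) (fun z => by ring),
          hz hcd hcd hcd]
        simp [hcd]
      · rw [moment_perm w (a' := c) (b' := a) (c' := a) (d' := d) (fun z => by ring),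
          hz (Ne.symm hca) (Ne.symm hca) (Ne.symm hcd)]
        simp [hcd, Ne.symm hca]
  · by_cases hac : a = c
    · subst hac
      by_cases hbd : b = d
      · subst hbd
        rw [moment_perm w (a' := a) (b' := a) (c' := b) (d' := b) (fun z => by ring), h22 a b hab]
        simp [hab]
      · rw [moment_perm w (a' := b) (b' := a) (c' := a) (d' := d) (fun z => by ring),
          hz hab hab (Ne.symm hbd)]
        simp [hab, hbd, Ne.symm hab]
    · by_cases had : a = d
      · subst had
        by_cases hbc : b = c
        · subst hbc
          rw [moment_perm w (a' := a) (b' := a) (c' := b) (d' := b) (fun z => by ring),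
            h22 a b hab]
          simp [hab]
        · rw [moment_perm w (a' := b) (b' := a) (c' := a) (d' := c) (fun z => by ring),
            hz hab hab (Ne.symm hbc)]
          simp [hab, hac, hbc]
      · rw [hz (Ne.symm hab) (Ne.symm hac) (Ne.symm had)]
        simp [hab, hac, had]

/-- The fourth order moments of a rotationally invariant measure. -/
theorem OrthInvariant.integral_quartic (hν : OrthInvariant ν) {w : ℝ → ℝ}
    (hw : ∀ a b c d, Integrable (fun z => w (z ⬝ᵥ z) * (z a * z b * z c * z d)) ν) :
    ∃ κ : ℝ, (∀ (Λ : Matrix (Fin p) (Fin p) ℝ) (a b : Fin p), Λ.IsSymm →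
      ∫ z, w (z ⬝ᵥ z) * (z ⬝ᵥ Λ.mulVec z) * (z a * z b) ∂ν =
        κ * (2 * Λ a b + Λ.trace * (1 : Matrix (Fin p) (Fin p) ℝ) a b)) ∧
      Integrable (fun z => w (z ⬝ᵥ z) * (z ⬝ᵥ z) ^ 2) ν ∧
      ∫ z, w (z ⬝ᵥ z) * (z ⬝ᵥ z) ^ 2 ∂ν = κ * (p * (p + 2)) := by
  obtain ⟨κ, hκ⟩ := hν.moment_eq hw
  have key : ∀ (Λ : Matrix (Fin p) (Fin p) ℝ) (a b : Fin p), Λ.IsSymm →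
      ∫ z, w (z ⬝ᵥ z) * (z ⬝ᵥ Λ.mulVec z) * (z a * z b) ∂ν =
        κ * (2 * Λ a b + Λ.trace * (1 : Matrix (Fin p) (Fin p) ℝ) a b) := by
    intro Λ a b hΛ
    have h1 : ∀ z : Fin p → ℝ, w (z ⬝ᵥ z) * (z ⬝ᵥ Λ.mulVec z) * (z a * z b) =
        ∑ c, ∑ d, Λ c d * (w (z ⬝ᵥ z) * (z a * z b * z c * z d)) := fun z => by
      simp only [dotProduct, Matrix.mulVec, Finset.mul_sum, Finset.sum_mul]
      refine Finset.sum_congr rfl fun c _ => Finset.sum_congr rfl fun d _ => ?_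
      ring
    simp only [h1]
    have hI : ∀ c, Integrable (fun z : Fin p → ℝ =>
        ∑ d, Λ c d * (w (z ⬝ᵥ z) * (z a * z b * z c * z d))) ν := fun c =>
      integrable_finsetSum _ fun d _ => (hw a b c d).const_mul _
    rw [integral_finsetSum _ fun c _ => hI c]
    have h2 : ∀ c, ∫ z, ∑ d, Λ c d * (w (z ⬝ᵥ z) * (z a * z b * z c * z d)) ∂ν =
        ∑ d, Λ c d * moment ν w a b c d := fun c => by
      rw [integral_finsetSum _ fun d _ => (hw a b c d).const_mul _]
      simp only [integral_const_mul]
      rfl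
    simp only [h2, hκ]
    have h3 : ∀ c d, Λ c d * (κ * ((if a = b then if c = d then 1 else 0 else 0) +
      (if a = c then if b = d then 1 else 0 else 0) +
      (if a = d then if b = c then 1 else 0 else 0))) =
      κ * ((if a = b then if c = d then Λ c d else 0 else 0) +
      (if a = c then if b = d then Λ c d else 0 else 0) +
      (if b = c then if a = d then Λ c d else 0 else 0)) := fun c d => by
        split_ifs <;> ring
    simp only [h3, ← Finset.mul_sum, Finset.sum_add_distrib]
    congr 1
    have e1 : ∑ c, ∑ d, (if a = b then if c = d then Λ c d else 0 else 0) =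
        Λ.trace * (1 : Matrix (Fin p) (Fin p) ℝ) a b := by
      by_cases hab : a = b
      · subst hab
        simp [Matrix.trace]
      · simp [hab]
    -- The two crossed pairings contribute `Λ a b` and `Λ b a`, which agree by symmetry.
    have e2 : ∀ a b, ∑ c, ∑ d, (if a = c then if b = d then Λ c d else 0 else 0) = Λ a b := by
      intro a b
      rw [Finset.sum_eq_single a (fun c _ hc => by simp [Ne.symm hc]) (by simp)]
      simp
    rw [e1, e2, e2, hΛ.apply a b]
    ring
  have hsum : ∀ z : Fin p → ℝ, w (z ⬝ᵥ z) * (z ⬝ᵥ z) ^ 2 =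
      ∑ a, ∑ c, w (z ⬝ᵥ z) * (z a * z a * z c * z c) := fun z => by
    rw [pow_two]
    nth_rw 2 [dotProduct]
    nth_rw 2 [dotProduct]
    rw [Finset.sum_mul_sum, Finset.mul_sum]
    refine Finset.sum_congr rfl fun c _ => ?_
    rw [Finset.mul_sum]
    refine Finset.sum_congr rfl fun d _ => ?_
    ring
  have hI : ∀ a, Integrable (fun z : Fin p → ℝ =>
      ∑ c, w (z ⬝ᵥ z) * (z a * z a * z c * z c)) ν := fun a =>
    integrable_finsetSum _ fun c _ => hw a a c c
  simp only [hsum]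
  refine ⟨κ, key, integrable_finsetSum _ fun a _ => hI a, ?_⟩
  rw [integral_finsetSum _ fun a _ => hI a]
  have h2 : ∀ a, ∫ z, ∑ c, w (z ⬝ᵥ z) * (z a * z a * z c * z c) ∂ν =
      ∑ c, moment ν w a a c c := fun a => integral_finsetSum _ fun d _ => hw a a d d
  rw [Finset.sum_congr rfl fun a _ => h2 a]
  -- Over all `a`, `c`, the pairing of equal indices counts `p ^ 2` and the two crossed ones `p`
  -- each.
  simp only [hκ, ← Finset.mul_sum, Finset.sum_add_distrib]
  congr 1
  simp
  ring

/-- Second order moments of a rotationally invariant measure. -/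
theorem OrthInvariant.integral_quadratic (hν : OrthInvariant ν) (hp : p ≠ 0) {w v : ℝ → ℝ}
    (hw : ∀ k j, Integrable (fun z => w (z ⬝ᵥ z) * (z k * z j) +
      v (z ⬝ᵥ z) * (1 : Matrix (Fin p) (Fin p) ℝ) k j) ν) :
    Integrable (fun z => w (z ⬝ᵥ z) * (z ⬝ᵥ z) + p * v (z ⬝ᵥ z)) ν ∧
    ∀ (ω : Fin p → ℝ) (j : Fin p),
      ∫ z, (w (z ⬝ᵥ z) * (ω ⬝ᵥ z) * z j + v (z ⬝ᵥ z) * ω j) ∂ν =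
        (∫ z, (w (z ⬝ᵥ z) * (z ⬝ᵥ z) + p * v (z ⬝ᵥ z)) ∂ν) / p * ω j := by
  -- Only the combination of the `w` and `v` terms is known to be integrable, so the integral is
  -- never split. Sign changes and swaps show that `n` is a multiple of the identity.
  set n : Fin p → Fin p → ℝ := fun k j => ∫ z, (w (z ⬝ᵥ z) * (z k * z j) +
      v (z ⬝ᵥ z) * (1 : Matrix (Fin p) (Fin p) ℝ) k j) ∂ν with hn
  have hoff : ∀ k j, k ≠ j → n k j = 0 := fun k j h => by
    refine hν.integral_flip k fun z => ?_
    rw [dotProduct_mulVec_orthogonal (flipMat_orthogonal k), flipMat_mulVec_same,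
      flipMat_mulVec_ne h.symm, Matrix.one_apply_ne h]
    ring
  have hdiag : ∀ k j, n k k = n j j := fun k j => by
    by_cases h : k = j
    · rw [h]
    simp only [hn]
    rw [← hν.integral_comp (swapMat_orthogonal h)]
    simp only [dotProduct_mulVec_orthogonal (swapMat_orthogonal h), swapMat_mulVec_left h,
      Matrix.one_apply_eq]
  have hsum : ∀ z : Fin p → ℝ, w (z ⬝ᵥ z) * (z ⬝ᵥ z) + p * v (z ⬝ᵥ z) = ∑ k,
      (w (z ⬝ᵥ z) * (z k * z k) + v (z ⬝ᵥ z) * (1 : Matrix (Fin p) (Fin p) ℝ) k k) := fun z => by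
    rw [Finset.sum_add_distrib, ← Finset.mul_sum]
    simp [dotProduct]
  have htot : ∀ j, ∫ z, (w (z ⬝ᵥ z) * (z ⬝ᵥ z) + p * v (z ⬝ᵥ z)) ∂ν = p * n j j := fun j => by
    simp only [hsum]
    rw [integral_finsetSum _ fun k _ => hw k k]
    change ∑ k, n k k = _
    rw [Finset.sum_congr rfl fun k _ => hdiag k j]
    simp
  refine ⟨?_, fun ω j => ?_⟩
  · simp only [hsum]
    exact integrable_finsetSum _ fun k _ => hw k k
  · have h1 : ∀ z : Fin p → ℝ, w (z ⬝ᵥ z) * (ω ⬝ᵥ z) * z j + v (z ⬝ᵥ z) * ω j = ∑ k, ω k *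
        (w (z ⬝ᵥ z) * (z k * z j) + v (z ⬝ᵥ z) * (1 : Matrix (Fin p) (Fin p) ℝ) k j) := fun z => by
      simp only [mul_add, Finset.sum_add_distrib]
      congr 1
      · generalize w (z ⬝ᵥ z) = r
        rw [mul_assoc, dotProduct, Finset.sum_mul, Finset.mul_sum]
        refine Finset.sum_congr rfl fun k _ => ?_
        ring
      · simp [Matrix.one_apply, mul_comm]
    simp only [h1]
    rw [integral_finsetSum _ fun k _ => (hw k j).const_mul _]
    simp only [integral_const_mul]
    change ∑ k, ω k * n k j = _
    rw [Finset.sum_eq_single j (fun k _ hk => by rw [hoff k j hk, mul_zero]) (by simp), htot j]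
    field_simp

end Invariant

/-! ### Standardization of an elliptical distribution -/

section Elliptical

variable {p : ℕ} {m : Fin p → ℝ} {S V T : Matrix (Fin p) (Fin p) ℝ} {g : ℝ → ℝ}

theorem continuous_sqDist (m : Fin p → ℝ) (K : Matrix (Fin p) (Fin p) ℝ) :
    Continuous (sqDist m K) := by
  unfold sqDist
  fun_prop

theorem measurable_density (hg : Measurable g) (m : Fin p → ℝ) (S : Matrix (Fin p) (Fin p) ℝ) :
    Measurable fun x => ENNReal.ofReal ((Real.sqrt S.det)⁻¹ * g (sqDist m S⁻¹ x)) :=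
  ENNReal.measurable_ofReal.comp
    ((hg.comp (continuous_sqDist m S⁻¹).measurable).const_mul _)

theorem elliptical_ac (m : Fin p → ℝ) (S : Matrix (Fin p) (Fin p) ℝ) (g : ℝ → ℝ) :
    elliptical m S g ≪ volume :=
  withDensity_absolutelyContinuous _ _

/-- An affine map with determinant `±1` which leaves the quadratic form invariant preserves the
elliptical distribution. -/
theorem measurePreserving_elliptical (hg : Measurable g) {A : Matrix (Fin p) (Fin p) ℝ}
    (hA : |A.det| = 1)
    (hq : ∀ x, sqDist m S⁻¹ (m + A.mulVec (x - m)) = sqDist m S⁻¹ x) :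
    MeasurePreserving (fun x => m + A.mulVec (x - m)) (elliptical m S g) (elliptical m S g) := by
  have hA0 : A.det ≠ 0 := fun h => by simp [h] at hA
  have hlin : MeasurePreserving (fun x : Fin p → ℝ => A.mulVec x) volume volume := by
    refine ⟨(Continuous.matrix_mulVec continuous_const continuous_id).measurable, ?_⟩
    have := Real.map_matrix_volume_pi_eq_smul_volume_pi hA0
    rw [abs_inv, hA, inv_one, ENNReal.ofReal_one, one_smul] at this
    exact this
  have hvol : MeasurePreserving (fun x => m + A.mulVec (x - m)) volume volume :=
    (measurePreserving_add_left volume m).comp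
      (hlin.comp (measurePreserving_sub_right volume m))
  refine ⟨hvol.measurable, ?_⟩
  ext s hs
  rw [Measure.map_apply hvol.measurable hs, elliptical, withDensity_apply _ hs,
    withDensity_apply _ (hvol.measurable hs),
    ← hvol.setLIntegral_comp_preimage hs (measurable_density hg m S)]
  simp only [hq]

/-- The law of `T⁻¹ (x - m)`. -/
def standardized (F : Measure (Fin p → ℝ)) (m : Fin p → ℝ) (T : Matrix (Fin p) (Fin p) ℝ) :
    Measure (Fin p → ℝ) :=
  F.map fun x => T⁻¹.mulVec (x - m)

theorem measurableEmbedding_standardize (hT : IsUnit T.det) (m : Fin p → ℝ) :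
    MeasurableEmbedding fun x => T⁻¹.mulVec (x - m) := by
  refine Continuous.measurableEmbedding (by fun_prop) fun x y h => ?_
  have hT' : IsUnit T⁻¹.det := Matrix.isUnit_nonsing_inv_det _ hT
  have := Matrix.mulVec_injective_iff_isUnit.2 ((Matrix.isUnit_iff_isUnit_det _).2 hT') h
  exact sub_left_injective this

theorem mulVec_standardize (hT : IsUnit T.det) (m x : Fin p → ℝ) :
    T.mulVec (T⁻¹.mulVec (x - m)) = x - m := by
  rw [Matrix.mulVec_mulVec, Matrix.mul_nonsing_inv _ hT, Matrix.one_mulVec]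

theorem inv_mulVec_mulVec (hT : IsUnit T.det) (z : Fin p → ℝ) :
    T⁻¹.mulVec (T.mulVec z) = z := by
  rw [Matrix.mulVec_mulVec, Matrix.nonsing_inv_mul _ hT, Matrix.one_mulVec]

theorem integral_standardized {F : Measure (Fin p → ℝ)} (hT : IsUnit T.det) (m : Fin p → ℝ)
    (f : (Fin p → ℝ) → ℝ) :
    ∫ z, f (m + T.mulVec z) ∂(standardized F m T) = ∫ x, f x ∂F := by
  rw [standardized, (measurableEmbedding_standardize hT m).integral_map]
  simp only [mulVec_standardize hT, add_sub_cancel]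

theorem integrable_standardized {F : Measure (Fin p → ℝ)} (hT : IsUnit T.det) {m : Fin p → ℝ}
    {f : (Fin p → ℝ) → ℝ} :
    Integrable (fun z => f (m + T.mulVec z)) (standardized F m T) ↔ Integrable f F := by
  rw [standardized, (measurableEmbedding_standardize hT m).integrable_map_iff]
  simp only [Function.comp_def, mulVec_standardize hT, add_sub_cancel]

theorem sqDist_factor (hT : IsUnit T.det) (m z : Fin p → ℝ) :
    sqDist m (T * T.transpose)⁻¹ (m + T.mulVec z) = z ⬝ᵥ z := by
  rw [sqDist, add_sub_cancel_left, Matrix.mul_inv_rev, ← Matrix.mulVec_mulVec,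
    inv_mulVec_mulVec hT, Matrix.dotProduct_mulVec, ← Matrix.transpose_nonsing_inv,
    Matrix.vecMul_transpose, inv_mulVec_mulVec hT]

theorem det_conj_orthogonal (hT : IsUnit T.det) {O : Matrix (Fin p) (Fin p) ℝ}
    (hO : O.transpose * O = 1) : |(T * O * T⁻¹).det| = 1 := by
  have h1 := congrArg Matrix.det hO
  rw [Matrix.det_mul, Matrix.det_transpose, Matrix.det_one] at h1
  rw [Matrix.det_mul, Matrix.det_mul, mul_right_comm, ← Matrix.det_mul,
    Matrix.mul_nonsing_inv _ hT, Matrix.det_one, one_mul]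
  rcases mul_self_eq_one_iff.1 h1 with h | h <;> simp [h]

/-- In the coordinates `T⁻¹ (x - m)` the map is the rotation `O` and the quadratic form is `η` times
the squared Euclidean length. -/
theorem sqDist_conj_orthogonal (hT : IsUnit T.det) {η : ℝ}
    (hS : S⁻¹ = η • (T * T.transpose)⁻¹) {O : Matrix (Fin p) (Fin p) ℝ}
    (hO : O.transpose * O = 1) (x : Fin p → ℝ) :
    sqDist m S⁻¹ (m + (T * O * T⁻¹).mulVec (x - m)) = sqDist m S⁻¹ x := by
  have hsc : ∀ y, sqDist m S⁻¹ y = η * sqDist m (T * T.transpose)⁻¹ y := fun y => by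
    rw [sqDist, hS, Matrix.smul_mulVec, dotProduct_smul, smul_eq_mul]
    rfl
  rw [hsc, hsc, ← Matrix.mulVec_mulVec, ← Matrix.mulVec_mulVec, sqDist_factor hT,
    dotProduct_mulVec_orthogonal hO, ← sqDist_factor hT m (T⁻¹.mulVec (x - m)),
    mulVec_standardize hT, add_sub_cancel]

/-- The standardized elliptical distribution is rotationally invariant. -/
theorem orthInvariant_standardized (hg : Measurable g) (hT : IsUnit T.det) {η : ℝ}
    (hS : S⁻¹ = η • (T * T.transpose)⁻¹) :
    OrthInvariant (standardized (elliptical m S g) m T) := by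
  intro O hO
  have hF := measurePreserving_elliptical (m := m) hg (det_conj_orthogonal hT hO)
    (sqDist_conj_orthogonal hT hS hO)
  have hst := (measurableEmbedding_standardize hT m).measurable
  have hOm : Measurable O.mulVec :=
    (Continuous.matrix_mulVec continuous_const continuous_id).measurable
  refine ⟨hOm, ?_⟩
  rw [standardized, Measure.map_map hOm hst]
  conv_rhs => rw [← hF.map_eq, Measure.map_map hst hF.measurable]
  congr 1
  ext1 x
  simp only [Function.comp_apply, add_sub_cancel_left, ← Matrix.mulVec_mulVec]
  rw [inv_mulVec_mulVec hT]

end Elliptical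

/-! ### Derivatives of the estimating functions -/

section Derivative

variable {p : ℕ} {G : SimpleGraph (Fin p)}

theorem hasDerivAt_sqDist {x m w : Fin p → ℝ} {K L : Matrix (Fin p) (Fin p) ℝ}
    {mt : ℝ → Fin p → ℝ} {Kt : ℝ → Matrix (Fin p) (Fin p) ℝ} {t₀ : ℝ} (hm : mt t₀ = m)
    (hK : Kt t₀ = K) (hKs : K.IsSymm) (hmt : ∀ j, HasDerivAt (fun t => mt t j) (w j) t₀)
    (hKt : ∀ i j, HasDerivAt (fun t => Kt t i j) (L i j) t₀) :
    HasDerivAt (fun t => sqDist (mt t) (Kt t) x)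
      ((x - m) ⬝ᵥ L.mulVec (x - m) - 2 * (w ⬝ᵥ K.mulVec (x - m))) t₀ := by
  have h : HasDerivAt (fun t => ∑ i, (x i - mt t i) * ∑ j, Kt t i j * (x j - mt t j))
      (∑ i, (-w i * ∑ j, Kt t₀ i j * (x j - mt t₀ j) +
        (x i - mt t₀ i) * ∑ j, (L i j * (x j - mt t₀ j) + Kt t₀ i j * -w j))) t₀ := by
    refine HasDerivAt.fun_sum fun i _ => ((hmt i).const_sub (x i)).fun_mul
      (HasDerivAt.fun_sum fun j _ => (hKt i j).fun_mul ((hmt j).const_sub (x j)))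
  have hval : (∑ i, (-w i * ∑ j, Kt t₀ i j * (x j - mt t₀ j) +
        (x i - mt t₀ i) * ∑ j, (L i j * (x j - mt t₀ j) + Kt t₀ i j * -w j))) =
      (x - m) ⬝ᵥ L.mulVec (x - m) - 2 * (w ⬝ᵥ K.mulVec (x - m)) := by
    have hsym : w ⬝ᵥ K.mulVec (x - m) = (x - m) ⬝ᵥ K.mulVec w := by
      rw [Matrix.dotProduct_mulVec, dotProduct_comm, ← Matrix.mulVec_transpose, hKs.eq]
    rw [two_mul]
    nth_rw 2 [hsym]
    rw [hm, hK]
    simp only [dotProduct, Matrix.mulVec, Pi.sub_apply, Finset.sum_add_distrib, mul_add,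
      Finset.sum_neg_distrib, neg_mul, mul_neg]
    ring
  rw [hval] at h
  exact h

/-- The derivative of `u₁(R) (x - m)` in a direction which changes the location by `w` and the
concentration matrix `K` by `L`. -/
def dLoc (u₁ : ℝ → ℝ) (m : Fin p → ℝ) (K : Matrix (Fin p) (Fin p) ℝ) (x w : Fin p → ℝ)
    (L : Matrix (Fin p) (Fin p) ℝ) : Fin p → ℝ :=
  (deriv u₁ (sqDist m K x) * ((x - m) ⬝ᵥ L.mulVec (x - m) - 2 * (w ⬝ᵥ K.mulVec (x - m)))) • (x - m)
    - u₁ (sqDist m K x) • w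

/-- The derivative of `u₂(R) (x - m)(x - m)ᵀ - V` in a direction which changes the location by
`w`, the concentration matrix `K` by `L` and the scatter matrix `V` by `H`. -/
def dScat (u₂ : ℝ → ℝ) (m : Fin p → ℝ) (K : Matrix (Fin p) (Fin p) ℝ) (x w : Fin p → ℝ)
    (L H : Matrix (Fin p) (Fin p) ℝ) : Matrix (Fin p) (Fin p) ℝ :=
  (deriv u₂ (sqDist m K x) * ((x - m) ⬝ᵥ L.mulVec (x - m) - 2 * (w ⬝ᵥ K.mulVec (x - m)))) •
      Matrix.vecMulVec (x - m) (x - m)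
    - u₂ (sqDist m K x) • (Matrix.vecMulVec w (x - m) + Matrix.vecMulVec (x - m) w) - H

/-- The derivative of `score G u₁ u₂ x` at `(m, K⁻¹)` in a direction which changes the location by
`w`, the concentration matrix by `L` and the scatter matrix by `H`. -/
def dScore (G : SimpleGraph (Fin p)) (u₁ u₂ : ℝ → ℝ) (m : Fin p → ℝ)
    (K : Matrix (Fin p) (Fin p) ℝ) (x w : Fin p → ℝ) (L H : Matrix (Fin p) (Fin p) ℝ) :
    Idx G → ℝ :=
  Sum.elim (dLoc u₁ m K x w L) (fun q => dScat u₂ m K x w L H q.1.1 q.1.2)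

theorem hasDerivAt_score {u₁ u₂ : ℝ → ℝ} {x m w : Fin p → ℝ} {K L H : Matrix (Fin p) (Fin p) ℝ}
    {mt : ℝ → Fin p → ℝ} {St : ℝ → Matrix (Fin p) (Fin p) ℝ} {t₀ : ℝ} (hm : mt t₀ = m)
    (hK : (St t₀)⁻¹ = K) (hKs : K.IsSymm) (hmt : ∀ j, HasDerivAt (fun t => mt t j) (w j) t₀)
    (hSt : ∀ i j, HasDerivAt (fun t => St t i j) (H i j) t₀)
    (hKt : ∀ i j, HasDerivAt (fun t => (St t)⁻¹ i j) (L i j) t₀)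
    (hu₁ : DifferentiableAt ℝ u₁ (sqDist m K x)) (hu₂ : DifferentiableAt ℝ u₂ (sqDist m K x))
    (j : Idx G) :
    HasDerivAt (fun t => score G u₁ u₂ x (mt t) (St t) j) (dScore G u₁ u₂ m K x w L H j) t₀ := by
  have hR := hasDerivAt_sqDist (x := x) (Kt := fun t => (St t)⁻¹) hm hK hKs hmt hKt
  have hR0 : sqDist (mt t₀) (St t₀)⁻¹ x = sqDist m K x := by rw [hm, hK]
  have h1 : HasDerivAt (fun t => u₁ (sqDist (mt t) (St t)⁻¹ x)) _ t₀ :=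
    HasDerivAt.comp (h₂ := u₁) t₀ (by rw [hR0]; exact hu₁.hasDerivAt) hR
  have h2 : HasDerivAt (fun t => u₂ (sqDist (mt t) (St t)⁻¹ x)) _ t₀ :=
    HasDerivAt.comp (h₂ := u₂) t₀ (by rw [hR0]; exact hu₂.hasDerivAt) hR
  have hy : ∀ i, HasDerivAt (fun t => x i - mt t i) (-w i) t₀ := fun i => (hmt i).const_sub (x i)
  rcases j with j | q
  · refine (h1.fun_mul (hy j)).congr_deriv ?_
    simp only [dScore, dLoc, Sum.elim_inl, Pi.sub_apply, Pi.smul_apply, smul_eq_mul, hm, hK]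
    ring
  · refine ((h2.fun_mul ((hy q.1.1).fun_mul (hy q.1.2))).fun_sub (hSt q.1.1 q.1.2)).congr_deriv ?_
    simp only [dScore, dScat, Sum.elim_inr, Matrix.sub_apply, Matrix.add_apply, Matrix.smul_apply,
      Matrix.vecMulVec_apply, Pi.sub_apply, smul_eq_mul, hm, hK]
    ring

/-- `dScore` as a linear function of the direction. -/
def dScoreLin (G : SimpleGraph (Fin p)) (u₁ u₂ : ℝ → ℝ) (m : Fin p → ℝ)
    (K : Matrix (Fin p) (Fin p) ℝ) (x : Fin p → ℝ) :
    ((Fin p → ℝ) × Matrix (Fin p) (Fin p) ℝ × Matrix (Fin p) (Fin p) ℝ) →ₗ[ℝ] (Idx G → ℝ) where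
  toFun d := dScore G u₁ u₂ m K x d.1 d.2.1 d.2.2
  map_add' d e := by
    ext j
    rcases j with j | q <;>
      simp only [dScore, dLoc, dScat, Sum.elim_inl, Sum.elim_inr, Prod.fst_add, Prod.snd_add,
        Pi.add_apply, Pi.sub_apply, Pi.smul_apply, Matrix.sub_apply, Matrix.smul_apply, smul_eq_mul,
        Matrix.vecMulVec_apply, Matrix.add_mulVec, dotProduct_add, add_dotProduct,
        Matrix.add_apply] <;> ring
  map_smul' c d := by
    ext j
    rcases j with j | q <;>
      simp only [dScore, dLoc, dScat, Sum.elim_inl, Sum.elim_inr, Prod.smul_fst, Prod.smul_snd,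
        Pi.smul_apply, Pi.sub_apply, Matrix.sub_apply, Matrix.add_apply, Matrix.vecMulVec_apply,
        Matrix.smul_mulVec, dotProduct_smul, smul_dotProduct, Matrix.smul_apply, smul_eq_mul,
        RingHom.id_apply] <;> ring

theorem dScoreLin_apply (u₁ u₂ : ℝ → ℝ) (m : Fin p → ℝ) (K : Matrix (Fin p) (Fin p) ℝ)
    (x w : Fin p → ℝ) (L H : Matrix (Fin p) (Fin p) ℝ) :
    dScoreLin G u₁ u₂ m K x (w, L, H) = dScore G u₁ u₂ m K x w L H := rfl

/-- The location part of a parameter vector, as a linear map. -/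
def locLin (G : SimpleGraph (Fin p)) : (Idx G → ℝ) →ₗ[ℝ] (Fin p → ℝ) where
  toFun := locPart
  map_add' _ _ := rfl
  map_smul' _ _ := rfl

/-- The matrix part of a parameter vector, as a linear map. -/
def matLin (G : SimpleGraph (Fin p)) : (Idx G → ℝ) →ₗ[ℝ] Matrix (Fin p) (Fin p) ℝ where
  toFun := matPart
  map_add' d e := (symMatLin G).map_add (fun q => d (Sum.inr q)) (fun q => e (Sum.inr q))
  map_smul' c d := (symMatLin G).map_smul c (fun q => d (Sum.inr q))

/-- The linear map `M ↦ -A M A`. -/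
def conjNeg (A : Matrix (Fin p) (Fin p) ℝ) :
    Matrix (Fin p) (Fin p) ℝ →ₗ[ℝ] Matrix (Fin p) (Fin p) ℝ where
  toFun M := -(A * M * A)
  map_add' M N := by
    rw [Matrix.mul_add, Matrix.add_mul, neg_add]
  map_smul' c M := by
    simp

theorem conjNeg_apply (A M : Matrix (Fin p) (Fin p) ℝ) : conjNeg A M = -(A * M * A) := rfl

/-- The direction `(w, L, H)` of a change of the parameter `(m, V)`, with `K = V⁻¹`. -/
def dirFull (K : Matrix (Fin p) (Fin p) ℝ) : (Idx (⊤ : SimpleGraph (Fin p)) → ℝ) →ₗ[ℝ]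
    ((Fin p → ℝ) × Matrix (Fin p) (Fin p) ℝ × Matrix (Fin p) (Fin p) ℝ) :=
  (locLin ⊤).prod (((conjNeg K).comp (matLin ⊤)).prod (matLin ⊤))

/-- The direction `(w, L, H)` of a change of the parameter `(m, V⁻¹)`. -/
def dirGraph (G : SimpleGraph (Fin p)) (V : Matrix (Fin p) (Fin p) ℝ) : (Idx G → ℝ) →ₗ[ℝ]
    ((Fin p → ℝ) × Matrix (Fin p) (Fin p) ℝ × Matrix (Fin p) (Fin p) ℝ) :=
  (locLin G).prod ((matLin G).prod ((conjNeg V).comp (matLin G)))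

theorem dirFull_apply (K : Matrix (Fin p) (Fin p) ℝ) (e : Idx (⊤ : SimpleGraph (Fin p)) → ℝ) :
    dirFull K e = (locPart e, -(K * matPart e * K), matPart e) := rfl

theorem dirGraph_apply (V : Matrix (Fin p) (Fin p) ℝ) (e : Idx G → ℝ) :
    dirGraph G V e = (locPart e, matPart e, -(V * matPart e * V)) := rfl

theorem hasDerivAt_locPart (θ : Idx G → ℝ) (k : Idx G) (t : ℝ) (j : Fin p) :
    HasDerivAt (fun t => locPart (Function.update θ k t) j)
      (locPart (Pi.single k (1 : ℝ) : Idx G → ℝ) j) t :=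
  hasDerivAt_pi.1 (hasDerivAt_update θ k t) (Sum.inl j)

theorem hasDerivAt_inr (θ : Idx G → ℝ) (k : Idx G) (t : ℝ) :
    HasDerivAt (fun t (q : kPos G) => Function.update θ k t (Sum.inr q))
      (fun q => (Pi.single k (1 : ℝ) : Idx G → ℝ) (Sum.inr q)) t :=
  hasDerivAt_pi.2 fun q => hasDerivAt_pi.1 (hasDerivAt_update θ k t) (Sum.inr q)

/-- The entry `(i, j)` of `symMat G k` as a linear function of `k`. -/
def symMatEntry (G : SimpleGraph (Fin p)) (i j : Fin p) : (kPos G → ℝ) →ₗ[ℝ] ℝ where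
  toFun k := symMatLin G k i j
  map_add' k l := by simp
  map_smul' c k := by simp

theorem hasDerivAt_matPart (θ : Idx G → ℝ) (k : Idx G) (t : ℝ) (i j : Fin p) :
    HasDerivAt (fun t => matPart (Function.update θ k t) i j)
      (matPart (Pi.single k (1 : ℝ) : Idx G → ℝ) i j) t :=
  (symMatEntry G i j).toContinuousLinearMap.hasFDerivAt.comp_hasDerivAt t (hasDerivAt_inr θ k t)

theorem hasDerivAt_matPart_inv {θ : Idx G → ℝ} (hθ : IsUnit (matPart θ).det) (k : Idx G)
    (i j : Fin p) :
    HasDerivAt (fun t => (matPart (Function.update θ k t))⁻¹ i j)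
      ((-((matPart θ)⁻¹ * matPart (Pi.single k (1 : ℝ) : Idx G → ℝ) * (matPart θ)⁻¹)) i j)
      (θ k) := by
  have h0 : (fun q : kPos G => Function.update θ k (θ k) (Sum.inr q)) = fun q => θ (Sum.inr q) := by
    rw [Function.update_eq_self]
  have h := (hasStrictFDerivAt_inv_symMat (G := G) (k := fun q => θ (Sum.inr q)) hθ).hasFDerivAt
  rw [← h0] at h
  have h2 := h.comp_hasDerivAt (θ k) (hasDerivAt_inr θ k (θ k))
  rw [h0] at h2
  exact hasDerivAt_pi.1 (hasDerivAt_pi.1 h2 i) j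

theorem partialPsi_psiFull {u₁ u₂ : ℝ → ℝ} {θ : Idx (⊤ : SimpleGraph (Fin p)) → ℝ}
    (hθ : (matPart θ).PosDef) {x : Fin p → ℝ}
    (hu₁ : DifferentiableAt ℝ u₁ (sqDist (locPart θ) (matPart θ)⁻¹ x))
    (hu₂ : DifferentiableAt ℝ u₂ (sqDist (locPart θ) (matPart θ)⁻¹ x))
    (j k : Idx (⊤ : SimpleGraph (Fin p))) :
    partialPsi (psiFull u₁ u₂) θ j k x =
      dScoreLin ⊤ u₁ u₂ (locPart θ) (matPart θ)⁻¹ x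
        (dirFull (matPart θ)⁻¹ (Pi.single k 1)) j := by
  refine HasDerivAt.deriv (hasDerivAt_score (mt := fun t => locPart (Function.update θ k t))
    (St := fun t => matPart (Function.update θ k t)) ?_ ?_ (PosDef.isSymm hθ.inv)
    (hasDerivAt_locPart θ k (θ k)) (hasDerivAt_matPart θ k (θ k))
    (hasDerivAt_matPart_inv (PosDef.isUnit_det hθ) k) hu₁ hu₂ j)
  · simp
  · simp

theorem partialPsi_psiGraph {u₁ u₂ : ℝ → ℝ} {θ : Idx G → ℝ}
    (hθ : (matPart θ).PosDef) {x : Fin p → ℝ}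
    (hu₁ : DifferentiableAt ℝ u₁ (sqDist (locPart θ) (matPart θ) x))
    (hu₂ : DifferentiableAt ℝ u₂ (sqDist (locPart θ) (matPart θ) x)) (j k : Idx G) :
    partialPsi (psiGraph G u₁ u₂) θ j k x =
      dScoreLin G u₁ u₂ (locPart θ) (matPart θ) x
        (dirGraph G (matPart θ)⁻¹ (Pi.single k 1)) j := by
  have hu := PosDef.isUnit_det hθ
  refine HasDerivAt.deriv (hasDerivAt_score (mt := fun t => locPart (Function.update θ k t))
    (St := fun t => (matPart (Function.update θ k t))⁻¹) ?_ ?_ (PosDef.isSymm hθ)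
    (hasDerivAt_locPart θ k (θ k)) (hasDerivAt_matPart_inv hu k) ?_ hu₁ hu₂ j)
  · simp
  · simp [Matrix.nonsing_inv_nonsing_inv _ hu]
  -- The double inverse equals `matPart` only where the determinant is non-zero, which holds near
  -- the base point.
  · intro a b
    have hc : Continuous fun t => (matPart (Function.update θ k t)).det :=
      Continuous.matrix_det (continuous_matrix fun a b =>
        continuous_iff_continuousAt.2 fun t => (hasDerivAt_matPart θ k t a b).continuousAt)
    have hev : ∀ᶠ t in 𝓝 (θ k), (matPart (Function.update θ k t)).det ≠ 0 :=
      hc.continuousAt.eventually_ne (by simpa using hu.ne_zero)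
    refine (hasDerivAt_matPart θ k (θ k) a b).congr_of_eventuallyEq ?_
    filter_upwards [hev] with t ht
    rw [Matrix.nonsing_inv_nonsing_inv _ ht.isUnit]

/-! ### Differentiability of the weight functions -/

/-- Locally `u = (u ∘ φ) ∘ φ⁻¹`, and `φ⁻¹` is differentiable by the inverse function theorem. -/
theorem differentiableAt_of_comp {u φ : ℝ → ℝ} {φ' t₀ : ℝ} (hφ : HasStrictDerivAt φ φ' t₀)
    (hφ' : φ' ≠ 0) (h : DifferentiableAt ℝ (fun t => u (φ t)) t₀) :
    DifferentiableAt ℝ u (φ t₀) := by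
  have hinv := hφ.to_localInverse hφ'
  have hr := (hφ.hasStrictFDerivAt_equiv hφ').eventually_right_inverse
  have h0 := (hφ.hasStrictFDerivAt_equiv hφ').localInverse_apply_image
  have h0' : hφ.localInverse φ φ' t₀ hφ' (φ t₀) = t₀ := h0
  have hcomp : DifferentiableAt ℝ ((fun t => u (φ t)) ∘ hφ.localInverse φ φ' t₀ hφ') (φ t₀) :=
    DifferentiableAt.comp (φ t₀) (by rwa [h0']) hinv.hasDerivAt.differentiableAt
  refine hcomp.congr_of_eventuallyEq ?_
  filter_upwards [hr] with s hs
  exact congrArg u hs.symm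

/-- Moving the location coordinate `k` changes the squared distance at rate `-2 (K (x - m))_k ≠ 0`.
This transfers differentiability from the estimating function to the weights. -/
theorem differentiableAt_weight {u : ℝ → ℝ} {m x : Fin p → ℝ} {K : Matrix (Fin p) (Fin p) ℝ}
    (hK : K.IsSymm) {k : Fin p} (hk : K.mulVec (x - m) k ≠ 0)
    (h : DifferentiableAt ℝ (fun t => u (sqDist (Function.update m k t) K x)) (m k)) :
    DifferentiableAt ℝ u (sqDist m K x) := by
  have hd : HasDerivAt (fun t => sqDist (Function.update m k t) K x)
      ((x - m) ⬝ᵥ (0 : Matrix (Fin p) (Fin p) ℝ).mulVec (x - m)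
        - 2 * ((Pi.single k 1 : Fin p → ℝ) ⬝ᵥ K.mulVec (x - m))) (m k) :=
    hasDerivAt_sqDist (mt := fun t => Function.update m k t) (Kt := fun _ => K) (by simp) rfl hK
      (fun j => hasDerivAt_pi.1 (hasDerivAt_update m k (m k)) j)
      (fun i j => hasDerivAt_const _ _)
  have hcd : ContDiff ℝ 1 fun t => sqDist (Function.update m k t) K x := by
    have hu : ∀ j, ContDiff ℝ 1 fun t => Function.update m k t j := fun j =>
      contDiff_pi.1 (contDiff_update 1 m k) j
    simp only [sqDist, dotProduct, Matrix.mulVec, Pi.sub_apply]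
    fun_prop
  have hs := hcd.contDiffAt.hasStrictDerivAt' hd one_ne_zero
  have := differentiableAt_of_comp hs (by simpa using hk) h
  simpa using this

end Derivative

/-! ### Weight functions -/

section Weights

variable {u : ℝ → ℝ}

/-- If `u s < 0`, then `(s/2) u(s/2) ≤ s u(s) < (s/2) u(s)`, against `u(s/2) ≥ u(s)`. -/
theorem weight_nonneg (ha : AntitoneOn u (Set.Ioi 0))
    (hm : MonotoneOn (fun s => s * u s) (Set.Ioi 0)) {s : ℝ} (hs : 0 < s) : 0 ≤ u s := by
  by_contra h
  push Not at h
  have hs2 : (0 : ℝ) < s / 2 := by positivity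
  have h1 : u s ≤ u (s / 2) := ha hs2 hs (by linarith)
  have h2 : s / 2 * u (s / 2) ≤ s * u s := hm hs2 hs (by linarith)
  nlinarith

/-- Positivity at one point spreads to the left because `u` decreases, and to the right because `s *
u s` increases. -/
theorem weight_pos (ha : AntitoneOn u (Set.Ioi 0))
    (hm : MonotoneOn (fun s => s * u s) (Set.Ioi 0)) (hne : ∃ s > 0, u s ≠ 0) {t : ℝ}
    (ht : 0 < t) : 0 < u t := by
  obtain ⟨s, hs, hus⟩ := hne
  have hus' : 0 < u s := lt_of_le_of_ne (weight_nonneg ha hm hs) (Ne.symm hus)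
  rcases le_total t s with h | h
  · exact hus'.trans_le (ha ht hs h)
  · have h1 : s * u s ≤ t * u t := hm hs ht h
    exact pos_of_mul_pos_right ((mul_pos hs hus').trans_le h1) ht.le

theorem deriv_mul_weight_nonneg (hm : MonotoneOn (fun s => s * u s) (Set.Ioi 0)) {s : ℝ}
    (hs : 0 < s) : 0 ≤ deriv (fun s => s * u s) s := by
  rw [← derivWithin_of_isOpen isOpen_Ioi hs]
  exact hm.derivWithin_nonneg

theorem deriv_mul_weight {s : ℝ} (h : DifferentiableAt ℝ u s) :
    deriv (fun s => s * u s) s = u s + s * deriv u s := by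
  have := (hasDerivAt_id s).fun_mul h.hasDerivAt
  simpa using this.deriv

end Weights

/-! ### Linear transformations of vector and matrix valued integrals -/

section Congruence

variable {α : Type*} [MeasurableSpace α] {ν : Measure α} {p : ℕ}

theorem integrable_mulVec {f : α → Fin p → ℝ} (hf : ∀ j, Integrable (fun x => f x j) ν)
    (A : Matrix (Fin p) (Fin p) ℝ) (i : Fin p) : Integrable (fun x => A.mulVec (f x) i) ν := by
  simp only [Matrix.mulVec, dotProduct]
  exact integrable_finsetSum _ fun j _ => (hf j).const_mul _

theorem integral_mulVec {f : α → Fin p → ℝ} (hf : ∀ j, Integrable (fun x => f x j) ν)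
    (A : Matrix (Fin p) (Fin p) ℝ) (i : Fin p) :
    ∫ x, A.mulVec (f x) i ∂ν = A.mulVec (fun j => ∫ x, f x j ∂ν) i := by
  simp only [Matrix.mulVec, dotProduct]
  rw [integral_finsetSum _ fun j _ => (hf j).const_mul _]
  simp only [integral_const_mul]

theorem congr_apply (A M : Matrix (Fin p) (Fin p) ℝ) (a b : Fin p) :
    (A * M * A.transpose) a b = ∑ d, ∑ c, A b d * A a c * M c d := by
  simp only [Matrix.mul_apply, Matrix.transpose_apply, Finset.sum_mul]
  refine Finset.sum_congr rfl fun d _ => Finset.sum_congr rfl fun c _ => ?_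
  ring

theorem integrable_congr_matrix {f : α → Matrix (Fin p) (Fin p) ℝ}
    (hf : ∀ a b, Integrable (fun x => f x a b) ν) (A : Matrix (Fin p) (Fin p) ℝ) (a b : Fin p) :
    Integrable (fun x => (A * f x * A.transpose) a b) ν := by
  simp only [congr_apply]
  exact integrable_finsetSum _ fun d _ => integrable_finsetSum _ fun c _ => (hf c d).const_mul _

theorem integral_congr_matrix {f : α → Matrix (Fin p) (Fin p) ℝ}
    (hf : ∀ a b, Integrable (fun x => f x a b) ν) (A : Matrix (Fin p) (Fin p) ℝ) (a b : Fin p) :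
    ∫ x, (A * f x * A.transpose) a b ∂ν =
      (A * (Matrix.of fun c d => ∫ x, f x c d ∂ν) * A.transpose) a b := by
  simp only [congr_apply, Matrix.of_apply]
  have hI : ∀ d, Integrable (fun x => ∑ c, A b d * A a c * f x c d) ν := fun d =>
    integrable_finsetSum _ fun c _ => (hf c d).const_mul _
  rw [integral_finsetSum _ fun d _ => hI d]
  refine Finset.sum_congr rfl fun d _ => ?_
  rw [integral_finsetSum _ fun c _ => (hf c d).const_mul _]
  simp only [integral_const_mul]

end Congruence

/-! ### The population values -/

section Population

variable {p : ℕ} {G : SimpleGraph (Fin p)} {F : Measure (Fin p → ℝ)} {u₁ u₂ : ℝ → ℝ}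

/-- The parameter vector with location `m` and the entries of `M` at `K(G)`. -/
def mkParam (G : SimpleGraph (Fin p)) (m : Fin p → ℝ) (M : Matrix (Fin p) (Fin p) ℝ) :
    Idx G → ℝ :=
  Sum.elim m fun q => M q.1.1 q.1.2

theorem locPart_mkParam (m : Fin p → ℝ) (M : Matrix (Fin p) (Fin p) ℝ) :
    locPart (mkParam G m M) = m := rfl

theorem matPart_mkParam (m : Fin p → ℝ) {M : Matrix (Fin p) (Fin p) ℝ} (hM : M.IsSymm)
    (hs : Supported G M) : matPart (mkParam G m M) = M :=
  symMat_entries hM hs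

/-- `u₂(R) (x - m)(x - m)ᵀ - V`. -/
def scatterScore (u₂ : ℝ → ℝ) (m : Fin p → ℝ) (V : Matrix (Fin p) (Fin p) ℝ) (x : Fin p → ℝ) :
    Matrix (Fin p) (Fin p) ℝ :=
  u₂ (sqDist m V⁻¹ x) • Matrix.vecMulVec (x - m) (x - m) - V

/-- `u₁(R) (x - m)`. -/
def locationScore (u₁ : ℝ → ℝ) (m : Fin p → ℝ) (V : Matrix (Fin p) (Fin p) ℝ) (x : Fin p → ℝ) :
    Fin p → ℝ :=
  u₁ (sqDist m V⁻¹ x) • (x - m)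

theorem score_eq (x m : Fin p → ℝ) (V : Matrix (Fin p) (Fin p) ℝ) :
    score G u₁ u₂ x m V = mkParam G (locationScore u₁ m V x) (scatterScore u₂ m V x) := by
  ext j
  rcases j with j | q
  · simp [score, mkParam, locationScore]
  · simp [score, mkParam, scatterScore, Matrix.vecMulVec_apply]

/-- `(m, V)` solves the population equations of location and scatter. -/
structure PopSolution (F : Measure (Fin p → ℝ)) (u₁ u₂ : ℝ → ℝ) (m : Fin p → ℝ)
    (V : Matrix (Fin p) (Fin p) ℝ) : Prop where
  posDef : V.PosDef
  integrable_loc : ∀ j, Integrable (fun x => locationScore u₁ m V x j) F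
  integral_loc : ∀ j, ∫ x, locationScore u₁ m V x j ∂F = 0
  integrable_scat : ∀ a b, Integrable (fun x => scatterScore u₂ m V x a b) F
  integral_scat : ∀ a b, ∫ x, scatterScore u₂ m V x a b ∂F = 0

theorem scatterScore_comm {m : Fin p → ℝ} {V : Matrix (Fin p) (Fin p) ℝ} (hV : V.IsSymm)
    (x : Fin p → ℝ) (a b : Fin p) : scatterScore u₂ m V x a b = scatterScore u₂ m V x b a := by
  simp [scatterScore, Matrix.vecMulVec_apply, hV.apply a b, mul_comm]

theorem PopSolution.of_isMFunctional {θ : Idx (⊤ : SimpleGraph (Fin p)) → ℝ}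
    (h : IsMFunctional F (psiFull u₁ u₂) (paramSet ⊤) θ) :
    PopSolution F u₁ u₂ (locPart θ) (matPart θ) := by
  obtain ⟨hV, h⟩ := h
  have hVs := PosDef.isSymm (V := matPart θ) hV
  simp only [psiFull, score_eq] at h
  have hs : ∀ a b, Integrable (fun x => scatterScore u₂ (locPart θ) (matPart θ) x a b) F ∧
      ∫ x, scatterScore u₂ (locPart θ) (matPart θ) x a b ∂F = 0 := fun a b => by
    have hab : a = b ∨ (⊤ : SimpleGraph (Fin p)).Adj a b := by
      simpa using eq_or_ne a b
    rcases mem_kPos_or hab with hq | hq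
    · exact h (Sum.inr ⟨(a, b), hq⟩)
    · simp only [scatterScore_comm hVs _ a b]
      exact h (Sum.inr ⟨(b, a), hq⟩)
  exact ⟨hV, fun j => (h (Sum.inl j)).1, fun j => (h (Sum.inl j)).2, fun a b => (hs a b).1,
    fun a b => (hs a b).2⟩

theorem PopSolution.isMFunctional_full {m : Fin p → ℝ} {V : Matrix (Fin p) (Fin p) ℝ}
    (h : PopSolution F u₁ u₂ m V) :
    IsMFunctional F (psiFull u₁ u₂) (paramSet ⊤) (mkParam ⊤ m V) := by
  have hV : matPart (mkParam ⊤ m V) = V :=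
    matPart_mkParam m (PosDef.isSymm h.posDef) (supported_top V)
  refine ⟨by rw [paramSet, Set.mem_ofPred_eq, hV]; exact h.posDef, fun j => ?_⟩
  simp only [psiFull, score_eq, hV, locPart_mkParam]
  rcases j with j | q
  · exact ⟨h.integrable_loc j, h.integral_loc j⟩
  · exact ⟨h.integrable_scat _ _, h.integral_scat _ _⟩

theorem PopSolution.isMFunctional_graph {m : Fin p → ℝ} {V : Matrix (Fin p) (Fin p) ℝ}
    (h : PopSolution F u₁ u₂ m V) (hVG : Supported G V⁻¹) :
    IsMFunctional F (psiGraph G u₁ u₂) (paramSet G) (mkParam G m V⁻¹) := by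
  have hV : matPart (mkParam G m V⁻¹) = V⁻¹ :=
    matPart_mkParam m (PosDef.isSymm h.posDef.inv) hVG
  refine ⟨by rw [paramSet, Set.mem_ofPred_eq, hV]; exact h.posDef.inv, fun j => ?_⟩
  simp only [psiGraph, score_eq, hV, locPart_mkParam,
    Matrix.nonsing_inv_nonsing_inv _ (PosDef.isUnit_det h.posDef)]
  rcases j with j | q
  · exact ⟨h.integrable_loc j, h.integral_loc j⟩
  · exact ⟨h.integrable_scat _ _, h.integral_scat _ _⟩

/-- Affine equivariance of the population equations. -/
theorem PopSolution.affine {μ m : Fin p → ℝ} {V A : Matrix (Fin p) (Fin p) ℝ}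
    (h : PopSolution F u₁ u₂ m V) (hA : IsUnit A.det)
    (hF : MeasurePreserving (fun x => μ + A.mulVec (x - μ)) F F) :
    PopSolution F u₁ u₂ (μ + A.mulVec (m - μ)) (A * V * A.transpose) := by
  have hemb : MeasurableEmbedding fun x : Fin p → ℝ => μ + A.mulVec (x - μ) := by
    refine Continuous.measurableEmbedding (by fun_prop) fun x y hxy => ?_
    have := Matrix.mulVec_injective_iff_isUnit.2 ((Matrix.isUnit_iff_isUnit_det _).2 hA)
      (add_left_cancel hxy)
    exact sub_left_injective this
  have hdiff : ∀ x, μ + A.mulVec (x - μ) - (μ + A.mulVec (m - μ)) = A.mulVec (x - m) := fun x => by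
    rw [add_sub_add_left_eq_sub, ← Matrix.mulVec_sub, sub_sub_sub_cancel_right]
  have hAt : IsUnit A.transpose.det := by rwa [Matrix.det_transpose]
  have hR : ∀ x, sqDist (μ + A.mulVec (m - μ)) (A * V * A.transpose)⁻¹ (μ + A.mulVec (x - μ)) =
      sqDist m V⁻¹ x := fun x => by
    rw [sqDist, hdiff, Matrix.mul_inv_rev, Matrix.mul_inv_rev, Matrix.dotProduct_mulVec,
      ← Matrix.vecMul_transpose, Matrix.vecMul_vecMul, Matrix.mul_nonsing_inv_cancel_left _ _ hAt,
      ← Matrix.dotProduct_mulVec, Matrix.vecMul_transpose, Matrix.mulVec_mulVec, Matrix.mul_assoc,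
      Matrix.nonsing_inv_mul _ hA, Matrix.mul_one]
    rfl
  have hloc : ∀ x j, locationScore u₁ (μ + A.mulVec (m - μ)) (A * V * A.transpose)
      (μ + A.mulVec (x - μ)) j = A.mulVec (locationScore u₁ m V x) j := fun x j => by
    rw [locationScore, hR, hdiff, locationScore, Matrix.mulVec_smul]
  have hscat : ∀ x a b, scatterScore u₂ (μ + A.mulVec (m - μ)) (A * V * A.transpose)
      (μ + A.mulVec (x - μ)) a b = (A * scatterScore u₂ m V x * A.transpose) a b := fun x a b => by
    rw [scatterScore, hR, hdiff, scatterScore, Matrix.mul_sub, Matrix.sub_mul, Matrix.mul_smul,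
      Matrix.smul_mul, Matrix.mul_vecMulVec, Matrix.vecMulVec_mul, Matrix.vecMul_transpose]
  refine ⟨?_, fun j => ?_, fun j => ?_, fun a b => ?_, fun a b => ?_⟩
  · have := h.posDef.conjTranspose_mul_mul_same (B := A.transpose)
      (Matrix.mulVec_injective_iff_isUnit.2 ((Matrix.isUnit_iff_isUnit_det _).2 hAt))
    simpa using this
  · rw [← hF.integrable_comp_emb hemb]
    simp only [Function.comp_def, hloc]
    exact integrable_mulVec h.integrable_loc A j
  · rw [← hF.integral_comp hemb]
    simp only [hloc]
    rw [integral_mulVec h.integrable_loc]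
    simp only [h.integral_loc]
    exact congrFun (Matrix.mulVec_zero A) j
  · rw [← hF.integrable_comp_emb hemb]
    simp only [Function.comp_def, hscat]
    exact integrable_congr_matrix h.integrable_scat A a b
  · rw [← hF.integral_comp hemb]
    simp only [hscat]
    rw [integral_congr_matrix h.integrable_scat]
    simp only [h.integral_scat]
    change (A * (0 : Matrix (Fin p) (Fin p) ℝ) * A.transpose) a b = 0
    simp

/-- Commuting with sign changes kills the off-diagonal entries; commuting with swaps equates the
diagonal ones. -/
theorem eq_smul_one_of_commute {N : Matrix (Fin p) (Fin p) ℝ} (hp : 0 < p)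
    (h : ∀ v : Fin p → ℝ, v ⬝ᵥ v ≠ 0 → householder v * N = N * householder v) :
    ∃ η : ℝ, N = η • (1 : Matrix (Fin p) (Fin p) ℝ) := by
  have hl : ∀ (O : Matrix (Fin p) (Fin p) ℝ) a b, (O * N) a b = O.mulVec (fun i => N i b) a :=
    fun O a b => rfl
  have hr : ∀ (v : Fin p → ℝ) a b,
      (N * householder v) a b = (householder v).mulVec (fun i => N a i) b := fun v a b => by
    conv_lhs => rw [← householder_transpose v]
    simp [Matrix.mul_apply, Matrix.mulVec, dotProduct, mul_comm]
  have hoff : ∀ a b, a ≠ b → N a b = 0 := fun a b hab => by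
    have h1 := congrFun (congrFun (h (Pi.single a 1) (by simp)) a) b
    rw [hl, hr] at h1
    have e1 := flipMat_mulVec_same a fun i => N i b
    have e2 := flipMat_mulVec_ne hab.symm fun i => N a i
    rw [flipMat] at e1 e2
    rw [e1, e2] at h1
    linarith
  have hdiag : ∀ a b, N a a = N b b := fun a b => by
    by_cases hab : a = b
    · rw [hab]
    have h1 := congrFun (congrFun (h (Pi.single a 1 - Pi.single b 1)
      (by rw [dotProduct_swap hab]; norm_num)) a) b
    rw [hl, hr] at h1
    have e1 := swapMat_mulVec_left hab fun i => N i b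
    have e2 := swapMat_mulVec_right hab fun i => N a i
    rw [swapMat] at e1 e2
    rw [e1, e2] at h1
    exact h1.symm
  refine ⟨N ⟨0, hp⟩ ⟨0, hp⟩, ?_⟩
  ext a b
  by_cases hab : a = b
  · subst hab
    simp [hdiag a ⟨0, hp⟩]
  · simp [hoff a b hab, hab]

/-- A unique solution of the population equations at an elliptical distribution consists of the
centre and a multiple of the shape matrix. -/
theorem PopSolution.eq_elliptical {μ m : Fin p → ℝ} {S V : Matrix (Fin p) (Fin p) ℝ} {g : ℝ → ℝ}
    (hp : 0 < p) (hS : S.PosDef) (hg : Measurable g)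
    (h : PopSolution (elliptical μ S g) u₁ u₂ m V)
    (huniq : ∀ m' V', PopSolution (elliptical μ S g) u₁ u₂ m' V' → m' = m ∧ V' = V) :
    m = μ ∧ ∃ η : ℝ, 0 < η ∧ V = η • S := by
  obtain ⟨T, hT, rfl⟩ := PosDef.exists_factor hS
  have hTt : IsUnit T.transpose.det := by rwa [Matrix.det_transpose]
  -- Each `T O T⁻¹` about `μ` preserves the law, so by equivariance it maps solutions to solutions,
  -- and by uniqueness it fixes `(m, V)`. Taking `O = -1` gives `m = μ`; reflections show that `T⁻¹
  -- V T⁻ᵀ` is scalar.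
  have hinv : ∀ O : Matrix (Fin p) (Fin p) ℝ, O.transpose * O = 1 →
      μ + (T * O * T⁻¹).mulVec (m - μ) = m ∧
        T * O * T⁻¹ * V * (T * O * T⁻¹).transpose = V := fun O hO => by
    have hdet := det_conj_orthogonal hT hO
    refine huniq _ _ (h.affine ?_ (measurePreserving_elliptical hg hdet
      (sqDist_conj_orthogonal hT (η := 1) (by simp) hO)))
    exact isUnit_iff_ne_zero.2 fun h0 => by simp [h0] at hdet
  refine ⟨?_, ?_⟩
  · have h1 := (hinv (-1) (by simp)).1
    rw [Matrix.mul_neg, Matrix.mul_one, Matrix.neg_mul, Matrix.mul_nonsing_inv _ hT,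
      Matrix.neg_mulVec, Matrix.one_mulVec] at h1
    ext j
    have := congrFun h1 j
    simp only [Pi.add_apply, Pi.neg_apply, Pi.sub_apply] at this
    linarith
  · obtain ⟨η, hη⟩ := eq_smul_one_of_commute (N := T⁻¹ * V * T.transpose⁻¹) hp fun v hv => by
      have hO := householder_orthogonal hv
      have hO' : householder v * householder v = 1 := by
        rwa [householder_transpose] at hO
      have h2 := (hinv _ hO).2
      rw [Matrix.transpose_mul, Matrix.transpose_mul, householder_transpose,
        Matrix.transpose_nonsing_inv] at h2
      conv_rhs => rw [← h2]
      have e1 : T⁻¹ * (T * householder v * T⁻¹ * V *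
          (T.transpose⁻¹ * (householder v * T.transpose))) * T.transpose⁻¹ * householder v =
          (T⁻¹ * T) * householder v * T⁻¹ * V * T.transpose⁻¹ * (householder v *
            (T.transpose * T.transpose⁻¹) * householder v) := by
        simp only [Matrix.mul_assoc]
      rw [e1, Matrix.nonsing_inv_mul _ hT, Matrix.mul_nonsing_inv _ hTt, Matrix.mul_one, hO']
      simp only [Matrix.mul_assoc, Matrix.one_mul, Matrix.mul_one]
    have hV : V = η • (T * T.transpose) := by
      calc V = T * (T⁻¹ * V * T.transpose⁻¹) * T.transpose := by
            rw [Matrix.mul_assoc T⁻¹, Matrix.mul_nonsing_inv_cancel_left _ _ hT, Matrix.mul_assoc,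
              Matrix.nonsing_inv_mul _ hTt, Matrix.mul_one]
        _ = η • (T * T.transpose) := by
            rw [hη, Matrix.mul_smul, Matrix.mul_one, Matrix.smul_mul]
    refine ⟨η, ?_, hV⟩
    have h1 := h.posDef.diag_pos (i := ⟨0, hp⟩)
    have h2 := hS.diag_pos (i := ⟨0, hp⟩)
    rw [hV, Matrix.smul_apply, smul_eq_mul] at h1
    exact pos_of_mul_pos_left h1 h2.le

end Population

section Coefficients

variable {p : ℕ} {F : Measure (Fin p → ℝ)} {u₁ u₂ : ℝ → ℝ}

/-! ### Almost sure regularity -/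

/-- The exceptional set is a translate of a proper subspace, hence a Lebesgue null set. -/
theorem ae_dotProduct_ne_zero (hF : F ≪ volume) (m : Fin p → ℝ) {v : Fin p → ℝ} (hv : v ≠ 0) :
    ∀ᵐ x ∂F, v ⬝ᵥ (x - m) ≠ 0 := by
  refine hF.ae_le ?_
  let s : Submodule ℝ (Fin p → ℝ) := LinearMap.ker
    ({ toFun := fun y => v ⬝ᵥ y, map_add' := dotProduct_add v,
       map_smul' := fun c y => dotProduct_smul c v y } : (Fin p → ℝ) →ₗ[ℝ] ℝ)
  have hs : s ≠ ⊤ := fun h => by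
    have : v ∈ s := h ▸ Submodule.mem_top
    exact hv (dotProduct_self_eq_zero.1 this)
  have h0 : ∀ᵐ y : Fin p → ℝ, y ∉ s := measure_eq_zero_iff_ae_notMem.1
    (Measure.addHaar_submodule volume s hs)
  exact (measurePreserving_sub_right volume m).quasiMeasurePreserving.ae h0

theorem sqDist_pos {m x : Fin p → ℝ} {K : Matrix (Fin p) (Fin p) ℝ} (hK : K.PosDef)
    (h : x - m ≠ 0) : 0 < sqDist m K x := by
  simpa [sqDist] using hK.dotProduct_mulVec_pos h

theorem locPart_update_inl {G : SimpleGraph (Fin p)} (θ : Idx G → ℝ) (k : Fin p) (t : ℝ) :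
    locPart (Function.update θ (Sum.inl k) t) = Function.update (locPart θ) k t := by
  ext j
  by_cases h : j = k
  · subst h
    simp [locPart]
  · simp [locPart, h]

theorem matPart_update_inl {G : SimpleGraph (Fin p)} (θ : Idx G → ℝ) (k : Fin p) (t : ℝ) :
    matPart (Function.update θ (Sum.inl k) t) = matPart θ := by
  simp [matPart]

/-- Two distinct coordinates are needed: when only the location coordinate `a` moves, the score
components at `b` and `(b, b)` vary through the weight alone. Dividing by the constant factor `x b -
m b`, or by its square, isolates the weight. -/
theorem ae_regular (hp : 2 ≤ p) (hF : F ≪ volume) {θ : Idx (⊤ : SimpleGraph (Fin p)) → ℝ}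
    (hθ : (matPart θ).PosDef)
    (h : ∀ j k, ∀ᵐ x ∂F,
      DifferentiableAt ℝ (fun t => psiFull u₁ u₂ x (Function.update θ k t) j) (θ k)) :
    ∀ᵐ x ∂F, DifferentiableAt ℝ u₁ (sqDist (locPart θ) (matPart θ)⁻¹ x) ∧
      DifferentiableAt ℝ u₂ (sqDist (locPart θ) (matPart θ)⁻¹ x) ∧
      0 < sqDist (locPart θ) (matPart θ)⁻¹ x := by
  let a : Fin p := ⟨0, by omega⟩
  let b : Fin p := ⟨1, by omega⟩
  have hba : b ≠ a := by simp [a, b]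
  have hK := hθ.inv
  have hrow : (matPart θ)⁻¹ a ≠ 0 := fun h0 => by
    have := hK.diag_pos (i := a)
    rw [h0] at this
    simp at this
  have hb : (Pi.single b 1 : Fin p → ℝ) ≠ 0 := by simp
  filter_upwards [h (Sum.inl b) (Sum.inl a),
    h (Sum.inr ⟨(b, b), mem_kPos.2 (Or.inl rfl)⟩) (Sum.inl a),
    ae_dotProduct_ne_zero hF (locPart θ) hrow, ae_dotProduct_ne_zero hF (locPart θ) hb]
    with x h1 h2 h3 h4
  have h4' : x b - locPart θ b ≠ 0 := by simpa using h4
  have hx : x - locPart θ ≠ 0 := fun h0 => h4' (by simpa using congrFun h0 b)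
  simp only [psiFull, locPart_update_inl, matPart_update_inl, score, Sum.elim_inl, Sum.elim_inr,
    Function.update_of_ne hba] at h1 h2
  refine ⟨?_, ?_, sqDist_pos hK hx⟩
  · refine differentiableAt_weight (PosDef.isSymm hK) h3 ?_
    have := h1.mul_const (x b - locPart θ b)⁻¹
    simp only [mul_inv_cancel_right₀ h4'] at this
    exact this
  · refine differentiableAt_weight (PosDef.isSymm hK) h3 ?_
    have := (h2.add_const (matPart θ b b)).mul_const
      ((x b - locPart θ b) * (x b - locPart θ b))⁻¹
    simp only [sub_add_cancel, mul_inv_cancel_right₀ (mul_ne_zero h4' h4')] at this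
    exact this

/-! ### Non-degeneracy -/

theorem integral_ne_zero_of_nonneg_ae {α : Type*} [MeasurableSpace α] {ν : Measure α} {f : α → ℝ}
    (hf : Integrable f ν) (h0 : 0 ≤ᵐ[ν] f) {s : Set α} (hs : ν s ≠ 0)
    (hpos : ∀ᵐ x ∂ν, x ∈ s → 0 < f x) : 0 < ∫ x, f x ∂ν := by
  refine lt_of_le_of_ne (integral_nonneg_of_ae h0) fun h => hs ?_
  have h1 := (integral_eq_zero_iff_of_nonneg_ae h0 hf).1 h.symm
  refine measure_eq_zero_iff_ae_notMem.2 ?_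
  filter_upwards [h1, hpos] with x hx1 hx2 hxs
  have := hx2 hxs
  rw [hx1] at this
  exact lt_irrefl _ this

/-- With `φ₁(s) = s u₁(s)` the integrand is `2 φ₁'(R) + (p - 2) u₁(R)`. For `p > 2` positivity of
`u₁` suffices; for `p = 2` the second term is absent and `φ₁'` must help. -/
theorem location_coefficient_pos [IsProbabilityMeasure F] (hp : 2 ≤ p)
    (hu : WeightConditions u₁ u₂) {m : Fin p → ℝ} {V : Matrix (Fin p) (Fin p) ℝ}
    (hnd : NonDegenerate F u₁ u₂ m V)
    (hreg : ∀ᵐ x ∂F, DifferentiableAt ℝ u₁ (sqDist m V⁻¹ x) ∧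
      DifferentiableAt ℝ u₂ (sqDist m V⁻¹ x) ∧ 0 < sqDist m V⁻¹ x)
    (hInt : Integrable (fun x => 2 * deriv u₁ (sqDist m V⁻¹ x) * sqDist m V⁻¹ x
      + p * u₁ (sqDist m V⁻¹ x)) F) :
    0 < ∫ x, (2 * deriv u₁ (sqDist m V⁻¹ x) * sqDist m V⁻¹ x + p * u₁ (sqDist m V⁻¹ x)) ∂F := by
  have hp' : (2 : ℝ) ≤ p := by exact_mod_cast hp
  have key : ∀ s, 0 < s → DifferentiableAt ℝ u₁ s →
      2 * deriv u₁ s * s + p * u₁ s = 2 * deriv (fun s => s * u₁ s) s + (p - 2) * u₁ s :=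
    fun s _ hd => by
      rw [deriv_mul_weight hd]
      ring
  have hφ := fun s (hs : 0 < s) => deriv_mul_weight_nonneg hu.φ₁_mono hs
  have hpos := fun s (hs : 0 < s) => weight_pos hu.u₁_anti hu.φ₁_mono hnd.u₁_ne_zero hs
  have h0 : ∀ᵐ x ∂F, 0 ≤ 2 * deriv u₁ (sqDist m V⁻¹ x) * sqDist m V⁻¹ x
      + p * u₁ (sqDist m V⁻¹ x) := by
    filter_upwards [hreg] with x hx
    rw [key _ hx.2.2 hx.1]
    have := mul_nonneg (sub_nonneg.2 hp') (hpos _ hx.2.2).le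
    linarith [hφ _ hx.2.2]
  rcases hp.eq_or_lt with h2 | h2
  · refine integral_ne_zero_of_nonneg_ae hInt h0 (hnd.φ₁_deriv h2.symm) ?_
    filter_upwards [hreg] with x hx hxs
    have hxs' : 0 < deriv (fun s => s * u₁ s) (sqDist m V⁻¹ x) := hxs
    rw [key _ hx.2.2 hx.1]
    have := mul_nonneg (sub_nonneg.2 hp') (hpos _ hx.2.2).le
    linarith
  · refine integral_ne_zero_of_nonneg_ae (s := Set.univ) hInt h0 (by simp) ?_
    have hp'' : (2 : ℝ) < p := by exact_mod_cast h2
    filter_upwards [hreg] with x hx _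
    rw [key _ hx.2.2 hx.1]
    have := mul_pos (sub_pos.2 hp'') (hpos _ hx.2.2)
    linarith [hφ _ hx.2.2]

/-- This is the scatter equation paired with `V⁻¹` under the trace; it normalizes `E u₂(R) R` to
`p`. -/
theorem PopSolution.integral_trace {m : Fin p → ℝ} {V : Matrix (Fin p) (Fin p) ℝ}
    (h : PopSolution F u₁ u₂ m V) :
    Integrable (fun x => u₂ (sqDist m V⁻¹ x) * sqDist m V⁻¹ x - p) F ∧
      ∫ x, (u₂ (sqDist m V⁻¹ x) * sqDist m V⁻¹ x - p) ∂F = 0 := by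
  have hsum : ∀ x, u₂ (sqDist m V⁻¹ x) * sqDist m V⁻¹ x - p =
      ∑ a, ∑ b, V⁻¹ a b * scatterScore u₂ m V x b a := fun x => by
    have h1 : ∑ a, ∑ b, V⁻¹ a b * scatterScore u₂ m V x b a =
        (V⁻¹ * scatterScore u₂ m V x).trace := by
      simp [Matrix.trace, Matrix.mul_apply]
    rw [h1, scatterScore, Matrix.mul_sub, Matrix.nonsing_inv_mul _ (PosDef.isUnit_det h.posDef),
      Matrix.trace_sub, Matrix.trace_one, Matrix.mul_smul, Matrix.trace_smul, Matrix.mul_vecMulVec,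
      Matrix.trace_vecMulVec, Fintype.card_fin, smul_eq_mul, dotProduct_comm]
    rfl
  simp only [hsum]
  have hI : ∀ a, Integrable (fun x => ∑ b, V⁻¹ a b * scatterScore u₂ m V x b a) F := fun a =>
    integrable_finsetSum _ fun b _ => (h.integrable_scat b a).const_mul _
  refine ⟨integrable_finsetSum _ fun a _ => hI a, ?_⟩
  rw [integral_finsetSum _ fun a _ => hI a]
  refine Finset.sum_eq_zero fun a _ => ?_
  rw [integral_finsetSum _ fun b _ => (h.integrable_scat b a).const_mul _]
  simp only [integral_const_mul, h.integral_scat, mul_zero, Finset.sum_const_zero]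

/-- By `PopSolution.integral_trace` the constant `p` may be replaced by `u₂(R) R` under the
integral, and the integrand becomes `R φ₂'(R)` with `φ₂(s) = s u₂(s)`. -/
theorem scatter_coefficient_pos [IsProbabilityMeasure F]
    (hu : WeightConditions u₁ u₂) {m : Fin p → ℝ} {V : Matrix (Fin p) (Fin p) ℝ}
    (hpop : PopSolution F u₁ u₂ m V) (hnd : NonDegenerate F u₁ u₂ m V)
    (hreg : ∀ᵐ x ∂F, DifferentiableAt ℝ u₁ (sqDist m V⁻¹ x) ∧
      DifferentiableAt ℝ u₂ (sqDist m V⁻¹ x) ∧ 0 < sqDist m V⁻¹ x)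
    (hInt : Integrable (fun x => deriv u₂ (sqDist m V⁻¹ x) * sqDist m V⁻¹ x ^ 2) F) :
    0 < ∫ x, deriv u₂ (sqDist m V⁻¹ x) * sqDist m V⁻¹ x ^ 2 ∂F + p := by
  obtain ⟨hi, hz⟩ := hpop.integral_trace
  have hsum : ∫ x, deriv u₂ (sqDist m V⁻¹ x) * sqDist m V⁻¹ x ^ 2 ∂F + p =
      ∫ x, (deriv u₂ (sqDist m V⁻¹ x) * sqDist m V⁻¹ x ^ 2 +
        (u₂ (sqDist m V⁻¹ x) * sqDist m V⁻¹ x - p) + p) ∂F := by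
    have hi2 : Integrable (fun x => deriv u₂ (sqDist m V⁻¹ x) * sqDist m V⁻¹ x ^ 2 +
        (u₂ (sqDist m V⁻¹ x) * sqDist m V⁻¹ x - p)) F := hInt.add hi
    rw [integral_add hi2 (integrable_const _), integral_add hInt hi, hz]
    simp
  rw [hsum]
  have key : ∀ s, DifferentiableAt ℝ u₂ s →
      deriv u₂ s * s ^ 2 + (u₂ s * s - p) + p = s * deriv (fun s => s * u₂ s) s := fun s hd => by
    rw [deriv_mul_weight hd]
    ring
  refine integral_ne_zero_of_nonneg_ae ((hInt.add hi).add (integrable_const _)) ?_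
    hnd.φ₂_deriv ?_
  · filter_upwards [hreg] with x hx
    rw [key _ hx.2.1]
    exact mul_nonneg hx.2.2.le (deriv_mul_weight_nonneg hu.φ₂_mono hx.2.2)
  · filter_upwards [hreg] with x hx hxs
    rw [key _ hx.2.1]
    exact mul_pos hx.2.2 hxs

/-! ### Expectation of the derivative of the estimating function -/

theorem quadratic_standardize (T L : Matrix (Fin p) (Fin p) ℝ) (z : Fin p → ℝ) :
    T.mulVec z ⬝ᵥ L.mulVec (T.mulVec z) = z ⬝ᵥ (T.transpose * L * T).mulVec z := by
  rw [Matrix.mulVec_mulVec, Matrix.mul_assoc, ← Matrix.mulVec_mulVec z T.transpose,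
    Matrix.dotProduct_mulVec z, Matrix.vecMul_transpose]

theorem bilinear_standardize {T : Matrix (Fin p) (Fin p) ℝ} (hT : IsUnit T.det)
    (w z : Fin p → ℝ) :
    w ⬝ᵥ (T * T.transpose)⁻¹.mulVec (T.mulVec z) = T⁻¹.mulVec w ⬝ᵥ z := by
  rw [Matrix.mul_inv_rev, ← Matrix.mulVec_mulVec, inv_mulVec_mulVec hT, Matrix.dotProduct_mulVec,
    ← Matrix.transpose_nonsing_inv, Matrix.vecMul_transpose]

/-- Together with `dScat_standardize`, this reduces expectations at an elliptical law to a
rotationally invariant one with centre `0` and scatter `1`. -/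
theorem dLoc_standardize {T : Matrix (Fin p) (Fin p) ℝ} (hT : IsUnit T.det) (m z w : Fin p → ℝ)
    (L : Matrix (Fin p) (Fin p) ℝ) :
    dLoc u₁ m (T * T.transpose)⁻¹ (m + T.mulVec z) w L =
      T.mulVec (dLoc u₁ 0 1 z (T⁻¹.mulVec w) (T.transpose * L * T)) := by
  rw [dLoc, dLoc, sqDist_factor hT, add_sub_cancel_left, quadratic_standardize,
    bilinear_standardize hT, Matrix.mulVec_sub, Matrix.mulVec_smul, Matrix.mulVec_smul,
    Matrix.mulVec_mulVec, Matrix.mul_nonsing_inv _ hT, Matrix.one_mulVec]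
  simp [sqDist]

theorem dScat_standardize {T : Matrix (Fin p) (Fin p) ℝ} (hT : IsUnit T.det) (m z w : Fin p → ℝ)
    (L : Matrix (Fin p) (Fin p) ℝ) :
    dScat u₂ m (T * T.transpose)⁻¹ (m + T.mulVec z) w L
        (-(T * T.transpose * L * (T * T.transpose))) =
      T * dScat u₂ 0 1 z (T⁻¹.mulVec w) (T.transpose * L * T) (-(T.transpose * L * T)) *
        T.transpose := by
  have hw : T.mulVec (T⁻¹.mulVec w) = w := by
    rw [Matrix.mulVec_mulVec, Matrix.mul_nonsing_inv _ hT, Matrix.one_mulVec]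
  have hv : ∀ y y' : Fin p → ℝ, T * Matrix.vecMulVec y y' * T.transpose =
      Matrix.vecMulVec (T.mulVec y) (T.mulVec y') := fun y y' => by
    rw [Matrix.mul_vecMulVec, Matrix.vecMulVec_mul, Matrix.vecMul_transpose]
  rw [dScat, dScat, sqDist_factor hT, add_sub_cancel_left, quadratic_standardize,
    bilinear_standardize hT]
  simp only [Matrix.mul_sub, Matrix.sub_mul, Matrix.mul_smul, Matrix.smul_mul, Matrix.mul_add,
    Matrix.add_mul, hv, hw, Matrix.mul_neg, Matrix.neg_mul, Matrix.mul_assoc]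
  simp [sqDist]

theorem dScat_comm (m x w : Fin p → ℝ) (K L : Matrix (Fin p) (Fin p) ℝ)
    {H : Matrix (Fin p) (Fin p) ℝ} (hH : H.IsSymm) (a b : Fin p) :
    dScat u₂ m K x w L H a b = dScat u₂ m K x w L H b a := by
  simp only [dScat, Matrix.sub_apply, Matrix.add_apply, Matrix.smul_apply, Matrix.vecMulVec_apply,
    hH.apply a b, smul_eq_mul]
  ring

theorem isSymm_conj {A M : Matrix (Fin p) (Fin p) ℝ} (hM : M.IsSymm) :
    (A.transpose * M * A).IsSymm := by
  rw [Matrix.IsSymm, Matrix.transpose_mul, Matrix.transpose_mul, Matrix.transpose_transpose, hM.eq,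
    Matrix.mul_assoc]

/-- Expected derivative of the location score for a rotationally invariant distribution. -/
theorem OrthInvariant.integral_dLoc {ν : Measure (Fin p → ℝ)} (hν : OrthInvariant ν) (hp : p ≠ 0)
    (hI : ∀ (ω : Fin p → ℝ) (Λ : Matrix (Fin p) (Fin p) ℝ), Λ.IsSymm → ∀ i,
      Integrable (fun z => dLoc u₁ 0 1 z ω Λ i) ν) :
    Integrable (fun z => 2 * deriv u₁ (z ⬝ᵥ z) * (z ⬝ᵥ z) + p * u₁ (z ⬝ᵥ z)) ν ∧
    ∀ (ω : Fin p → ℝ) (Λ : Matrix (Fin p) (Fin p) ℝ), Λ.IsSymm → ∀ i,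
      ∫ z, dLoc u₁ 0 1 z ω Λ i ∂ν =
        -((∫ z, (2 * deriv u₁ (z ⬝ᵥ z) * (z ⬝ᵥ z) + p * u₁ (z ⬝ᵥ z)) ∂ν) / p) * ω i := by
  have hform : ∀ (ω : Fin p → ℝ) (Λ : Matrix (Fin p) (Fin p) ℝ) (z : Fin p → ℝ) (i : Fin p),
      dLoc u₁ 0 1 z ω Λ i =
        deriv u₁ (z ⬝ᵥ z) * (z ⬝ᵥ Λ.mulVec z - 2 * (ω ⬝ᵥ z)) * z i - u₁ (z ⬝ᵥ z) * ω i :=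
    fun ω Λ z i => by simp [dLoc, sqDist]
  -- Integrability of the second order terms is read off from the direction `ω = e_k`, `Λ = 0`.
  have hq := hν.integral_quadratic hp (w := fun s => -(2 * deriv u₁ s)) (v := fun s => -u₁ s)
    fun k j => by
      refine (hI (Pi.single k 1) 0 Matrix.isSymm_zero j).congr (Eventually.of_forall fun z => ?_)
      simp only [hform, Matrix.zero_mulVec, dotProduct_zero, single_one_dotProduct,
        Matrix.one_apply, Pi.single_apply, eq_comm (a := k)]
      ring
  have hneg : ∀ z : Fin p → ℝ, -(2 * deriv u₁ (z ⬝ᵥ z)) * (z ⬝ᵥ z) + p * -u₁ (z ⬝ᵥ z) =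
      -(2 * deriv u₁ (z ⬝ᵥ z) * (z ⬝ᵥ z) + p * u₁ (z ⬝ᵥ z)) := fun z => by ring
  simp only [hneg, integral_neg] at hq
  refine ⟨integrable_neg_iff.1 hq.1, fun ω Λ hΛ i => ?_⟩
  have hsplit : ∀ z, dLoc u₁ 0 1 z ω Λ i = dLoc u₁ 0 1 z 0 Λ i + dLoc u₁ 0 1 z ω 0 i := fun z => by
    simp only [hform, Matrix.zero_mulVec, dotProduct_zero, zero_dotProduct, Pi.zero_apply]
    ring
  simp only [hsplit]
  -- The `Λ` part is cubic and odd in `z`, so a change of scatter does not affect the expected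
  -- location score.
  rw [integral_add (hI 0 Λ hΛ i) (hI ω 0 Matrix.isSymm_zero i), hν.integral_odd, zero_add]
  · rw [← neg_div, ← hq.2 ω i]
    congr 1 with z
    simp only [hform, Matrix.zero_mulVec, dotProduct_zero]
    ring
  · intro z
    simp only [hform, neg_dotProduct_neg, Matrix.mulVec_neg, zero_dotProduct, Pi.zero_apply,
      Pi.neg_apply]
    ring

/-- Expected derivative of the scatter score for a rotationally invariant distribution. -/
theorem OrthInvariant.integral_dScat {ν : Measure (Fin p → ℝ)} [IsProbabilityMeasure ν]
    (hν : OrthInvariant ν)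
    (hI : ∀ (ω : Fin p → ℝ) (Λ : Matrix (Fin p) (Fin p) ℝ), Λ.IsSymm → ∀ a b,
      Integrable (fun z => dScat u₂ 0 1 z ω Λ (-Λ) a b) ν) :
    ∃ κ : ℝ, Integrable (fun z => deriv u₂ (z ⬝ᵥ z) * (z ⬝ᵥ z) ^ 2) ν ∧
      ∫ z, deriv u₂ (z ⬝ᵥ z) * (z ⬝ᵥ z) ^ 2 ∂ν = κ * (p * (p + 2)) ∧
      ∀ (ω : Fin p → ℝ) (Λ : Matrix (Fin p) (Fin p) ℝ), Λ.IsSymm → ∀ a b,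
        ∫ z, dScat u₂ 0 1 z ω Λ (-Λ) a b ∂ν =
          ((1 + 2 * κ) • Λ + (κ * Λ.trace) • (1 : Matrix (Fin p) (Fin p) ℝ)) a b := by
  have hform : ∀ (ω : Fin p → ℝ) (Λ H : Matrix (Fin p) (Fin p) ℝ) (z : Fin p → ℝ) (a b : Fin p),
      dScat u₂ 0 1 z ω Λ H a b =
        deriv u₂ (z ⬝ᵥ z) * (z ⬝ᵥ Λ.mulVec z - 2 * (ω ⬝ᵥ z)) * (z a * z b)
          - u₂ (z ⬝ᵥ z) * (ω a * z b + z a * ω b) - H a b :=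
    fun ω Λ H z a b => by
      simp [dScat, sqDist, Matrix.vecMulVec_apply]
      ring
  -- At `ω = 0` only the quartic term and the constant `Λ a b` remain, so the quartic term is
  -- integrable by itself.
  have hI0 : ∀ Λ : Matrix (Fin p) (Fin p) ℝ, Λ.IsSymm → ∀ a b,
      Integrable (fun z => deriv u₂ (z ⬝ᵥ z) * (z ⬝ᵥ Λ.mulVec z) * (z a * z b)) ν := by
    intro Λ hΛ a b
    refine ((hI 0 Λ hΛ a b).sub (integrable_const (Λ a b))).congr (Eventually.of_forall fun z => ?_)
    simp only [Pi.sub_apply, hform, zero_dotProduct, Pi.zero_apply, Matrix.neg_apply]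
    ring
  obtain ⟨κ, hκ, hi2, hκ2⟩ := hν.integral_quartic (w := deriv u₂) fun a b c d => by
    -- The quadratic form of this symmetrized matrix unit is the monomial `z c * z d`.
    have hs : (Matrix.single c d (1 / 2 : ℝ) + Matrix.single d c (1 / 2 : ℝ)).IsSymm := by
      simp [Matrix.IsSymm, Matrix.transpose_add, Matrix.transpose_single, add_comm]
    refine (hI0 _ hs a b).congr (Eventually.of_forall fun z => ?_)
    have hup : ∀ (c : Fin p) (v : ℝ), z ⬝ᵥ Function.update 0 c v = z c * v := fun c v =>
      dotProduct_single z v c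
    simp only [Matrix.add_mulVec, Matrix.single_mulVec, dotProduct_add, hup]
    ring
  refine ⟨κ, hi2, hκ2, fun ω Λ hΛ a b => ?_⟩
  have hsplit : ∀ z, dScat u₂ 0 1 z ω Λ (-Λ) a b =
      deriv u₂ (z ⬝ᵥ z) * (z ⬝ᵥ Λ.mulVec z) * (z a * z b) + Λ a b +
        dScat u₂ 0 1 z ω 0 (-0) a b := fun z => by
    simp only [hform, Matrix.zero_mulVec, dotProduct_zero, Matrix.neg_apply, neg_zero,
      Matrix.zero_apply]
    ring
  have hi1 : Integrable (fun z => deriv u₂ (z ⬝ᵥ z) * (z ⬝ᵥ Λ.mulVec z) * (z a * z b) + Λ a b) ν :=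
    (hI0 Λ hΛ a b).add (integrable_const _)
  have hodd : ∫ z, dScat u₂ 0 1 z ω 0 (-0) a b ∂ν = 0 := hν.integral_odd fun z => by
    simp only [hform, neg_dotProduct, Matrix.zero_mulVec, dotProduct_zero, Pi.neg_apply,
      neg_zero, neg_neg, Matrix.zero_apply, dotProduct_neg]
    ring
  simp only [hsplit]
  rw [integral_add hi1 (hI ω 0 Matrix.isSymm_zero a b),
    integral_add (hI0 Λ hΛ a b) (integrable_const _), hκ Λ a b hΛ, hodd]
  simp only [integral_const, probReal_univ, Matrix.add_apply, Matrix.smul_apply,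
    smul_eq_mul]
  ring

/-- Expected derivative of the score at an elliptical distribution. The location and the scatter
components decouple, and both parts are non-singular. -/
theorem exists_coefficients {μ : Fin p → ℝ} {S V : Matrix (Fin p) (Fin p) ℝ} {g : ℝ → ℝ}
    (hp : 2 ≤ p) (hg : Measurable g) [hprob : IsProbabilityMeasure (elliptical μ S g)]
    {η : ℝ} (hη : 0 < η) (hVS : V = η • S) (hu : WeightConditions u₁ u₂)
    (hpop : PopSolution (elliptical μ S g) u₁ u₂ μ V)
    (hnd : NonDegenerate (elliptical μ S g) u₁ u₂ μ V)
    (hreg : ∀ᵐ x ∂(elliptical μ S g), DifferentiableAt ℝ u₁ (sqDist μ V⁻¹ x) ∧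
      DifferentiableAt ℝ u₂ (sqDist μ V⁻¹ x) ∧ 0 < sqDist μ V⁻¹ x)
    (hI1 : ∀ w L, L.IsSymm → ∀ j,
      Integrable (fun x => dLoc u₁ μ V⁻¹ x w L j) (elliptical μ S g))
    (hI2 : ∀ w L, L.IsSymm → ∀ a b,
      Integrable (fun x => dScat u₂ μ V⁻¹ x w L (-(V * L * V)) a b) (elliptical μ S g)) :
    ∃ δ κ : ℝ, δ ≠ 0 ∧ 1 + 2 * κ ≠ 0 ∧ 1 + 2 * κ + p * κ ≠ 0 ∧ ∀ w L, L.IsSymm →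
      (∀ j, ∫ x, dLoc u₁ μ V⁻¹ x w L j ∂(elliptical μ S g) = δ * w j) ∧
      ∀ a b, ∫ x, dScat u₂ μ V⁻¹ x w L (-(V * L * V)) a b ∂(elliptical μ S g) =
        (1 + 2 * κ) * (V * L * V) a b + κ * (L * V).trace * V a b := by
  obtain ⟨T, hT, hVT⟩ := PosDef.exists_factor hpop.posDef
  have hp0 : (0 : ℝ) < p := by exact_mod_cast (by omega : 0 < p)
  have hTt : IsUnit T.transpose.det := by rwa [Matrix.det_transpose]
  have hSinv : S⁻¹ = η • (T * T.transpose)⁻¹ := by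
    have hSV : S = η⁻¹ • V := by rw [hVS, smul_smul, inv_mul_cancel₀ hη.ne', one_smul]
    rw [hSV, ← hVT]
    refine Matrix.inv_eq_left_inv ?_
    rw [Matrix.smul_mul, Matrix.mul_smul, smul_smul, mul_inv_cancel₀ hη.ne', one_smul,
      Matrix.nonsing_inv_mul _ (PosDef.isUnit_det hpop.posDef)]
  have hν := orthInvariant_standardized (m := μ) hg hT hSinv
  have hνp : IsProbabilityMeasure (standardized (elliptical μ S g) μ T) :=
    Measure.isProbabilityMeasure_map (measurableEmbedding_standardize hT μ).measurable.aemeasurable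
  have hΛ : ∀ Λ : Matrix (Fin p) (Fin p) ℝ,
      T.transpose * (T⁻¹.transpose * Λ * T⁻¹) * T = Λ := fun Λ => by
    rw [Matrix.transpose_nonsing_inv, Matrix.mul_assoc, Matrix.mul_assoc,
      Matrix.nonsing_inv_mul _ hT, Matrix.mul_one, Matrix.mul_nonsing_inv_cancel_left _ _ hTt]
  subst hVT
  have hJ1 : ∀ (ω : Fin p → ℝ) (Λ : Matrix (Fin p) (Fin p) ℝ), Λ.IsSymm → ∀ i,
      Integrable (fun z => dLoc u₁ 0 1 z ω Λ i) (standardized (elliptical μ S g) μ T) := by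
    intro ω Λ hs i
    have h1 := integrable_mulVec (f := fun z => dLoc u₁ μ (T * T.transpose)⁻¹ (μ + T.mulVec z)
      (T.mulVec ω) (T⁻¹.transpose * Λ * T⁻¹))
      (fun j => (integrable_standardized hT).2 (hI1 (T.mulVec ω) _ (isSymm_conj hs) j)) T⁻¹ i
    simpa only [dLoc_standardize hT, inv_mulVec_mulVec hT, hΛ] using h1
  have hJ2 : ∀ (ω : Fin p → ℝ) (Λ : Matrix (Fin p) (Fin p) ℝ), Λ.IsSymm → ∀ a b,
      Integrable (fun z => dScat u₂ 0 1 z ω Λ (-Λ) a b)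
        (standardized (elliptical μ S g) μ T) := by
    intro ω Λ hs a b
    have h1 := integrable_congr_matrix (f := fun z => dScat u₂ μ (T * T.transpose)⁻¹
      (μ + T.mulVec z) (T.mulVec ω) (T⁻¹.transpose * Λ * T⁻¹)
        (-(T * T.transpose * (T⁻¹.transpose * Λ * T⁻¹) * (T * T.transpose))))
      (fun c d => (integrable_standardized hT).2 (hI2 (T.mulVec ω) _ (isSymm_conj hs) c d)) T⁻¹ a b
    have hcancel : ∀ M : Matrix (Fin p) (Fin p) ℝ,
        T⁻¹ * (T * M * T.transpose) * T⁻¹.transpose = M := fun M => by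
      rw [Matrix.mul_assoc T, Matrix.nonsing_inv_mul_cancel_left _ _ hT,
        Matrix.transpose_nonsing_inv, Matrix.mul_nonsing_inv_cancel_right _ _ hTt]
    simpa only [dScat_standardize hT, inv_mulVec_mulVec hT, hΛ, hcancel] using h1
  obtain ⟨hd1, hd2⟩ := hν.integral_dLoc (by omega) hJ1
  obtain ⟨κ, hκ1, hκ2, hκ3⟩ := hν.integral_dScat hJ2
  simp only [← sqDist_factor hT μ] at hd1 hd2 hκ1 hκ2
  rw [integrable_standardized hT (f := fun x => 2 * deriv u₁ (sqDist μ (T * T.transpose)⁻¹ x) *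
    sqDist μ (T * T.transpose)⁻¹ x + p * u₁ (sqDist μ (T * T.transpose)⁻¹ x))] at hd1
  rw [integral_standardized hT μ (fun x => 2 * deriv u₁ (sqDist μ (T * T.transpose)⁻¹ x) *
    sqDist μ (T * T.transpose)⁻¹ x + p * u₁ (sqDist μ (T * T.transpose)⁻¹ x))] at hd2
  rw [integrable_standardized hT (f := fun x => deriv u₂ (sqDist μ (T * T.transpose)⁻¹ x) *
    sqDist μ (T * T.transpose)⁻¹ x ^ 2)] at hκ1
  rw [integral_standardized hT μ (fun x => deriv u₂ (sqDist μ (T * T.transpose)⁻¹ x) *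
    sqDist μ (T * T.transpose)⁻¹ x ^ 2)] at hκ2
  have hδ := location_coefficient_pos hp hu hnd hreg hd1
  have hκpos := scatter_coefficient_pos hu hpop hnd hreg hκ1
  rw [hκ2] at hκpos
  set I := ∫ x, (2 * deriv u₁ (sqDist μ (T * T.transpose)⁻¹ x) *
    sqDist μ (T * T.transpose)⁻¹ x + p * u₁ (sqDist μ (T * T.transpose)⁻¹ x)) ∂(elliptical μ S g)
    with hIdef
  -- The positive quantity of `scatter_coefficient_pos` equals `p + κ p (p + 2) = p (1 + 2κ + pκ)`.
  have h12 : 0 < 1 + 2 * κ + p * κ := by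
    have : 0 < p * (1 + 2 * κ + p * κ) := by linarith
    exact pos_of_mul_pos_right this hp0.le
  -- This follows from `(p + 2) (1 + 2κ) = p + 2 (1 + 2κ + pκ)`.
  have h1 : 0 < 1 + 2 * κ := by
    have : 0 < (p + 2) * (1 + 2 * κ) := by linarith
    exact pos_of_mul_pos_right this (by linarith)
  refine ⟨-(I / p), κ, neg_ne_zero.2 (div_pos hδ hp0).ne', h1.ne', h12.ne', fun w L hL => ?_⟩
  refine ⟨fun j => ?_, fun a b => ?_⟩
  · rw [← integral_standardized hT μ]
    simp only [dLoc_standardize hT]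
    rw [integral_mulVec (hJ1 _ _ (isSymm_conj hL))]
    simp only [hd2 _ _ (isSymm_conj hL)]
    change T.mulVec (-(I / p) • T⁻¹.mulVec w) j = _
    rw [Matrix.mulVec_smul, Matrix.mulVec_mulVec, Matrix.mul_nonsing_inv _ hT, Matrix.one_mulVec]
    rfl
  · rw [← integral_standardized hT μ]
    simp only [dScat_standardize hT]
    rw [integral_congr_matrix (hJ2 _ _ (isSymm_conj hL))]
    simp only [hκ3 _ _ (isSymm_conj hL)]
    change (T * ((1 + 2 * κ) • (T.transpose * L * T) + (κ * (T.transpose * L * T).trace) •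
      (1 : Matrix (Fin p) (Fin p) ℝ)) * T.transpose) a b = _
    have htr : (T.transpose * L * T).trace = (L * (T * T.transpose)).trace := by
      rw [Matrix.mul_assoc, Matrix.trace_mul_comm, Matrix.mul_assoc]
    rw [htr, Matrix.mul_add, Matrix.add_mul, Matrix.mul_smul, Matrix.smul_mul, Matrix.mul_smul,
      Matrix.smul_mul, Matrix.mul_one]
    simp only [Matrix.add_apply, Matrix.smul_apply, smul_eq_mul, Matrix.mul_assoc]

end Coefficients

/-! ### Linearization of M-estimating equations -/

section Linearization

variable {Ω E ι : Type*} [MeasurableSpace Ω] [MeasurableSpace E] [Fintype ι]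
  {P : Measure Ω} {F : Measure E} {X : ℕ → Ω → E} {ψ : E → (ι → ℝ) → ι → ℝ} {Θ : Set (ι → ℝ)}
  {θ : ι → ℝ}

theorem isBigO_mulVec {α κ : Type*} [Fintype κ] {A : Matrix κ ι ℝ}
    (hA : ∀ e, A.mulVec e = 0 → e = 0) (d : α → ι → ℝ) (l : Filter α) :
    d =O[l] fun q => A.mulVec (d q) := by
  have hker : LinearMap.ker A.mulVecLin = ⊥ := LinearMap.ker_eq_bot'.2 fun e he => hA e he
  obtain ⟨K, _, hK⟩ := A.mulVecLin.exists_antilipschitzWith hker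
  refine Asymptotics.IsBigO.of_bound K (Eventually.of_forall fun q => ?_)
  have := hK.le_mul_dist (d q) 0
  simpa using this

/-- If `A d + a = o(d)` with `A` injective, then `d = O(a)`. -/
theorem isBigO_of_mulVec_add_isLittleO {α : Type*} {A : Matrix ι ι ℝ}
    (hA : ∀ e, A.mulVec e = 0 → e = 0) {d a : α → ι → ℝ} {l : Filter α}
    (h : (fun q => A.mulVec (d q) + a q) =o[l] d) : d =O[l] a := by
  have h1 := isBigO_mulVec hA d l
  have h2 := (h.trans_isBigO h1).right_isBigO_sub
  refine h1.trans (h2.trans ?_)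
  refine (Asymptotics.isBigO_refl a l).neg_left.congr_left fun q => ?_
  simp

variable [DecidableEq ι]

/-- The matrix `E_F (∂ψ_j(X; θ)/∂θ_k)`. -/
def expectedDerivative (F : Measure E) (ψ : E → (ι → ℝ) → ι → ℝ) (θ : ι → ℝ) : Matrix ι ι ℝ :=
  Matrix.of fun j k => ∫ x, partialPsi ψ θ j k x ∂F

/-- By the law of large numbers the averaged derivative plus the remainder `r` differs from its
expectation by `o(1)`, and this error multiplies the deviation of the estimator. -/
theorem MRegular.isLittleO_expansion [IsProbabilityMeasure P] (h : MRegular P X F ψ Θ θ)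
    (hind : iIndepFun X P) (hlaw : ∀ i, HasLaw (X i) F P) {θhat : ℕ → Ω → ι → ℝ}
    (hθ : IsMEstimatorSeq P X ψ Θ θhat) :
    (fun q : ℕ × Ω => (expectedDerivative F ψ θ).mulVec (θhat q.1 q.2 - θ) +
      fun j => ave q.1 fun i => ψ (X i q.2) θ j) =o[probFilter P]
        fun q => θhat q.1 q.2 - θ := by
  obtain ⟨r, hr, hexp⟩ := h.expansion θhat hθ
  have hexp' : ∀ᶠ q : ℕ × Ω in probFilter P, ∀ j,
      0 = ave q.1 (fun i => ψ (X i q.2) θ j) + ∑ k, (θhat q.1 q.2 k - θ k) *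
        (ave q.1 (fun i => partialPsi ψ θ j k (X i q.2)) + r j k q.1 q.2) :=
    eventually_probFilter.2 hexp
  refine Asymptotics.isLittleO_pi.2 fun j => ?_
  have hc : ∀ k, Tendsto (fun q : ℕ × Ω => (expectedDerivative F ψ θ) j k -
      (ave q.1 (fun i => partialPsi ψ θ j k (X i q.2)) + r j k q.1 q.2)) (probFilter P)
      (𝓝 0) := fun k => by
    have h1 := tendsto_ave hind hlaw (h.integrable_partial j k)
    have h2 := tendsto_probFilter (hr j k)
    simpa [expectedDerivative] using (h1.add h2).const_sub ((expectedDerivative F ψ θ) j k)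
  have hterm : ∀ k, (fun q : ℕ × Ω => ((expectedDerivative F ψ θ) j k -
      (ave q.1 (fun i => partialPsi ψ θ j k (X i q.2)) + r j k q.1 q.2)) *
        (θhat q.1 q.2 k - θ k)) =o[probFilter P] fun q => θhat q.1 q.2 - θ := fun k => by
    have hO : (fun q : ℕ × Ω => θhat q.1 q.2 k - θ k) =O[probFilter P]
        fun q => ‖θhat q.1 q.2 - θ‖ :=
      Asymptotics.IsBigO.of_bound 1 (Eventually.of_forall fun q => by
        simpa using norm_le_pi_norm (θhat q.1 q.2 - θ) k)
    have := ((Asymptotics.isLittleO_one_iff ℝ).2 (hc k)).mul_isBigO hO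
    simpa using this
  refine (Asymptotics.IsLittleO.fun_sum (s := Finset.univ) fun k _ => hterm k).congr' ?_
    EventuallyEq.rfl
  filter_upwards [hexp'] with q hq
  have hj := hq j
  simp only [Pi.add_apply, Matrix.mulVec, dotProduct, Pi.sub_apply]
  have hsub : ∀ (A c d : ι → ℝ), ∑ k, (A k - c k) * d k = ∑ k, A k * d k - ∑ k, d k * c k :=
    fun A c d => by
      rw [← Finset.sum_sub_distrib]
      exact Finset.sum_congr rfl fun k _ => by ring
  rw [hsub (fun k => expectedDerivative F ψ θ j k)]
  linarith

theorem sum_mul_single {D : (ι → ℝ) →ₗ[ℝ] (ι → ℝ)} (e : ι → ℝ) (j : ι) :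
    ∑ k, e k * D (Pi.single k 1) j = D e j := by
  conv_rhs => rw [← Finset.univ_sum_single e]
  rw [map_sum, Finset.sum_apply]
  refine Finset.sum_congr rfl fun k _ => ?_
  have : (Pi.single k (e k) : ι → ℝ) = e k • Pi.single k 1 := by
    rw [← Pi.single_smul, smul_eq_mul, mul_one]
  rw [this, map_smul]
  rfl

theorem integrable_directional {D : E → (ι → ℝ) →ₗ[ℝ] (ι → ℝ)}
    (hInt : ∀ j k, Integrable (partialPsi ψ θ j k) F)
    (hD : ∀ j k, partialPsi ψ θ j k =ᵐ[F] fun x => D x (Pi.single k 1) j) (e : ι → ℝ) (j : ι) :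
    Integrable (fun x => D x e j) F := by
  simp only [← sum_mul_single (D := D _) e j]
  exact integrable_finsetSum _ fun k _ => ((hInt j k).congr (hD j k)).const_mul _

theorem expectedDerivative_mulVec {D : E → (ι → ℝ) →ₗ[ℝ] (ι → ℝ)}
    (hInt : ∀ j k, Integrable (partialPsi ψ θ j k) F)
    (hD : ∀ j k, partialPsi ψ θ j k =ᵐ[F] fun x => D x (Pi.single k 1) j) (e : ι → ℝ) (j : ι) :
    (expectedDerivative F ψ θ).mulVec e j = ∫ x, D x e j ∂F := by
  simp only [← sum_mul_single (D := D _) e j]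
  rw [integral_finsetSum _ fun k _ => ((hInt j k).congr (hD j k)).const_mul _]
  rw [Matrix.mulVec, dotProduct]
  refine Finset.sum_congr rfl fun k _ => ?_
  rw [integral_const_mul, ← integral_congr_ae (hD j k), mul_comm]
  rfl

end Linearization

/-! ### Estimates as solutions of the estimating equations -/

section Estimates

variable {p : ℕ} {G : SimpleGraph (Fin p)} {u₁ u₂ : ℝ → ℝ} {n : ℕ} {x : ℕ → Fin p → ℝ}
  {m : Fin p → ℝ} {S : Matrix (Fin p) (Fin p) ℝ}

/-- The inclusion of index sets given by `K(G) ⊆ K(⊤)`. -/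
def toTop : Idx G → Idx (⊤ : SimpleGraph (Fin p)) :=
  Sum.map id fun q => ⟨q.1, mem_kPos.2 ((mem_kPos.1 q.2).imp id fun h => ⟨h.1, h.2.ne⟩)⟩

theorem mkParam_toTop (m : Fin p → ℝ) (M : Matrix (Fin p) (Fin p) ℝ) (j : Idx G) :
    mkParam ⊤ m M (toTop j) = mkParam G m M j := by
  rcases j with j | q <;> rfl

theorem ave_locationScore (h : 0 = ∑ i ∈ Finset.range n, u₁ (sqDist m S⁻¹ (x i)) • (x i - m))
    (j : Fin p) : ave n (fun i => locationScore u₁ m S (x i) j) = 0 := by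
  have := congrFun h j
  rw [Finset.sum_apply] at this
  rw [ave]
  simp only [locationScore]
  rw [← this]
  simp

theorem ave_scatterScore {a b : Fin p} (h : S a b = weightedScatter u₂ n x m S a b) :
    ave n (fun i => scatterScore u₂ m S (x i) a b) = 0 := by
  rcases Nat.eq_zero_or_pos n with rfl | hn
  · simp [ave]
  have hn' : (n : ℝ) ≠ 0 := by exact_mod_cast hn.ne'
  simp only [ave, scatterScore, Matrix.sub_apply, Finset.sum_sub_distrib, Finset.sum_const,
    Finset.card_range, nsmul_eq_mul]
  rw [weightedScatter, Matrix.smul_apply, Matrix.sum_apply, smul_eq_mul] at h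
  rw [mul_sub, ← h, inv_mul_cancel_left₀ hn', sub_self]

theorem IsMEstimate.solves (h : IsMEstimate u₁ u₂ n x m S) :
    mkParam ⊤ m S ∈ paramSet (⊤ : SimpleGraph (Fin p)) ∧
      ∀ j, ave n (fun i => psiFull u₁ u₂ (x i) (mkParam ⊤ m S) j) = 0 := by
  have hS : matPart (mkParam ⊤ m S) = S :=
    matPart_mkParam m (PosDef.isSymm h.1) (supported_top S)
  refine ⟨by rw [paramSet, Set.mem_ofPred_eq, hS]; exact h.1, fun j => ?_⟩
  simp only [psiFull, score_eq, hS, locPart_mkParam]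
  rcases j with j | q
  · exact ave_locationScore h.2.1 j
  · exact ave_scatterScore (congrFun (congrFun h.2.2 _) _)

theorem IsGraphicalMEstimate.solves (h : IsGraphicalMEstimate G u₁ u₂ n x m S) :
    mkParam G m S⁻¹ ∈ paramSet G ∧
      ∀ j, ave n (fun i => psiGraph G u₁ u₂ (x i) (mkParam G m S⁻¹) j) = 0 := by
  have hS : matPart (mkParam G m S⁻¹) = S⁻¹ :=
    matPart_mkParam m (PosDef.isSymm h.1.inv) h.2.2.2
  refine ⟨by rw [paramSet, Set.mem_ofPred_eq, hS]; exact h.1.inv, fun j => ?_⟩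
  simp only [psiGraph, score_eq, hS, locPart_mkParam,
    Matrix.nonsing_inv_nonsing_inv _ (PosDef.isUnit_det h.1)]
  rcases j with j | q
  · exact ave_locationScore h.2.1 j
  · exact ave_scatterScore (h.2.2.1 _ _ (adj_of_mem_kPos q.2))

variable {Ω : Type*} [MeasurableSpace Ω]

theorem measurable_det {M : Ω → Matrix (Fin p) (Fin p) ℝ} (hM : ∀ i j, Measurable fun ω => M ω i j) :
    Measurable fun ω => (M ω).det := by
  simp only [Matrix.det_apply]
  fun_prop

theorem measurable_inv {M : Ω → Matrix (Fin p) (Fin p) ℝ} (hM : ∀ i j, Measurable fun ω => M ω i j)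
    (i j : Fin p) : Measurable fun ω => (M ω)⁻¹ i j := by
  simp only [Matrix.inv_def, Matrix.smul_apply, Matrix.adjugate_apply, Ring.inverse_eq_inv',
    smul_eq_mul]
  refine (measurable_det hM).inv.mul (measurable_det fun a b => ?_)
  by_cases h : a = j
  · subst h
    simp only [Matrix.updateRow_self]
    exact measurable_const
  · simp only [Matrix.updateRow_ne h]
    exact hM a b

theorem measurable_mkParam {m : Ω → Fin p → ℝ} {M : Ω → Matrix (Fin p) (Fin p) ℝ}
    (hm : Measurable m) (hM : ∀ i j, Measurable fun ω => M ω i j) :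
    Measurable fun ω => mkParam G (m ω) (M ω) := by
  refine measurable_pi_iff.2 fun j => ?_
  rcases j with j | q
  · exact measurable_pi_iff.1 hm j
  · exact hM _ _

end Estimates

/-! ### The expected derivatives of the two systems -/

section Response

variable {p : ℕ} {G : SimpleGraph (Fin p)}

/-- The expected derivative of the score in a direction which changes the location by `w` and the
concentration matrix by `L`. -/
def response (G : SimpleGraph (Fin p)) (δ κ : ℝ) (V : Matrix (Fin p) (Fin p) ℝ) (w : Fin p → ℝ)
    (L : Matrix (Fin p) (Fin p) ℝ) : Idx G → ℝ :=
  mkParam G (δ • w) ((1 + 2 * κ) • (V * L * V) + (κ * (L * V).trace) • V)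

/-- Applied with `⊤` and with `G`, this makes the expected derivatives of both systems injective. It
is `eq_zero_of_pattern_eq_zero` with `α = 1 + 2κ` and `β = κ`. -/
theorem response_eq_zero {δ κ : ℝ} (hδ : δ ≠ 0) (h1 : 1 + 2 * κ ≠ 0)
    (h2 : 1 + 2 * κ + p * κ ≠ 0) {V : Matrix (Fin p) (Fin p) ℝ} (hV : V.PosDef)
    (hVG : Supported G V⁻¹) {w : Fin p → ℝ} {L : Matrix (Fin p) (Fin p) ℝ} (hL : L.IsSymm)
    (hLG : Supported G L) (h : response G δ κ V w L = 0) : w = 0 ∧ L = 0 := by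
  refine ⟨?_, eq_zero_of_pattern_eq_zero hV hVG hL hLG h1 h2 fun i j hij => ?_⟩
  · ext j
    have := congrFun h (Sum.inl j)
    simpa [response, mkParam, hδ] using this
  · have hVs := PosDef.isSymm hV
    have hs : ((1 + 2 * κ) • (V * L * V) + (κ * (L * V).trace) • V).IsSymm := by
      have : (V * L * V).IsSymm := by
        simpa only [hVs.eq] using isSymm_conj (A := V) hL
      exact (this.smul _).add (hVs.smul _)
    have := eq_on_pattern (G := G) hs Matrix.isSymm_zero
      (fun q => by simpa [response, mkParam] using congrFun h (Sum.inr q)) i j hij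
    simpa using this

end Response

/-! ### The plug-in estimator in the linearized graphical equations -/

section PlugIn

variable {p : ℕ} {G : SimpleGraph (Fin p)}

/-- The plug-in estimate `h_G(St)` satisfies the linearized graphical estimating equations. -/
theorem plugIn_expansion {α : Type*} {l : Filter α} {V : Matrix (Fin p) (Fin p) ℝ} (hV : V.PosDef)
    {k₀ : kPos G → ℝ} (hk₀ : symMat G k₀ = V⁻¹) {mt : α → Fin p → ℝ} {μ : Fin p → ℝ}
    {St : α → Matrix (Fin p) (Fin p) ℝ} {a : α → Idx (⊤ : SimpleGraph (Fin p)) → ℝ} {δ κ : ℝ}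
    (hSt : ∀ᶠ q in l, (St q).IsSymm)
    (hlim : ∀ r : kPos G, Tendsto (fun q => St q r.1.1 r.1.2) l (𝓝 (V r.1.1 r.1.2)))
    (hO : ∀ r : kPos G, (fun q => (St q - V) r.1.1 r.1.2) =O[l] a)
    (hloc : ∀ j, (fun q => δ * (mt q j - μ j) + a q (Sum.inl j)) =o[l] a)
    (hscat : ∀ r : kPos G, (fun q => -((1 + 2 * κ) * (St q - V) r.1.1 r.1.2 +
      κ * (V⁻¹ * (St q - V)).trace * V r.1.1 r.1.2) + a q (toTop (Sum.inr r))) =o[l] a) :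
    ∃ k : α → kPos G → ℝ, Tendsto k l (𝓝 k₀) ∧ (fun q => k q - k₀) =O[l] a ∧
      (∀ᶠ q in l, hG G (St q) = (symMat G (k q))⁻¹) ∧
      (fun q => response G δ κ V (mt q - μ) (symMat G (k q - k₀)) +
        fun j => a q (toTop j)) =o[l] a := by
  have hu := PosDef.isUnit_det hV
  have hVs := PosDef.isSymm hV
  have hpd : (symMat G k₀).PosDef := hk₀ ▸ hV.inv
  have hinv : (symMat G k₀)⁻¹ = V := by rw [hk₀, Matrix.nonsing_inv_nonsing_inv _ hu]
  have hVG : Supported G V⁻¹ := hk₀ ▸ symMat_supported k₀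
  have hy₀ : invEntries G k₀ = fun r => V r.1.1 r.1.2 := by
    ext r
    rw [invEntries, hinv]
  obtain ⟨f, hf1, hf2, hf3, hf4⟩ := exists_hG_param hpd
  rw [hy₀] at hf1 hf2 hf3 hf4
  have hylim : Tendsto (fun q (r : kPos G) => St q r.1.1 r.1.2) l
      (𝓝 fun r => V r.1.1 r.1.2) := tendsto_pi_nhds.2 hlim
  have hyO : (fun q => (fun r : kPos G => St q r.1.1 r.1.2) - fun r => V r.1.1 r.1.2) =O[l] a :=
    Asymptotics.isBigO_pi.2 hO
  set k : α → kPos G → ℝ := fun q => f fun r => St q r.1.1 r.1.2 with hkdef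
  have hk : Tendsto k l (𝓝 k₀) := hf1.comp hylim
  have hkO : (fun q => k q - k₀) =O[l] a := (hf2.comp_tendsto hylim).trans hyO
  refine ⟨k, hk, hkO, ?_, ?_⟩
  · filter_upwards [hylim.eventually hf4, hSt] with q hq hs
    exact hq (St q) hs rfl
  set Z : α → Matrix (Fin p) (Fin p) ℝ := fun q => V * symMat G (k q - k₀) * V with hZ
  have hZs : ∀ q, (Z q).IsSymm := fun q => by
    simpa only [hVs.eq] using isSymm_conj (A := V) (symMat_isSymm (k q - k₀))
  -- At `K(G)` the inverse of `symMat G (k q)` has the entries of `St q`, and its linearization at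
  -- `k₀` is `V - Z q`. Hence `St q - V` and `-Z q` agree there up to `o(a)`; off the pattern
  -- nothing is claimed.
  have hpos : ∀ r : kPos G, (fun q => (Z q + (St q - V)) r.1.1 r.1.2) =o[l] a := fun r => by
    have h1 := ((hasStrictFDerivAt_invEntries (PosDef.isUnit_det hpd)).hasFDerivAt.isLittleO
      |>.comp_tendsto hk).trans_isBigO hkO
    refine (Asymptotics.isLittleO_pi.1 h1 r).congr' ?_ EventuallyEq.rfl
    filter_upwards [hylim.eventually hf3] with q hq
    have h2 := congrFun hq r
    simp only [Function.comp_apply, Pi.sub_apply, ContinuousLinearMap.comp_apply]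
    rw [h2, hy₀, hinv]
    change _ - (-(V * symMat G (k q - k₀) * V) r.1.1 r.1.2) = _
    simp only [hZ, Matrix.add_apply, Matrix.sub_apply]
    ring
  have hpat : ∀ i j, (i = j ∨ G.Adj i j) → (fun q => (Z q + (St q - V)) i j) =o[l] a :=
    fun i j hij => by
      rcases mem_kPos_or hij with h | h
      · exact hpos ⟨(i, j), h⟩
      · refine (hpos ⟨(j, i), h⟩).congr' ?_ EventuallyEq.rfl
        filter_upwards [hSt] with q hq
        exact ((hZs q).add (hq.sub hVs)).apply i j
  -- This is where the model enters: `V⁻¹` vanishes at the non-edges, so the uncontrolled entries of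
  -- `St q` do not contribute to the trace.
  have htrace : (fun q => (V⁻¹ * (Z q + (St q - V))).trace) =o[l] a := by
    simp only [Matrix.trace, Matrix.diag, Matrix.mul_apply]
    refine Asymptotics.IsLittleO.fun_sum fun i _ => Asymptotics.IsLittleO.fun_sum fun j _ => ?_
    by_cases hij : j = i ∨ G.Adj j i
    · exact (hpat j i hij).const_mul_left _
    · push Not at hij
      simp only [hVG i j (fun e => hij.1 e.symm) (fun e => hij.2 e.symm), zero_mul]
      exact Asymptotics.isLittleO_zero _ _
  refine Asymptotics.isLittleO_pi.2 fun j => ?_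
  rcases j with j | r
  · exact hloc j
  · have h1 := (((hpos r).const_mul_left (1 + 2 * κ)).add
      (htrace.const_mul_left (κ * V r.1.1 r.1.2))).add (hscat r)
    refine h1.congr_left fun q => ?_
    have ht : (symMat G (k q - k₀) * V).trace = (V⁻¹ * Z q).trace := by
      simp only [hZ]
      rw [Matrix.mul_assoc, Matrix.nonsing_inv_mul_cancel_left _ _ hu]
    simp only [Pi.add_apply, response, mkParam, Sum.elim_inr, Matrix.add_apply, Matrix.smul_apply,
      smul_eq_mul, ht, Matrix.mul_add, Matrix.trace_add]
    simp only [hZ]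
    ring

end PlugIn

/-! ### Asymptotic equivalence -/

section Equivalence

variable {p : ℕ} {G : SimpleGraph (Fin p)}

theorem mkParam_sub (m m' : Fin p → ℝ) (M M' : Matrix (Fin p) (Fin p) ℝ) :
    mkParam G m M - mkParam G m' M' = mkParam G (m - m') (M - M') := by
  ext j
  rcases j with j | r <;> rfl

theorem mkParam_self (e : Idx G → ℝ) : mkParam G (locPart e) (matPart e) = e := by
  ext j
  rcases j with j | r
  · rfl
  · exact symMat_apply_mem (fun r => e (Sum.inr r)) r

theorem isBigO_toTop {α : Type*} {l : Filter α} {a : α → Idx (⊤ : SimpleGraph (Fin p)) → ℝ} :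
    (fun q (j : Idx G) => a q (toTop j)) =O[l] a :=
  Asymptotics.isBigO_pi.2 fun j => Asymptotics.IsBigO.of_bound 1 (Eventually.of_forall fun q => by
    simpa using norm_le_pi_norm (a q) (toTop j))

/-- Two estimators whose linearized estimating equations have the form `response`, driven by the
same averages `a`, agree up to `o(a)` after the map `h_G`. -/
theorem isLittleO_plugIn_sub {α : Type*} {l : Filter α} {V : Matrix (Fin p) (Fin p) ℝ}
    (hV : V.PosDef) (hVG : Supported G V⁻¹) {δ κ : ℝ} (hδ : δ ≠ 0) (h1 : 1 + 2 * κ ≠ 0)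
    (h2 : 1 + 2 * κ + p * κ ≠ 0) {μ : Fin p → ℝ} {mt mM : α → Fin p → ℝ}
    {St SM : α → Matrix (Fin p) (Fin p) ℝ} {a : α → Idx (⊤ : SimpleGraph (Fin p)) → ℝ}
    {A : Matrix (Idx (⊤ : SimpleGraph (Fin p))) (Idx (⊤ : SimpleGraph (Fin p))) ℝ}
    {B : Matrix (Idx G) (Idx G) ℝ}
    (hA : ∀ e, A.mulVec e = response ⊤ δ κ V (locPart e) (-(V⁻¹ * matPart e * V⁻¹)))
    (hB : ∀ e, B.mulVec e = response G δ κ V (locPart e) (matPart e))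
    (hSt : ∀ᶠ q in l, (St q).PosDef) (hSM : ∀ᶠ q in l, (SM q).PosDef ∧ Supported G (SM q)⁻¹)
    (hlimF : Tendsto (fun q => mkParam ⊤ (mt q) (St q)) l (𝓝 (mkParam ⊤ μ V)))
    (hlimG : Tendsto (fun q => mkParam G (mM q) (SM q)⁻¹) l (𝓝 (mkParam G μ V⁻¹)))
    (hF : (fun q => A.mulVec (mkParam ⊤ (mt q) (St q) - mkParam ⊤ μ V) + a q) =o[l]
      fun q => mkParam ⊤ (mt q) (St q) - mkParam ⊤ μ V)
    (hM : (fun q => B.mulVec (mkParam G (mM q) (SM q)⁻¹ - mkParam G μ V⁻¹) +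
      fun j => a q (toTop j)) =o[l] fun q => mkParam G (mM q) (SM q)⁻¹ - mkParam G μ V⁻¹) :
    (fun q => (mt q, (hG G (St q)).vec) - (mM q, (SM q).vec)) =o[l] a := by
  have hu := PosDef.isUnit_det hV
  have hVs := PosDef.isSymm hV
  have hVis := PosDef.isSymm hV.inv
  have hAinj : ∀ e, A.mulVec e = 0 → e = 0 := fun e he => by
    have hs : (V⁻¹ * matPart e * V⁻¹).IsSymm := by
      have := isSymm_conj (A := V⁻¹) (symMat_isSymm fun r => e (Sum.inr r))
      rwa [hVis.eq] at this
    obtain ⟨hw, hL⟩ := response_eq_zero hδ h1 h2 hV (supported_top _) hs.neg (supported_top _)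
      ((hA e).symm.trans he)
    have hz : matPart e = 0 := by
      have : V * (V⁻¹ * matPart e * V⁻¹) * V = 0 := by rw [neg_eq_zero.1 hL]; simp
      rwa [Matrix.mul_assoc V⁻¹, Matrix.mul_nonsing_inv_cancel_left _ _ hu,
        Matrix.nonsing_inv_mul_cancel_right _ _ hu] at this
    rw [← mkParam_self e, hw, hz]
    ext j
    rcases j with j | r <;> rfl
  have hBinj : ∀ e, B.mulVec e = 0 → e = 0 := fun e he => by
    obtain ⟨hw, hL⟩ := response_eq_zero hδ h1 h2 hV hVG (symMat_isSymm _) (symMat_supported _)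
      ((hB e).symm.trans he)
    rw [← mkParam_self e, hw, matPart, hL]
    ext j
    rcases j with j | r <;> rfl
  -- Both deviations are `O(a)`, so the remainders, given relative to the deviations, become `o(a)`.
  have hdO := isBigO_of_mulVec_add_isLittleO hAinj hF
  have hF' := hF.trans_isBigO hdO
  have heO := (isBigO_of_mulVec_add_isLittleO hBinj hM).trans isBigO_toTop
  have hM' := hM.trans_isBigO heO
  have hSts : ∀ᶠ q in l, (St q).IsSymm := hSt.mono fun q hq => PosDef.isSymm hq
  set k₀ : kPos G → ℝ := fun r => V⁻¹ r.1.1 r.1.2 with hk₀def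
  have hk₀ : symMat G k₀ = V⁻¹ := symMat_entries hVis hVG
  have hpd : (symMat G k₀).PosDef := hk₀ ▸ hV.inv
  have hresp : ∀ᶠ q in l, A.mulVec (mkParam ⊤ (mt q) (St q) - mkParam ⊤ μ V) =
      response ⊤ δ κ V (mt q - μ) (-(V⁻¹ * (St q - V) * V⁻¹)) := by
    filter_upwards [hSts] with q hq
    rw [hA, mkParam_sub, matPart_mkParam _ (hq.sub hVs) (supported_top _), locPart_mkParam]
  have hFj := fun j => (Asymptotics.isLittleO_pi.1 hF' j)
  obtain ⟨k, hk, hkO, hhG, hexp⟩ := plugIn_expansion (G := G) (δ := δ) (κ := κ) (mt := mt)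
    (μ := μ) (a := a) hV hk₀ hSts
    (fun r => tendsto_pi_nhds.1 hlimF (toTop (Sum.inr r)))
    (fun r => Asymptotics.isBigO_pi.1 hdO (toTop (Sum.inr r)))
    (fun j => by
      refine (hFj (Sum.inl j)).congr' ?_ EventuallyEq.rfl
      filter_upwards [hresp] with q hq
      rw [Pi.add_apply, hq]
      rfl)
    (fun r => by
      refine (hFj (toTop (Sum.inr r))).congr' ?_ EventuallyEq.rfl
      filter_upwards [hresp] with q hq
      have e1 : V * -(V⁻¹ * (St q - V) * V⁻¹) * V = -(St q - V) := by
        rw [Matrix.mul_neg, Matrix.neg_mul, Matrix.mul_assoc V⁻¹,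
          Matrix.mul_nonsing_inv_cancel_left _ _ hu, Matrix.nonsing_inv_mul_cancel_right _ _ hu]
      have e2 : (-(V⁻¹ * (St q - V) * V⁻¹) * V).trace = -(V⁻¹ * (St q - V)).trace := by
        rw [Matrix.neg_mul, Matrix.nonsing_inv_mul_cancel_right _ _ hu, Matrix.trace_neg]
      rw [Pi.add_apply, hq, response, mkParam_toTop, e1, e2]
      simp only [mkParam, Sum.elim_inr, Matrix.add_apply, Matrix.smul_apply, Matrix.neg_apply,
        smul_eq_mul]
      ring)
  set kM : α → kPos G → ℝ := fun q r => (SM q)⁻¹ r.1.1 r.1.2 with hkMdef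
  have hkM : Tendsto kM l (𝓝 k₀) :=
    tendsto_pi_nhds.2 fun r => tendsto_pi_nhds.1 hlimG (Sum.inr r)
  -- Both parameters solve the same linear system up to `o(a)`; on subtraction the driving averages
  -- cancel and `B` is injective.
  have hdiff : (fun q => Sum.elim (mt q - mM q) (k q - kM q)) =o[l] a := by
    refine (isBigO_mulVec hBinj (fun q => Sum.elim (mt q - mM q) (k q - kM q)) l).trans_isLittleO ?_
    refine (hexp.sub hM').congr_left fun q => ?_
    have e : (Sum.elim (mt q - mM q) (k q - kM q) : Idx G → ℝ) =
        Sum.elim (mt q - μ) (k q - k₀) - (mkParam G (mM q) (SM q)⁻¹ - mkParam G μ V⁻¹) := by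
      ext j
      rcases j with j | r
      · simp [mkParam]
      · simp [mkParam, hkMdef, hk₀def]
    rw [e, Matrix.mulVec_sub B (Sum.elim _ _), hB (Sum.elim (mt q - μ) (k q - k₀)),
      add_sub_add_right_eq_sub]
    rfl
  have hloc : (fun q => mt q - mM q) =o[l] a :=
    Asymptotics.isLittleO_pi.2 fun j => Asymptotics.isLittleO_pi.1 hdiff (Sum.inl j)
  have hkd : (fun q => k q - kM q) =o[l] a :=
    Asymptotics.isLittleO_pi.2 fun r => Asymptotics.isLittleO_pi.1 hdiff (Sum.inr r)
  -- Strict differentiability makes inversion Lipschitz near `k₀`, so the estimate passes from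
  -- concentration to scatter matrices.
  have hinv := (((hasStrictFDerivAt_inv_symMat (PosDef.isUnit_det hpd)).isBigO_sub).comp_tendsto
    (hk.prodMk_nhds hkM)).trans_isLittleO hkd
  have hvec : (fun q => (hG G (St q)).vec - (SM q).vec) =o[l] a := by
    refine Asymptotics.isLittleO_pi.2 fun ij => ?_
    have hij := Asymptotics.isLittleO_pi.1 (Asymptotics.isLittleO_pi.1 hinv ij.2) ij.1
    refine hij.congr' ?_ EventuallyEq.rfl
    filter_upwards [hhG, hSM] with q hq hq'
    have hs : symMat G (kM q) = (SM q)⁻¹ := symMat_entries (PosDef.isSymm hq'.1.inv) hq'.2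
    change (symMat G (k q))⁻¹ ij.2 ij.1 - (symMat G (kM q))⁻¹ ij.2 ij.1 =
      hG G (St q) ij.2 ij.1 - SM q ij.2 ij.1
    rw [hq, hs, Matrix.nonsing_inv_nonsing_inv _ (PosDef.isUnit_det hq'.1)]
  have hfin := hloc.prod_left hvec
  exact hfin

/-- The expected derivatives of both systems are given by `response` with the same coefficients. -/
theorem exists_response {Ω : Type*} [MeasurableSpace Ω] {P : Measure Ω} {X : ℕ → Ω → Fin p → ℝ}
    (hp : 2 ≤ p) {μ : Fin p → ℝ} {S V : Matrix (Fin p) (Fin p) ℝ} {g : ℝ → ℝ} (hg : Measurable g)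
    [IsProbabilityMeasure (elliptical μ S g)] {η : ℝ} (hη : 0 < η) (hVS : V = η • S)
    (hVG : Supported G V⁻¹) {u₁ u₂ : ℝ → ℝ} (hu : WeightConditions u₁ u₂)
    (hpop : PopSolution (elliptical μ S g) u₁ u₂ μ V)
    (hnd : NonDegenerate (elliptical μ S g) u₁ u₂ μ V)
    (hFull : MRegular P X (elliptical μ S g) (psiFull u₁ u₂) (paramSet ⊤) (mkParam ⊤ μ V))
    (hGraph : MRegular P X (elliptical μ S g) (psiGraph G u₁ u₂) (paramSet G)
      (mkParam G μ V⁻¹)) :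
    ∃ δ κ : ℝ, δ ≠ 0 ∧ 1 + 2 * κ ≠ 0 ∧ 1 + 2 * κ + p * κ ≠ 0 ∧
      (∀ e, (expectedDerivative (elliptical μ S g) (psiFull u₁ u₂) (mkParam ⊤ μ V)).mulVec e =
        response ⊤ δ κ V (locPart e) (-(V⁻¹ * matPart e * V⁻¹))) ∧
      ∀ e, (expectedDerivative (elliptical μ S g) (psiGraph G u₁ u₂) (mkParam G μ V⁻¹)).mulVec e =
        response G δ κ V (locPart e) (matPart e) := by
  have hV := hpop.posDef
  have hdet := PosDef.isUnit_det hV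
  have hVs := PosDef.isSymm hV
  have hVis := PosDef.isSymm hV.inv
  have hmF : matPart (mkParam ⊤ μ V) = V := matPart_mkParam μ hVs (supported_top V)
  have hmG : matPart (mkParam G μ V⁻¹) = V⁻¹ := matPart_mkParam μ hVis hVG
  have hreg := ae_regular hp (elliptical_ac μ S g) (θ := mkParam ⊤ μ V) (by rwa [hmF])
    hFull.differentiable
  rw [hmF, locPart_mkParam] at hreg
  have hDF : ∀ j k, partialPsi (psiFull u₁ u₂) (mkParam ⊤ μ V) j k =ᵐ[elliptical μ S g]
      fun x => (dScoreLin ⊤ u₁ u₂ μ V⁻¹ x ∘ₗ dirFull V⁻¹) (Pi.single k 1) j := fun j k => by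
    filter_upwards [hreg] with x hx
    have := partialPsi_psiFull (u₁ := u₁) (u₂ := u₂) (θ := mkParam ⊤ μ V) (x := x)
      (by rwa [hmF]) (by rw [hmF, locPart_mkParam]; exact hx.1)
      (by rw [hmF, locPart_mkParam]; exact hx.2.1) j k
    rw [this, hmF, locPart_mkParam]
    rfl
  have hDG : ∀ j k, partialPsi (psiGraph G u₁ u₂) (mkParam G μ V⁻¹) j k =ᵐ[elliptical μ S g]
      fun x => (dScoreLin G u₁ u₂ μ V⁻¹ x ∘ₗ dirGraph G V) (Pi.single k 1) j := fun j k => by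
    filter_upwards [hreg] with x hx
    have := partialPsi_psiGraph (u₁ := u₁) (u₂ := u₂) (θ := mkParam G μ V⁻¹) (x := x)
      (by rw [hmG]; exact hV.inv) (by rw [hmG, locPart_mkParam]; exact hx.1)
      (by rw [hmG, locPart_mkParam]; exact hx.2.1) j k
    rw [this, hmG, locPart_mkParam, Matrix.nonsing_inv_nonsing_inv _ hdet]
    rfl
  have hconj : ∀ {L : Matrix (Fin p) (Fin p) ℝ}, L.IsSymm → (-(V * L * V)).IsSymm := fun hL => by
    have := isSymm_conj (A := V) hL
    rw [hVs.eq] at this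
    exact this.neg
  -- The full system has arbitrary symmetric scatter directions; `-V L V` is the one whose
  -- concentration direction is `L`. Its integrability hypotheses therefore cover every direction
  -- needed for the coefficients.
  have hInt : ∀ (w : Fin p → ℝ) (L : Matrix (Fin p) (Fin p) ℝ), L.IsSymm → ∀ j,
      Integrable (fun x => dScore ⊤ u₁ u₂ μ V⁻¹ x w L (-(V * L * V)) j) (elliptical μ S g) :=
    fun w L hL j => by
      have := integrable_directional hFull.integrable_partial hDF (mkParam ⊤ w (-(V * L * V))) j
      simp only [LinearMap.comp_apply, dirFull_apply, locPart_mkParam,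
        matPart_mkParam w (hconj hL) (supported_top _), dScoreLin_apply] at this
      have e : -(V⁻¹ * -(V * L * V) * V⁻¹) = L := by
        rw [Matrix.mul_neg, Matrix.neg_mul, neg_neg, Matrix.mul_assoc V,
          Matrix.nonsing_inv_mul_cancel_left _ _ hdet, Matrix.mul_nonsing_inv_cancel_right _ _ hdet]
      rwa [e] at this
  obtain ⟨δ, κ, hδ, h1, h2, h⟩ := exists_coefficients hp hg hη hVS hu hpop hnd hreg
    (fun w L hL j => hInt w L hL (Sum.inl j))
    (fun w L hL a b => by
      have hab : a = b ∨ (⊤ : SimpleGraph (Fin p)).Adj a b := by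
        simpa using em (a = b)
      rcases mem_kPos_or hab with hm | hm
      · exact hInt w L hL (Sum.inr ⟨(a, b), hm⟩)
      · simp only [dScat_comm (u₂ := u₂) μ _ w V⁻¹ L (hconj hL) a b]
        exact hInt w L hL (Sum.inr ⟨(b, a), hm⟩))
  refine ⟨δ, κ, hδ, h1, h2, fun e => ?_, fun e => ?_⟩
  · ext j
    rw [expectedDerivative_mulVec hFull.integrable_partial hDF]
    simp only [LinearMap.comp_apply, dirFull_apply, dScoreLin_apply]
    set L := -(V⁻¹ * matPart e * V⁻¹) with hL
    have hLs : L.IsSymm := by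
      have := isSymm_conj (A := V⁻¹) (symMat_isSymm fun r => e (Sum.inr r))
      rw [hVis.eq] at this
      exact this.neg
    have hH : matPart e = -(V * L * V) := by
      rw [hL, Matrix.mul_neg, Matrix.neg_mul, neg_neg, Matrix.mul_assoc V⁻¹,
        Matrix.mul_nonsing_inv_cancel_left _ _ hdet, Matrix.nonsing_inv_mul_cancel_right _ _ hdet]
    rw [hH]
    rcases j with j | r
    · exact (h (locPart e) L hLs).1 j
    · exact (h (locPart e) L hLs).2 _ _
  · ext j
    rw [expectedDerivative_mulVec hGraph.integrable_partial hDG]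
    simp only [LinearMap.comp_apply, dirGraph_apply, dScoreLin_apply]
    have hLs : (matPart e).IsSymm := symMat_isSymm _
    rcases j with j | r
    · exact (h (locPart e) (matPart e) hLs).1 j
    · exact (h (locPart e) (matPart e) hLs).2 _ _

theorem tendstoInMeasure_plugIn_sub {Ω : Type*} [MeasurableSpace Ω] {P : Measure Ω}
    [IsProbabilityMeasure P] {X : ℕ → Ω → Fin p → ℝ} (hp : 2 ≤ p) {μ : Fin p → ℝ}
    {S V : Matrix (Fin p) (Fin p) ℝ} {g : ℝ → ℝ} (hg : Measurable g)
    [IsProbabilityMeasure (elliptical μ S g)] (hind : iIndepFun X P)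
    (hlaw : ∀ i, HasLaw (X i) (elliptical μ S g) P) {η : ℝ} (hη : 0 < η) (hVS : V = η • S)
    (hVG : Supported G V⁻¹) {u₁ u₂ : ℝ → ℝ} (hu : WeightConditions u₁ u₂)
    (hpop : PopSolution (elliptical μ S g) u₁ u₂ μ V)
    (hnd : NonDegenerate (elliptical μ S g) u₁ u₂ μ V)
    (hFull : MRegular P X (elliptical μ S g) (psiFull u₁ u₂) (paramSet ⊤) (mkParam ⊤ μ V))
    (hGraph : MRegular P X (elliptical μ S g) (psiGraph G u₁ u₂) (paramSet G)
      (mkParam G μ V⁻¹))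
    {μn μM : ℕ → Ω → Fin p → ℝ} {Sn SM : ℕ → Ω → Matrix (Fin p) (Fin p) ℝ}
    (hμn : ∀ n, Measurable (μn n)) (hSn : ∀ n i j, Measurable fun ω => Sn n ω i j)
    (hn : ∀ᶠ q in probFilter P,
      IsMEstimate u₁ u₂ q.1 (fun i => X i q.2) (μn q.1 q.2) (Sn q.1 q.2))
    (hμM : ∀ n, Measurable (μM n)) (hSM : ∀ n i j, Measurable fun ω => SM n ω i j)
    (hM : ∀ᶠ q in probFilter P,
      IsGraphicalMEstimate G u₁ u₂ q.1 (fun i => X i q.2) (μM q.1 q.2) (SM q.1 q.2)) :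
    TendstoInMeasure P
      (fun (n : ℕ) ω => Real.sqrt n •
        ((μn n ω, (hG G (Sn n ω)).vec) - (μM n ω, (SM n ω).vec))) atTop (fun _ => 0) := by
  have hV := hpop.posDef
  have hVis := PosDef.isSymm hV.inv
  obtain ⟨δ, κ, hδ, h1, h2, hA, hB⟩ := exists_response hp hg hη hVS hVG hu hpop hnd hFull hGraph
  have hseqF : IsMEstimatorSeq P X (psiFull u₁ u₂) (paramSet ⊤)
      fun n ω => mkParam ⊤ (μn n ω) (Sn n ω) :=
    ⟨fun n => measurable_mkParam (hμn n) (hSn n),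
      eventually_probFilter.1 (hn.mono fun _ hq => hq.solves)⟩
  have hseqG : IsMEstimatorSeq P X (psiGraph G u₁ u₂) (paramSet G)
      fun n ω => mkParam G (μM n ω) (SM n ω)⁻¹ :=
    ⟨fun n => measurable_mkParam (hμM n) (measurable_inv (hSM n)),
      eventually_probFilter.1 (hM.mono fun _ hq => hq.solves)⟩
  -- At the common population value the graphical score is a subvector of the full one, so the same
  -- averages drive both expansions.
  have hψ : ∀ x j, psiGraph G u₁ u₂ x (mkParam G μ V⁻¹) j =
      psiFull u₁ u₂ x (mkParam ⊤ μ V) (toTop j) := fun x j => by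
    rw [psiGraph, psiFull, matPart_mkParam _ hVis hVG,
      matPart_mkParam _ (PosDef.isSymm hV) (supported_top _), locPart_mkParam, locPart_mkParam,
      Matrix.nonsing_inv_nonsing_inv _ (PosDef.isUnit_det hV), score_eq, score_eq, mkParam_toTop]
  have hexpF := hFull.isLittleO_expansion hind hlaw hseqF
  have hexpG := hGraph.isLittleO_expansion hind hlaw hseqG
  simp only [hψ] at hexpG
  have hSnpd : ∀ᶠ q : ℕ × Ω in probFilter P, (Sn q.1 q.2).PosDef := hn.mono fun _ hq => hq.1
  have hSMpd : ∀ᶠ q : ℕ × Ω in probFilter P,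
      (SM q.1 q.2).PosDef ∧ Supported G (SM q.1 q.2)⁻¹ := hM.mono fun _ hq => ⟨hq.1, hq.2.2.2⟩
  have hlimF := tendsto_probFilter (hFull.consistent _ hseqF)
  have hlimG := tendsto_probFilter (hGraph.consistent _ hseqG)
  have hD :=
    isLittleO_plugIn_sub (mt := fun q : ℕ × Ω => μn q.1 q.2) (St := fun q : ℕ × Ω => Sn q.1 q.2)
      (mM := fun q : ℕ × Ω => μM q.1 q.2) (SM := fun q : ℕ × Ω => SM q.1 q.2)
      (a := fun q j => ave q.1 fun i => psiFull u₁ u₂ (X i q.2) (mkParam ⊤ μ V) j)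
      hV hVG hδ h1 h2 hA hB hSnpd hSMpd hlimF hlimG hexpF hexpG
  have htight := fun j => ave_tight (f := fun x => psiFull u₁ u₂ x (mkParam ⊤ μ V) j) hind hlaw
    (hFull.solution.2 j).1 (hFull.integrable_mul j j) (hFull.solution.2 j).2
  have hfin := tendstoInMeasure_sqrt_smul hD htight
  exact hfin

end Equivalence

end GraphicalM

end

/-! ### The main theorem -/

theorem theorem2
    {p : ℕ} (hp : 2 ≤ p) (G : SimpleGraph (Fin p))
    {Ω : Type*} [MeasurableSpace Ω] (P : Measure Ω) [IsProbabilityMeasure P]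
    -- the elliptical graphical model
    (μ : Fin p → ℝ) (S : Matrix (Fin p) (Fin p) ℝ) (hS : S.PosDef)
    (hSG : S⁻¹ ∈ GraphicalM.posDefGraph G)
    (g : ℝ → ℝ) (hg : Measurable g) (hg_nonneg : ∀ s, 0 ≤ s → 0 ≤ g s)
    (hg_prob : IsProbabilityMeasure (GraphicalM.elliptical μ S g))
    -- the i.i.d. sample
    (X : ℕ → Ω → Fin p → ℝ) (hX_indep : iIndepFun X P)
    (hX_law : ∀ i, HasLaw (X i) (GraphicalM.elliptical μ S g) P)
    -- the weight functions
    (u₁ u₂ : ℝ → ℝ) (hu : GraphicalM.WeightConditions u₁ u₂)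
    -- regularity of the unrestricted and of the graphical estimating equations
    (θF : GraphicalM.Idx (⊤ : SimpleGraph (Fin p)) → ℝ)
    (hFull : GraphicalM.MRegular P X (GraphicalM.elliptical μ S g)
      (GraphicalM.psiFull u₁ u₂) (GraphicalM.paramSet ⊤) θF)
    (θG : GraphicalM.Idx G → ℝ)
    (hGraph : GraphicalM.MRegular P X (GraphicalM.elliptical μ S g)
      (GraphicalM.psiGraph G u₁ u₂) (GraphicalM.paramSet G) θG)
    (hnd : GraphicalM.NonDegenerate (GraphicalM.elliptical μ S g) u₁ u₂
      (GraphicalM.locPart θF) (GraphicalM.matPart θF))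
    -- the M-estimator `(μn, Sn)`
    (μn : ℕ → Ω → Fin p → ℝ) (Sn : ℕ → Ω → Matrix (Fin p) (Fin p) ℝ)
    (hμn : ∀ n, Measurable (μn n)) (hSn : ∀ n i j, Measurable fun ω => Sn n ω i j)
    (hn : Tendsto (fun n => P {ω | ¬ GraphicalM.IsMEstimate u₁ u₂ n (fun i => X i ω)
      (μn n ω) (Sn n ω)}) atTop (𝓝 0))
    -- the graphical M-estimator `(μM, SM)`
    (μM : ℕ → Ω → Fin p → ℝ) (SM : ℕ → Ω → Matrix (Fin p) (Fin p) ℝ)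
    (hμM : ∀ n, Measurable (μM n)) (hSM : ∀ n i j, Measurable fun ω => SM n ω i j)
    (hM : Tendsto (fun n => P {ω | ¬ GraphicalM.IsGraphicalMEstimate G u₁ u₂ n (fun i => X i ω)
      (μM n ω) (SM n ω)}) atTop (𝓝 0)) :
    TendstoInMeasure P
      (fun (n : ℕ) ω => Real.sqrt n •
        ((μn n ω, (GraphicalM.hG G (Sn n ω)).vec) - (μM n ω, (SM n ω).vec)))
      atTop (fun _ => 0) := by
  have hpop := GraphicalM.PopSolution.of_isMFunctional hFull.solution
  -- Uniqueness of the parameter vector is translated into uniqueness of the pair of location and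
  -- scatter matrix.
  obtain ⟨hm, η, hη, hVS⟩ := hpop.eq_elliptical (by omega) hS hg fun m' V' h' => by
    rw [← hFull.unique _ h'.isMFunctional_full]
    exact ⟨(GraphicalM.locPart_mkParam _ _).symm, (GraphicalM.matPart_mkParam m'
      (GraphicalM.PosDef.isSymm h'.posDef) (GraphicalM.supported_top _)).symm⟩
  have hθF := GraphicalM.mkParam_self θF
  rw [hm] at hpop hnd hθF
  rw [← hθF] at hFull
  -- The population concentration matrix is `η⁻¹ S⁻¹` and inherits the zero pattern.
  have hVG : GraphicalM.Supported G (GraphicalM.matPart θF)⁻¹ := fun i j hij hadj => by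
    have : (GraphicalM.matPart θF)⁻¹ = η⁻¹ • S⁻¹ := by
      rw [hVS]
      refine Matrix.inv_eq_left_inv ?_
      rw [Matrix.smul_mul, Matrix.mul_smul, smul_smul, inv_mul_cancel₀ hη.ne', one_smul,
        Matrix.nonsing_inv_mul _ (GraphicalM.PosDef.isUnit_det hS)]
    rw [this, Matrix.smul_apply, hSG.2 i j hij hadj, smul_zero]
  -- The full population solution also solves the graphical population equations, so uniqueness
  -- identifies it with `θG`.
  rw [← hGraph.unique _ (hpop.isMFunctional_graph hVG)] at hGraph
  exact GraphicalM.tendstoInMeasure_plugIn_sub hp hg hX_indep hX_law hη hVS hVG hu hpop hnd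
    hFull hGraph hμn hSn (GraphicalM.eventually_probFilter.2 hn) hμM hSM
    (GraphicalM.eventually_probFilter.2 hM)
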